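/- All graphs are finite, simple and undirected. A graph is \emph{CIS} if every inclusion-maximal clique intersects every inclusion-maximal stable set; it is \emph{vertex-transitive} if for any two vertices there is an automorphism mapping one to the other; it has \emph{valency} $k$ if every vertex has exactly $k$ neighbours. $K_n$, $K_{m,n}$, $C_n$ denote the complete, complete bipartite and cycle graphs, $\overline{\Gamma}$ the complement and $L(\Gamma)$ the line graph of $\Gamma$. The lexicographic product $\Gamma_1[\Gamma_2]$ has vertex set $V(\Gamma_1)\times V(\Gamma_2)$, with $(u,x)$ and $(v,y)$ adjacent if and only if $u,v$ are adjacent in $\Gamma_1$, or $u=v$ and $x,y$ are adjacent in $\Gamma_2$. For $n\ge 3$, $Q_n$ is the graph with vertex set $\mathbb{Z}_n\times\mathbb{Z}_2\times\mathbb{Z}_2$ whose edges are all pairs $\{(i,x,y),(i+1,y,z)\}$ and all pairs $\{(i,x,y),(i,u,v)\}$ with $(x,y)\neq(u,v)$. \textbf{Theorem.} Let $\Gamma$ be a connected vertex-transitive graph of valency at most $7$. Then $\Gamma$ is CIS if and only if $\Gamma$ is isomorphic to one of the following graphs: $K_n$ ($1\le n\le 8$), $K_{n,n}$ ($2\le n\le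 7$), $L(K_{3,3})$, $L(K_{4,4})$, $C_4[K_2]$, $K_3[\overline{K_2}]$, $K_3[\overline{K_3}]$, $K_4[\overline{K_2}]$, $K_{3,3}[K_2]$, or $Q_n$ for some $n\ge 4$. In particular, up to isomorphism there are only finitely many connected vertex-transitive CIS graphs of valency at most $6$, whereas the graphs $Q_n$, $n\ge 4$, are pairwise non-isomorphic connected vertex-transitive CIS graphs of valency $7$. -/

import Mathlib

namespace CISGraph

/-- A graph is CIS if every (inclusion-)maximal clique meets every (inclusion-)maximal
stable set. -/
def IsCIS {V : Type*} (G : SimpleGraph V) : Prop :=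
  ∀ C S : Set V, Maximal G.IsClique C → Maximal G.IsIndepSet S → (C ∩ S).Nonempty

/-- A graph is vertex-transitive if any vertex can be mapped to any other by an automorphism. -/
def IsVertexTransitive {V : Type*} (G : SimpleGraph V) : Prop :=
  ∀ u v : V, ∃ φ : G ≃g G, φ u = v

/-- `G` has valency `k`: every vertex has exactly `k` neighbours. -/
def HasValency {V : Type*} (G : SimpleGraph V) (k : ℕ) : Prop :=
  ∀ v : V, (G.neighborSet v).encard = k

/-- Having valency `k` is the same as being `k`-regular in the sense of Mathlib. -/
theorem hasValency_iff {V : Type*} (G : SimpleGraph V) [G.LocallyFinite] (k : ℕ) :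
    HasValency G k ↔ G.IsRegularOfDegree k := by
  unfold HasValency SimpleGraph.IsRegularOfDegree
  refine forall_congr' fun v => ?_
  rw [← SimpleGraph.coe_neighborFinset, Set.encard_coe_eq_coe_finsetCard,
    SimpleGraph.card_neighborFinset_eq_degree]
  exact Nat.cast_inj

/-- The lexicographic product `G[H]`. -/
def lexProduct {V W : Type*} (G : SimpleGraph V) (H : SimpleGraph W) : SimpleGraph (V × W) where
  Adj p q := G.Adj p.1 q.1 ∨ (p.1 = q.1 ∧ H.Adj p.2 q.2)
  symm := ⟨fun _ _ h => h.imp (fun h => h.symm) (fun h => ⟨h.1.symm, h.2.symm⟩)⟩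
  loopless := ⟨fun _ h => h.elim (fun h => h.ne rfl) (fun h => h.2.ne rfl)⟩

/-- The graph `PX(n)` (used for `n ≥ 3`): its edges are the pairs `{(i, x, y), (i + 1, y, z)}`. -/
def graphPX (n : ℕ) : SimpleGraph (ZMod n × ZMod 2 × ZMod 2) :=
  SimpleGraph.fromRel fun p q => q.1 = p.1 + 1 ∧ q.2.1 = p.2.2

/-- The graph `Q_n` (used for `n ≥ 3`): `PX(n)` together with all edges
`{(i, x, y), (i, u, v)}` where `(x, y) ≠ (u, v)`. -/
def graphQ (n : ℕ) : SimpleGraph (ZMod n × ZMod 2 × ZMod 2) :=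
  graphPX n ⊔ SimpleGraph.fromRel fun p q => p.1 = q.1

end CISGraph

/-! Two tools carry the classification. First, if C is a maximal clique, S a maximal stable set and
g an automorphism, then gC and S share exactly one vertex. Counting triples (g, c, s) with g c = s
therefore gives |C| |S| |Aut_v| = |Aut|, so all maximal cliques have one common size w
(`IsCIS.card_mul_card`). Second, no stable set can dominate a maximal clique
(`IsPureCIS.not_dominated`): vertices attached to a clique so as to dominate it cannot be pairwise
non-adjacent. The bound k ≤ 7 enters through counting inside neighbourhoods.

A non-complete graph falls into one of three cases. If two vertices have the same open
neighbourhood, then every vertex has such a twin and one maximal clique represents all twin classes,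
so the graph is complete multipartite. If there are only closed twins, the quotient by them is
triangle-free and each of its paths of length three closes up; the quotient is K_{j,j}, the classes
have size two, and j is 2 or 3.

Without twins of either kind, either distinct maximal cliques meet in at most one vertex or (w, k) =
(4, 7). In the linear case counting leaves w = 3 or 4. When k = 2(w - 1), every vertex lies on two
cliques and domination forces a grid, hence L(K_{w,w}). For w = 3 parity excludes odd k, and k = 6
is excluded by a separate argument; linear graphs with w = 4, k = 7 join the remaining case.

For (w, k) = (4, 7) the seven neighbours of a vertex form three cliques arranged in a path
(`IsLocallyQ.exists_frame`). Hence each vertex lies on exactly two heavy edges, those in two maximal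
cliques. Domination forces the heavy edges to form 4-cycles inside 4-cliques, the layers. The
quotient by layers is a cycle, and consecutive layers are joined by matching binary labels, which is
the description of Q_n; n = 3 fails because Q_3 has a maximal triangle.

Conversely, lexicographic products preserve CIS, and grids and the graphs Q_n are checked by showing
that a maximal stable set meets every line, respectively every layer. The sporadic graphs have at
most 16 vertices and Q_n has valency 7, whence the finiteness statement. -/

namespace CISGraph

open Finset

/-! ### Maximal cliques and stable sets; the counting identity. -/

section Basics

variable {V W : Type*}

theorem maximal_isClique_iff {G : SimpleGraph V} {C : Set V} :
    Maximal G.IsClique C ↔ G.IsClique C ∧ ∀ v, (∀ c ∈ C, v ≠ c → G.Adj v c) → v ∈ C := by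
  constructor
  · refine fun h => ⟨h.1, fun v hv => ?_⟩
    exact h.2 (h.1.insert fun c hc hvc => hv c hc hvc) (Set.subset_insert v C)
      (Set.mem_insert v C)
  · refine fun h => ⟨h.1, fun D hD hCD v hv => h.2 v fun c hc hvc => ?_⟩
    exact hD hv (hCD hc) hvc

theorem maximal_isIndepSet_iff {G : SimpleGraph V} {S : Set V} :
    Maximal G.IsIndepSet S ↔
      G.IsIndepSet S ∧ ∀ v, (∀ c ∈ S, v ≠ c → ¬ G.Adj v c) → v ∈ S := by
  constructor
  · refine fun h => ⟨h.1, fun v hv => ?_⟩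
    refine h.2 (y := insert v S) ?_ (Set.subset_insert v S) (Set.mem_insert v S)
    exact h.1.insert fun c hc hvc => ⟨hv c hc hvc, fun h' => hv c hc hvc h'.symm⟩
  · refine fun h => ⟨h.1, fun D hD hCD v hv => h.2 v fun c hc hvc => ?_⟩
    exact hD hv (hCD hc) hvc

theorem IsCIS.of_iso {G : SimpleGraph V} {H : SimpleGraph W} (e : G ≃g H) (hH : IsCIS H) :
    IsCIS G := by
  intro C S hC hS
  rw [maximal_isClique_iff] at hC
  rw [maximal_isIndepSet_iff] at hS
  obtain ⟨w, ⟨c, hc, rfl⟩, ⟨s, hs, hcs⟩⟩ := hH (e '' C) (e '' S)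
    (maximal_isClique_iff.2 ⟨by
      rintro _ ⟨a, ha, rfl⟩ _ ⟨b, hb, rfl⟩ hab
      exact e.map_adj_iff.2 (hC.1 ha hb (fun h => hab (h ▸ rfl))), fun v hv => by
      refine ⟨e.symm v, hC.2 _ fun c hc hvc => ?_, e.apply_symm_apply v⟩
      rw [← e.map_adj_iff, e.apply_symm_apply]
      exact hv _ ⟨c, hc, rfl⟩ fun h => hvc (by rw [h, e.symm_apply_apply])⟩)
    (maximal_isIndepSet_iff.2 ⟨by
      rintro _ ⟨a, ha, rfl⟩ _ ⟨b, hb, rfl⟩ hab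
      exact fun h => hS.1 ha hb (fun h => hab (h ▸ rfl)) (e.map_adj_iff.1 h), fun v hv => by
      refine ⟨e.symm v, hS.2 _ fun c hc hvc => ?_, e.apply_symm_apply v⟩
      rw [← e.map_adj_iff, e.apply_symm_apply]
      exact hv _ ⟨c, hc, rfl⟩ fun h => hvc (by rw [h, e.symm_apply_apply])⟩)
  exact ⟨c, hc, by rwa [← e.injective hcs]⟩

theorem IsCIS.exists_maximal_clique [Finite V] {G : SimpleGraph V} {s : Set V}
    (hs : G.IsClique s) : ∃ C, s ⊆ C ∧ Maximal G.IsClique C :=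
  Finite.exists_le_maximal hs

theorem IsCIS.exists_maximal_indepSet [Finite V] {G : SimpleGraph V} {s : Set V}
    (hs : G.IsIndepSet s) : ∃ C, s ⊆ C ∧ Maximal G.IsIndepSet C :=
  Finite.exists_le_maximal hs

/-- Double counting of the triples (g, c, s) with g c = s. Here N is the order of a point stabiliser
and M that of the automorphism group. Positivity of M later allows cancellation. -/
theorem IsCIS.card_mul_card [Fintype V] [DecidableEq V] {G : SimpleGraph V} (hG : IsCIS G)
    (hvt : IsVertexTransitive G) (v : V) :
    ∃ N M : ℕ, 0 < M ∧ ∀ C S : Finset V, Maximal G.IsClique (C : Set V) →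
      Maximal G.IsIndepSet (S : Set V) → C.card * S.card * N = M := by
  classical
  have : Finite (G ≃g G) := DFunLike.finite _
  have := Fintype.ofFinite (G ≃g G)
  refine ⟨(univ.filter fun g : G ≃g G => g v = v).card, Fintype.card (G ≃g G),
    Fintype.card_pos_iff.2 ⟨SimpleGraph.Iso.refl⟩, fun C S hC hS => ?_⟩
  have hN : ∀ c s, (univ.filter fun g : G ≃g G => g c = s).card =
      (univ.filter fun g : G ≃g G => g v = v).card := by
    intro c s
    obtain ⟨f, hf⟩ := hvt c v
    obtain ⟨h, hh⟩ := hvt s v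
    -- With f c = v and h s = v, the map g ↦ h g f⁻¹ turns automorphisms taking c to s into
    -- automorphisms fixing v.
    refine Finset.card_bij' (fun g _ => (f.symm.trans g).trans h)
      (fun g _ => (f.trans g).trans h.symm) ?_ ?_ ?_ ?_
    · intro g hg
      simp only [mem_filter, mem_univ, true_and] at hg ⊢
      simp only [RelIso.trans_apply, ← hf, RelIso.symm_apply_apply, hg]
      rw [hh, hf]
    · intro g hg
      simp only [mem_filter, mem_univ, true_and] at hg ⊢
      simp only [RelIso.trans_apply, hf, hg]
      rw [← hh, RelIso.symm_apply_apply]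
    · intro g hg; ext x; simp
    · intro g hg; ext x; simp
  -- The image gC is again a maximal clique, so it meets S; a clique and a stable set never share
  -- two vertices.
  have h1 : ∀ g : G ≃g G, ∑ c ∈ C, ∑ s ∈ S, (if g c = s then 1 else 0) = 1 := by
    intro g
    rw [maximal_isClique_iff] at hC
    have hgC : Maximal G.IsClique (g '' (C : Set V)) := maximal_isClique_iff.2 ⟨by
      rintro _ ⟨a, ha, rfl⟩ _ ⟨b, hb, rfl⟩ hab
      exact g.map_adj_iff.2 (hC.1 ha hb (fun h => hab (h ▸ rfl))), fun v hv => by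
      refine ⟨g.symm v, hC.2 _ fun c hc hvc => ?_, g.apply_symm_apply v⟩
      rw [← g.map_adj_iff, g.apply_symm_apply]
      exact hv _ ⟨c, hc, rfl⟩ fun h => hvc (by rw [h, g.symm_apply_apply])⟩
    obtain ⟨_, ⟨c, hc, rfl⟩, hs⟩ := hG _ _ hgC hS
    have hc' : c ∈ C := hc
    have hs' : g c ∈ S := hs
    simp only [Finset.sum_ite_eq]
    rw [Finset.sum_eq_single_of_mem c hc']
    · simp [hs']
    · intro b hb hbc
      rw [if_neg]
      intro hbs
      have := hC.1 (show b ∈ (C : Set V) from hb) hc hbc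
      exact hS.1 (show g b ∈ (S : Set V) from hbs) hs (fun h => hbc (g.injective h))
        (g.map_adj_iff.2 this)
  calc C.card * S.card * (univ.filter fun g : G ≃g G => g v = v).card
      = ∑ c ∈ C, ∑ s ∈ S, (univ.filter fun g : G ≃g G => g c = s).card := by
        simp only [hN, sum_const, smul_eq_mul]; ring
    _ = ∑ c ∈ C, ∑ s ∈ S, ∑ g : G ≃g G, (if g c = s then 1 else 0) := by
        simp only [card_filter]
    _ = ∑ g : G ≃g G, ∑ c ∈ C, ∑ s ∈ S, (if g c = s then 1 else 0) := by
        simp_rw [Finset.sum_comm (s := S)]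
        exact Finset.sum_comm
    _ = Fintype.card (G ≃g G) := by simp only [h1, sum_const, smul_eq_mul, mul_one]; rfl

end Basics

/-- A finite connected regular CIS graph all of whose maximal cliques have the same size `w`. -/
structure IsPureCIS {V : Type*} [Fintype V] [DecidableEq V] (G : SimpleGraph V)
    [DecidableRel G.Adj] (k w : ℕ) : Prop where
  cis : IsCIS G
  conn : G.Connected
  deg : ∀ v, (G.neighborFinset v).card = k
  ext : ∀ s : Finset V, G.IsClique s → ∃ C, s ⊆ C ∧ G.IsNClique w C

/-! ### Regular CIS graphs with maximal cliques of one size. -/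

section Pure

variable {V : Type*} [Fintype V] [DecidableEq V] {G : SimpleGraph V} [DecidableRel G.Adj]
  {k w : ℕ}

theorem IsCIS.exists_isPureCIS (hG : IsCIS G) (hconn : G.Connected)
    (hvt : IsVertexTransitive G) (hk : HasValency G k) : ∃ w, IsPureCIS G k w := by
  obtain ⟨v⟩ := hconn.nonempty
  obtain ⟨N, M, hM, h⟩ := hG.card_mul_card hvt v
  obtain ⟨S, -, hS⟩ := IsCIS.exists_maximal_indepSet (G := G) (s := ∅) (by simp)
  obtain ⟨C₀, -, hC₀⟩ := IsCIS.exists_maximal_clique (G := G) (s := ∅) (by simp)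
  lift S to Finset V using Set.toFinite S
  lift C₀ to Finset V using Set.toFinite C₀
  refine ⟨C₀.card, hG, hconn, fun v => ?_, fun s hs => ?_⟩
  · exact ((hasValency_iff G k).1 hk) v
  · obtain ⟨C, hsC, hC⟩ := IsCIS.exists_maximal_clique hs
    lift C to Finset V using Set.toFinite C
    refine ⟨C, by exact_mod_cast hsC, hC.1, ?_⟩
    have h1 := h C S hC hS
    have h2 := h C₀ S hC₀ hS
    have h3 : C.card * (S.card * N) = C₀.card * (S.card * N) := by rw [← mul_assoc, ← mul_assoc, h1, h2]
    refine Nat.eq_of_mul_eq_mul_right ?_ h3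
    by_contra h4
    have : S.card * N = 0 := by omega
    rw [mul_assoc, this] at h1
    omega

namespace IsPureCIS

variable (h : IsPureCIS G k w)
include h

theorem card_le {s : Finset V} (hs : G.IsClique s) : s.card ≤ w := by
  obtain ⟨C, hsC, hC⟩ := h.ext s hs
  exact hC.card_eq ▸ card_le_card hsC

theorem maximal {C : Finset V} (hC : G.IsNClique w C) : Maximal G.IsClique (C : Set V) := by
  refine maximal_isClique_iff.2 ⟨hC.isClique, fun v hv => ?_⟩
  by_contra hvC
  have := h.card_le (s := insert v C) (by
    rw [coe_insert]
    exact hC.isClique.insert fun c hc hvc => hv c hc hvc)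
  rw [card_insert_of_notMem (by exact_mod_cast hvC), hC.card_eq] at this
  omega

/-- A stable set cannot dominate a maximal clique. -/
theorem not_dominated {C : Finset V} (hC : G.IsNClique w C) {S : Set V}
    (hS : G.IsIndepSet S) (hd : ∀ c ∈ C, ∃ s ∈ S, G.Adj c s) : False := by
  obtain ⟨T, hST, hT⟩ := IsCIS.exists_maximal_indepSet hS
  obtain ⟨c, hc, hcT⟩ := h.cis _ _ (h.maximal hC) hT
  obtain ⟨s, hs, hcs⟩ := hd c hc
  exact hT.1 hcT (hST hs) hcs.ne hcs

/-- Two adjacent maximal cliques (differing in one vertex) differ in a pair of open twins. -/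
theorem open_twin {C : Finset V} (hC : G.IsNClique w C) {a x : V} (hx : x ∉ C)
    (hadj : ∀ c ∈ C, c ≠ a → G.Adj x c) : ∀ v, G.Adj a v ↔ G.Adj x v := by
  have hsub : G.neighborFinset a ⊆ G.neighborFinset x := by
    intro p hp
    rw [SimpleGraph.mem_neighborFinset] at hp ⊢
    by_contra hpx
    by_cases hpC : p ∈ C
    · exact hpx (hadj p hpC hp.ne')
    · refine h.not_dominated hC (S := {x, p}) ?_ ?_
      · intro u hu v hv huv
        simp only [Set.mem_insert_iff, Set.mem_singleton_iff] at hu hv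
        rcases hu with rfl | rfl <;> rcases hv with rfl | rfl
        · exact absurd rfl huv
        · exact hpx
        · exact fun h => hpx h.symm
        · exact absurd rfl huv
      · intro c hc
        by_cases hca : c = a
        · exact ⟨p, by simp, hca ▸ hp⟩
        · exact ⟨x, by simp, (hadj c hc hca).symm⟩
  have := eq_of_subset_of_card_le hsub (by rw [h.deg, h.deg])
  intro v
  rw [← SimpleGraph.mem_neighborFinset, this, SimpleGraph.mem_neighborFinset]

omit [Fintype V] [DecidableRel G.Adj] h in
theorem inter_card_lt {C C' : Finset V} (hC : G.IsNClique w C) (hC' : G.IsNClique w C')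
    (hne : C ≠ C') : (C ∩ C').card < w := by
  rw [← hC.card_eq]
  refine card_lt_card ⟨inter_subset_left, fun hh => hne ?_⟩
  exact eq_of_subset_of_card_le (fun x hx => (mem_inter.1 (hh hx)).2)
    (by rw [hC.card_eq, hC'.card_eq])

theorem inter_card_add_two_le (ho : ∀ u v, (∀ x, G.Adj u x ↔ G.Adj v x) → u = v)
    {C C' : Finset V} (hC : G.IsNClique w C) (hC' : G.IsNClique w C') (hne : C ≠ C') :
    (C ∩ C').card + 2 ≤ w := by
  have h1 := inter_card_lt hC hC' hne
  by_contra h2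
  have h3 : (C \ C').card = 1 := by
    have := card_sdiff_add_card_inter C C'
    rw [hC.card_eq] at this; omega
  have h4 : (C' \ C).card = 1 := by
    have := card_sdiff_add_card_inter C' C
    rw [hC'.card_eq, inter_comm] at this; omega
  obtain ⟨a, ha⟩ := card_eq_one.1 h3
  obtain ⟨x, hx⟩ := card_eq_one.1 h4
  have ha' : a ∈ C \ C' := ha ▸ mem_singleton_self a
  have hx' : x ∈ C' \ C := hx ▸ mem_singleton_self x
  rw [mem_sdiff] at ha' hx'
  have := ho a x (h.open_twin hC hx'.2 fun c hc hca => by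
    have hcC' : c ∈ C' := by
      by_contra hcC'
      exact hca (mem_singleton.1 (ha ▸ mem_sdiff.2 ⟨hc, hcC'⟩))
    exact hC'.isClique hx'.1 hcC' (fun hxc => hx'.2 (hxc ▸ hc)))
  exact hx'.2 (this ▸ ha'.1)

/-- The form in which connectedness is used: a local closure argument becomes a global conclusion.
-/
theorem eq_univ_of_closed {s : Set V} (hs : s.Nonempty)
    (hcl : ∀ u ∈ s, ∀ v, G.Adj u v → v ∈ s) (v : V) : v ∈ s := by
  obtain ⟨u, hu⟩ := hs
  obtain ⟨p⟩ := h.conn.preconnected u v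
  induction p with
  | nil => exact hu
  | cons hadj _ ih => exact ih (hcl _ hu _ hadj)

end IsPureCIS

end Pure

/-! ### Recognising lexicographic products from maps with equal fibres. -/

section Isomorphisms

variable {V W U : Type*}

theorem exists_equiv_prod [Fintype V] [DecidableEq W] {m : ℕ} (f : V → W)
    (hf : ∀ x, (univ.filter fun v => f v = x).card = m) :
    ∃ e : V ≃ W × Fin m, ∀ v, (e v).1 = f v := by
  have he : ∀ x, Nonempty ({v // f v = x} ≃ Fin m) := fun x => by
    rw [← Fintype.card_eq, Fintype.card_fin, Fintype.card_subtype, hf]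
  refine ⟨(Equiv.sigmaFiberEquiv f).symm.trans
    ((Equiv.sigmaCongrRight fun x => (he x).some).trans (Equiv.sigmaEquivProd W (Fin m))),
    fun v => rfl⟩

theorem nonempty_iso_lexProduct_complete [Fintype V] [DecidableEq W] {m : ℕ}
    {G : SimpleGraph V} {H : SimpleGraph W} (f : V → W)
    (hf : ∀ x, (univ.filter fun v => f v = x).card = m)
    (hadj : ∀ u v, G.Adj u v ↔ H.Adj (f u) (f v) ∨ (f u = f v ∧ u ≠ v)) :
    Nonempty (G ≃g lexProduct H (SimpleGraph.completeGraph (Fin m))) := by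
  obtain ⟨e, he⟩ := exists_equiv_prod f hf
  refine ⟨⟨e, fun {u v} => ?_⟩⟩
  have h1 : f u = f v → ((e u).2 ≠ (e v).2 ↔ u ≠ v) := fun h => by
    rw [Ne, Ne, not_iff_not]
    refine ⟨fun h2 => e.injective (Prod.ext (by rw [he, he, h]) h2), fun h => h ▸ rfl⟩
  rw [hadj]
  simp only [lexProduct, he, SimpleGraph.completeGraph, SimpleGraph.top_adj]
  exact or_congr_right (and_congr_right h1)

theorem nonempty_iso_lexProduct_empty [Fintype V] [DecidableEq W] {m : ℕ}
    {G : SimpleGraph V} {H : SimpleGraph W} (f : V → W)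
    (hf : ∀ x, (univ.filter fun v => f v = x).card = m)
    (hadj : ∀ u v, G.Adj u v ↔ H.Adj (f u) (f v)) :
    Nonempty (G ≃g lexProduct H (SimpleGraph.completeGraph (Fin m))ᶜ) := by
  obtain ⟨e, he⟩ := exists_equiv_prod f hf
  refine ⟨⟨e, fun {u v} => ?_⟩⟩
  rw [hadj]
  simp [lexProduct, he]

theorem nonempty_iso_completeBipartite [Fintype V] {m : ℕ} {G : SimpleGraph V} (f : V → Bool)
    (hf : ∀ x, (univ.filter fun v => f v = x).card = m)
    (hadj : ∀ u v, G.Adj u v ↔ f u ≠ f v) :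
    Nonempty (G ≃g completeBipartiteGraph (Fin m) (Fin m)) := by
  obtain ⟨e, he⟩ := exists_equiv_prod f hf
  refine ⟨⟨e.trans (Equiv.boolProdEquivSum (Fin m)), fun {u v} => ?_⟩⟩
  rw [hadj, ← he u, ← he v]
  change (completeBipartiteGraph (Fin m) (Fin m)).Adj (Equiv.boolProdEquivSum _ (e u))
    (Equiv.boolProdEquivSum _ (e v)) ↔ _
  generalize e u = p
  generalize e v = q
  rcases p with ⟨_ | _, i⟩ <;> rcases q with ⟨_ | _, j⟩ <;> simp [Equiv.boolProdEquivSum]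

theorem lexProduct_iso_left {G : SimpleGraph V} {H : SimpleGraph W} (K : SimpleGraph U)
    (e : G ≃g H) : Nonempty (lexProduct G K ≃g lexProduct H K) :=
  ⟨⟨e.toEquiv.prodCongr (Equiv.refl U), fun {u v} => by
    simp only [lexProduct, Equiv.prodCongr_apply, Prod.map_fst, Prod.map_snd, Equiv.refl_apply,
      RelIso.coe_fn_toEquiv, e.map_adj_iff, e.injective.eq_iff]⟩⟩

end Isomorphisms

/-! ### Open twins and complete multipartite graphs. -/

namespace IsPureCIS

variable {V : Type*} [Fintype V] [DecidableEq V] {G : SimpleGraph V} [DecidableRel G.Adj]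
  {k w : ℕ} (h : IsPureCIS G k w)
include h

theorem exists_clique_of_adj {u v : V} (huv : G.Adj u v) :
    ∃ C, u ∈ C ∧ v ∈ C ∧ G.IsNClique w C := by
  obtain ⟨C, hs, hC⟩ := h.ext {u, v} (by simpa using fun _ => huv)
  exact ⟨C, hs (by simp), hs (by simp), hC⟩

theorem exists_clique_of_adj₃ {u v x : V} (huv : G.Adj u v) (hvx : G.Adj v x)
    (hux : G.Adj u x) : ∃ C, u ∈ C ∧ v ∈ C ∧ x ∈ C ∧ G.IsNClique w C := by
  obtain ⟨C, hs, hC⟩ := h.ext {u, v, x} (by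
    have := (SimpleGraph.is3Clique_triple_iff (a := u) (b := v) (c := x)).2 ⟨huv, hux, hvx⟩
    exact this.isClique)
  exact ⟨C, hs (by simp), hs (by simp), hs (by simp), hC⟩

theorem exists_clique : ∃ C, G.IsNClique w C := by
  obtain ⟨C, -, hC⟩ := h.ext ∅ (by simp)
  exact ⟨C, hC⟩

theorem mem_of_adj {C : Finset V} (hC : G.IsNClique w C) {v : V}
    (hv : ∀ c ∈ C, v ≠ c → G.Adj v c) : v ∈ C :=
  (maximal_isClique_iff.1 (h.maximal hC)).2 v hv

/-- If p is a twin of no vertex of C, then a clique through c and p contains a second such vertex q.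
Together p, q and C minus c are w + 1 pairwise non-twin neighbours of c. Their twins are neighbours
of c too, so 2(w + 1) ≤ k ≤ 7, while w ≥ 3. -/
theorem exists_open_twin_mem
    (ho : ∀ v, ∃ u, u ≠ v ∧ ∀ x, G.Adj v x ↔ G.Adj u x) (hk : k ≤ 7)
    {C : Finset V} (hC : G.IsNClique w C) {c p : V} (hc : c ∈ C) (hcp : G.Adj c p) :
    ∃ d ∈ C, ∀ x, G.Adj d x ↔ G.Adj p x := by
  by_contra hp
  obtain ⟨C', hcC', hpC', hC'⟩ := h.exists_clique_of_adj hcp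
  have hpC : p ∉ C := fun hpC => hp ⟨p, hpC, fun _ => Iff.rfl⟩
  -- Otherwise every vertex of C' other than p has a twin in C. These twins miss a single a ∈ C, so
  -- p is adjacent to all of C except possibly a, and `open_twin` makes p a twin of a.
  obtain ⟨q, hqC', hqp, hq⟩ : ∃ q ∈ C', q ≠ p ∧ ¬ ∃ d ∈ C, ∀ x, G.Adj d x ↔ G.Adj q x := by
    by_contra! hall
    have hall' : ∀ q, ∃ d, q ∈ C' → q ≠ p → d ∈ C ∧ ∀ x, G.Adj d x ↔ G.Adj q x := by
      intro q
      by_cases hq : q ∈ C' ∧ q ≠ p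
      · obtain ⟨d, hd, hd'⟩ := hall q hq.1 hq.2
        exact ⟨d, fun _ _ => ⟨hd, hd'⟩⟩
      · exact ⟨q, fun h1 h2 => absurd ⟨h1, h2⟩ hq⟩
    choose τ hτ using hall'
    have hinj : Set.InjOn τ (C'.erase p) := by
      intro q hq r hr hqr
      have hq' := mem_erase.1 (mem_coe.1 hq)
      have hr' := mem_erase.1 (mem_coe.1 hr)
      by_contra hne
      have h1 := hC'.isClique hq'.2 hr'.2 hne
      rw [← (hτ q hq'.2 hq'.1).2, hqr, (hτ r hr'.2 hr'.1).2] at h1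
      exact h1.ne rfl
    have hsub : (C'.erase p).image τ ⊆ C := by
      intro d hd
      obtain ⟨q, hq, rfl⟩ := mem_image.1 hd
      exact (hτ q (mem_erase.1 hq).2 (mem_erase.1 hq).1).1
    have hcard : (C \ (C'.erase p).image τ).card = 1 := by
      rw [card_sdiff_of_subset hsub, card_image_of_injOn hinj, card_erase_of_mem hpC',
        hC.card_eq, hC'.card_eq]
      have : 0 < C'.card := card_pos.2 ⟨p, hpC'⟩
      rw [hC'.card_eq] at this
      omega
    obtain ⟨a, ha⟩ := card_eq_one.1 hcard
    have ha' : a ∈ C \ (C'.erase p).image τ := ha ▸ mem_singleton_self a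
    refine hp ⟨a, (mem_sdiff.1 ha').1, h.open_twin hC hpC ?_⟩
    intro d hd hda
    have hd' : d ∈ (C'.erase p).image τ := by
      by_contra hd'
      exact hda (mem_singleton.1 (ha ▸ mem_sdiff.2 ⟨hd, hd'⟩))
    obtain ⟨q, hq, rfl⟩ := mem_image.1 hd'
    have hq' := mem_erase.1 hq
    exact ((hτ q hq'.2 hq'.1).2 p).2 (hC'.isClique hq'.2 hpC' hq'.1) |>.symm
  have hqC : q ∉ C := fun hqC => hq ⟨q, hqC, fun _ => Iff.rfl⟩
  choose σ hσ using ho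
  have hcq : G.Adj c q := hC'.isClique hcC' hqC' (fun hh => hqC (hh ▸ hc))
  set T : Finset V := insert p (insert q (C.erase c)) with hT
  have hTcard : T.card = w + 1 := by
    have : 0 < C.card := card_pos.2 ⟨c, hc⟩
    rw [hT, card_insert_of_notMem, card_insert_of_notMem, card_erase_of_mem hc] <;>
      simp [hpC, hqC, hqp.symm]
    have := hC.card_eq
    omega
  have hTc : ∀ t ∈ T, G.Adj c t := by
    intro t ht
    simp only [hT, mem_insert, mem_erase] at ht
    rcases ht with rfl | rfl | ht
    · exact hcp
    · exact hcq
    · exact hC.isClique hc ht.2 ht.1.symm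
  have hTtw : ∀ s ∈ T, ∀ t ∈ T, (∀ x, G.Adj s x ↔ G.Adj t x) → s = t := by
    intro s hs t ht hst
    by_contra hne
    have hpq := hC'.isClique hpC' hqC' hqp.symm
    simp only [hT, mem_insert, mem_erase] at hs ht
    rcases hs with rfl | rfl | hs <;> rcases ht with rfl | rfl | ht
    · exact hne rfl
    · exact ((hst s).2 hpq.symm).ne rfl
    · exact hp ⟨t, ht.2, fun x => (hst x).symm⟩
    · exact ((hst s).2 hpq).ne rfl
    · exact hne rfl
    · exact hq ⟨t, ht.2, fun x => (hst x).symm⟩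
    · exact hp ⟨s, hs.2, hst⟩
    · exact hq ⟨s, hs.2, hst⟩
    · exact ((hst s).2 (hC.isClique ht.2 hs.2 (Ne.symm hne))).ne rfl
  have hσinj : Set.InjOn σ T := fun s hs t ht hst => hTtw s hs t ht fun x => by
    rw [(hσ s).2, hst, (hσ t).2]
  have hdisj : Disjoint T (T.image σ) := by
    rw [Finset.disjoint_left]
    intro s hs hs'
    obtain ⟨t, ht, rfl⟩ := mem_image.1 hs'
    exact (hσ t).1 (hTtw _ hs t ht fun x => ((hσ t).2 x).symm)
  have hsub : T ∪ T.image σ ⊆ G.neighborFinset c := by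
    intro t ht
    rw [SimpleGraph.mem_neighborFinset]
    rcases mem_union.1 ht with ht | ht
    · exact hTc t ht
    · obtain ⟨s, hs, rfl⟩ := mem_image.1 ht
      exact (((hσ s).2 c).1 (hTc s hs).symm).symm
  have h1 := card_le_card hsub
  rw [card_union_of_disjoint hdisj, card_image_of_injOn hσinj, hTcard, h.deg] at h1
  have h2 : ({c, p, q} : Finset V) ⊆ C' := by
    intro x hx
    simp only [mem_insert, mem_singleton] at hx
    rcases hx with rfl | rfl | rfl <;> assumption
  have h3 := card_le_card h2
  rw [hC'.card_eq, card_eq_three.2 ⟨c, p, q, hcp.ne, hcq.ne, hqp.symm, rfl⟩] at h3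
  omega

/-- By connectedness each vertex has a twin in a fixed maximal clique C, and adjacency is read off
there. A part consists of the |V| - k non-neighbours of a vertex (itself included), so m = |V| - k
and |V| = w m. -/
theorem completeMultipartite_of_open_twins
    (ho : ∀ v, ∃ u, u ≠ v ∧ ∀ x, G.Adj v x ↔ G.Adj u x) (hk : k ≤ 7) :
    ∃ m, 2 ≤ m ∧ w * m = k + m ∧ ∃ f : V → Fin w,
      (∀ i, (univ.filter fun v => f v = i).card = m) ∧ ∀ u v, G.Adj u v ↔ f u ≠ f v := by
  obtain ⟨C, hC⟩ := h.exists_clique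
  have hall : ∀ v, ∃ d ∈ C, ∀ x, G.Adj d x ↔ G.Adj v x := by
    refine h.eq_univ_of_closed (s := {v | ∃ d ∈ C, ∀ x, G.Adj d x ↔ G.Adj v x}) ?_ ?_
    · obtain ⟨v⟩ := h.conn.nonempty
      have : C.Nonempty := by
        by_contra hne
        rw [not_nonempty_iff_eq_empty] at hne
        have := h.card_le (s := {v}) (by simp)
        rw [← hC.card_eq, hne] at this
        simp at this
      obtain ⟨c, hc⟩ := this
      exact ⟨c, c, hc, fun _ => Iff.rfl⟩
    · rintro u ⟨d, hd, hdu⟩ v huv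
      exact h.exists_open_twin_mem ho hk hC hd ((hdu v).2 huv)
  choose τ hτC hτ using hall
  have hadj : ∀ u v, G.Adj u v ↔ τ u ≠ τ v := by
    intro u v
    rw [← hτ u, SimpleGraph.adj_comm, ← hτ v]
    exact ⟨fun hh => hh.ne', fun hh => hC.isClique (hτC v) (hτC u) hh.symm⟩
  have hτid : ∀ c ∈ C, τ c = c := by
    intro c hc
    by_contra hne
    have := hC.isClique (hτC c) hc hne
    rw [hτ] at this
    exact this.ne rfl
  have e : Nonempty (C ≃ Fin w) := by
    rw [← Fintype.card_eq, Fintype.card_coe, hC.card_eq, Fintype.card_fin]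
  obtain ⟨e⟩ := e
  have hfib : ∀ c ∈ C, (univ.filter fun v => τ v = c).card = Fintype.card V - k := by
    intro c hc
    rw [← h.deg c, ← card_compl]
    congr 1
    ext v
    simp [hadj, hτid c hc, eq_comm]
  have hfib' : ∀ i, (univ.filter fun v => e ⟨τ v, hτC v⟩ = i).card = Fintype.card V - k := by
    intro i
    rw [← hfib _ (e.symm i).2]
    congr 1
    ext v
    simp [← Equiv.eq_symm_apply, Subtype.ext_iff]
  have hsum : Fintype.card V = w * (Fintype.card V - k) := by
    have := card_eq_sum_card_fiberwise (s := univ) (t := univ)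
      (f := fun v => e ⟨τ v, hτC v⟩) (fun _ _ => mem_coe.2 (mem_univ _))
    rw [sum_congr rfl fun i _ => hfib' i] at this
    simpa using this
  have hkle : k ≤ Fintype.card V := by
    obtain ⟨v⟩ := h.conn.nonempty
    rw [← h.deg v]; exact card_le_univ _
  refine ⟨Fintype.card V - k, ?_, by omega, fun v => e ⟨τ v, hτC v⟩, hfib', fun u v => ?_⟩
  · obtain ⟨v⟩ := h.conn.nonempty
    obtain ⟨u, huv, hu⟩ := ho v
    rw [← hfib (τ v) (hτC v)]
    refine one_lt_card.2 ⟨v, by simp, u, ?_, huv.symm⟩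
    simp only [mem_filter, mem_univ, true_and]
    by_contra hne
    have := (hadj u v).2 hne
    exact ((hu u).1 this.symm).ne rfl
  · rw [hadj]; simp

end IsPureCIS

/-- Two vertices with the same closed neighbourhood. -/
def ClosedTwin {V : Type*} (G : SimpleGraph V) (u v : V) : Prop :=
  ∀ x, (x = u ∨ G.Adj u x) ↔ (x = v ∨ G.Adj v x)

/-! ### Closed twins. -/

namespace ClosedTwin

variable {V : Type*} {G : SimpleGraph V} {u v x : V}

theorem refl (u : V) : ClosedTwin G u u := fun _ => Iff.rfl

theorem symm (h : ClosedTwin G u v) : ClosedTwin G v u := fun x => (h x).symm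

theorem trans (h : ClosedTwin G u v) (h' : ClosedTwin G v x) : ClosedTwin G u x :=
  fun y => (h y).trans (h' y)

theorem adj (h : ClosedTwin G u v) (hne : u ≠ v) : G.Adj u v :=
  ((h v).2 (Or.inl rfl)).resolve_left hne.symm

theorem adj_of_adj (h : ClosedTwin G u v) (hux : G.Adj u x) (hne : x ≠ v) : G.Adj v x :=
  ((h x).1 (Or.inr hux)).resolve_left hne

theorem mem_of_mem_clique [Fintype V] [DecidableEq V] [DecidableRel G.Adj] {k w : ℕ}
    (hG : IsPureCIS G k w) {C : Finset V} (hC : G.IsNClique w C) (hu : u ∈ C)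
    (h : ClosedTwin G u v) : v ∈ C := by
  refine hG.mem_of_adj hC fun c hc hvc => ?_
  by_cases hcu : u = c
  · subst hcu
    exact h.symm.adj hvc
  · exact h.adj_of_adj (hC.isClique hu hc hcu) hvc.symm

end ClosedTwin

namespace IsPureCIS

variable {V : Type*} [Fintype V] [DecidableEq V] {G : SimpleGraph V} [DecidableRel G.Adj]
  {k w : ℕ} (h : IsPureCIS G k w)

include h in
theorem eq_top_of_closed_clique {C : Finset V} (hC : G.IsNClique w C) (hne : C.Nonempty)
    (hcl : ∀ c ∈ C, ∀ v, G.Adj c v → v ∈ C) : G = ⊤ := by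
  have hall : ∀ v, v ∈ C := h.eq_univ_of_closed (s := (C : Set V)) (by exact_mod_cast hne)
    (fun u hu v huv => by exact_mod_cast hcl u (by exact_mod_cast hu) v huv)
  ext u v
  rw [SimpleGraph.top_adj]
  exact ⟨fun huv => huv.ne, fun huv => hC.isClique (hall u) (hall v) huv⟩

include h in
theorem one_le_cliqueSize : 1 ≤ w := by
  obtain ⟨v⟩ := h.conn.nonempty
  simpa using h.card_le (s := {v}) (by simp)

include h in
theorem lt_of_ne_top (hG : G ≠ ⊤) : w ≤ k := by
  by_contra hlt
  obtain ⟨C, hC⟩ := h.exists_clique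
  refine hG (h.eq_top_of_closed_clique hC (card_pos.1 ?_) fun c hc v hcv => ?_)
  · rw [hC.card_eq]; exact h.one_le_cliqueSize
  · have h1 : C.erase c ⊆ G.neighborFinset c := fun x hx => by
      rw [SimpleGraph.mem_neighborFinset]
      exact hC.isClique hc (mem_erase.1 hx).2 (mem_erase.1 hx).1.symm
    have h2 := eq_of_subset_of_card_le h1 (by
      rw [h.deg, card_erase_of_mem hc, hC.card_eq]; omega)
    have h3 : v ∈ C.erase c := by rw [h2]; simpa using hcv
    exact (mem_erase.1 h3).2

include h in
theorem exists_adj_notMem (hG : G ≠ ⊤) {C : Finset V} (hC : G.IsNClique w C) (c : V) :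
    ∃ p, G.Adj c p ∧ p ∉ C := by
  by_contra! hcon
  have h1 : G.neighborFinset c ⊆ C.erase c := fun x hx => by
    rw [SimpleGraph.mem_neighborFinset] at hx
    exact mem_erase.2 ⟨hx.ne', hcon x hx⟩
  have h2 := card_le_card h1
  by_cases hc : c ∈ C
  · rw [card_erase_of_mem hc, hC.card_eq, h.deg] at h2
    have := h.lt_of_ne_top hG
    have := h.one_le_cliqueSize
    omega
  · refine hc (h.mem_of_adj hC fun d hd hcd => ?_)
    have h3 := eq_of_subset_of_card_le h1 (by
      rw [erase_eq_of_notMem hc, h.deg, hC.card_eq]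
      exact h.lt_of_ne_top hG)
    have h4 : d ∈ C.erase c := mem_erase.2 ⟨hcd.symm, hd⟩
    rw [← h3] at h4
    simpa using h4

/-! ### Closed twins and no open twins: blow-ups of complete bipartite graphs. -/

section ClosedTwins

variable {m : ℕ} (ho : ∀ u v, (∀ x, G.Adj u x ↔ G.Adj v x) → u = v)
  {cl : V → Finset V} (hcl : ∀ u v, v ∈ cl u ↔ ClosedTwin G u v)
  (hm : ∀ v, (cl v).card = m) (hm2 : 2 ≤ m) (hk : k ≤ 7) (hG : G ≠ ⊤)

omit [Fintype V] [DecidableEq V] [DecidableRel G.Adj] in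
include hcl in
theorem closedTwinClass_disjoint {u v : V} (huv : ¬ ClosedTwin G u v) :
    Disjoint (cl u) (cl v) := by
  rw [Finset.disjoint_left]
  intro x hx hx'
  rw [hcl] at hx hx'
  exact huv (hx.trans hx'.symm)

include h hcl in
theorem closedTwinClass_subset {C : Finset V} (hC : G.IsNClique w C) {c : V} (hc : c ∈ C) :
    cl c ⊆ C := fun x hx => ((hcl c x).1 hx).mem_of_mem_clique h hC hc

include h in
theorem card_insert_neighborFinset (v : V) : (insert v (G.neighborFinset v)).card = k + 1 := by
  rw [card_insert_of_notMem (by simp), h.deg]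

theorem subset_insert_neighborFinset {C : Finset V}
    (hC : G.IsClique (C : Set V)) {c : V} (hc : c ∈ C) : C ⊆ insert c (G.neighborFinset c) := by
  intro x hx
  rw [mem_insert, SimpleGraph.mem_neighborFinset]
  by_cases hxc : x = c
  · exact Or.inl hxc
  · exact Or.inr (hC hc hx (Ne.symm hxc))

include h ho hcl hm hm2 hk in
-- Suppose d lies in C ∩ C' and is not a twin of c. Some e in N[c] is outside N[d], and its class
-- lies in N[c] and misses C ∪ C' ⊆ N[d]. So m + |C ∪ C'| ≤ 8. But 2m ≤ |C ∩ C'| ≤ w - 2 forces |C ∪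
-- C'| ≥ 2m + 4, which is too much for m ≥ 2.
theorem inter_eq_closedTwinClass {C C' : Finset V} (hC : G.IsNClique w C)
    (hC' : G.IsNClique w C') (hne : C ≠ C') {c : V} (hc : c ∈ C) (hc' : c ∈ C') :
    C ∩ C' = cl c := by
  refine Subset.antisymm (fun d hd => ?_) fun d hd => mem_inter.2
    ⟨h.closedTwinClass_subset hcl hC hc hd, h.closedTwinClass_subset hcl hC' hc' hd⟩
  rw [hcl]
  by_contra hcd
  obtain ⟨hdC, hdC'⟩ := mem_inter.1 hd
  obtain ⟨e, he, hed⟩ : ∃ e, e ∈ insert c (G.neighborFinset c) ∧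
      e ∉ insert d (G.neighborFinset d) := by
    by_contra! hsub
    have := eq_of_subset_of_card_le (fun x hx => hsub x hx)
      (by rw [h.card_insert_neighborFinset, h.card_insert_neighborFinset])
    refine hcd fun x => ?_
    have h1 : x ∈ insert c (G.neighborFinset c) ↔ x ∈ insert d (G.neighborFinset d) := by
      rw [this]
    simpa using h1
  have hCd : C ∪ C' ⊆ insert d (G.neighborFinset d) := union_subset
    (subset_insert_neighborFinset hC.isClique hdC) (subset_insert_neighborFinset hC'.isClique hdC')
  have hed' : Disjoint (cl e) (C ∪ C') := by
    rw [Finset.disjoint_left]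
    intro x hx hx'
    refine hed (hCd ?_)
    rw [hcl] at hx
    rcases mem_union.1 hx' with hx' | hx'
    · exact mem_union_left _ (hx.symm.mem_of_mem_clique h hC hx')
    · exact mem_union_right _ (hx.symm.mem_of_mem_clique h hC' hx')
  have hsub : cl e ∪ (C ∪ C') ⊆ insert c (G.neighborFinset c) := by
    refine union_subset (fun x hx => ?_) (union_subset
      (subset_insert_neighborFinset hC.isClique hc) (subset_insert_neighborFinset hC'.isClique hc'))
    rw [hcl] at hx
    rw [mem_insert, SimpleGraph.mem_neighborFinset] at he ⊢
    have h1 := (hx c).1 (by rcases he with he | he; exacts [Or.inl he.symm, Or.inr he.symm])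
    rcases h1 with h1 | h1
    exacts [Or.inl h1.symm, Or.inr h1.symm]
  have h1 := card_le_card hsub
  rw [card_union_of_disjoint hed', hm, h.card_insert_neighborFinset] at h1
  have h2 : (cl c ∪ cl d).card ≤ (C ∩ C').card := card_le_card (union_subset
    (fun x hx => mem_inter.2
      ⟨h.closedTwinClass_subset hcl hC hc hx, h.closedTwinClass_subset hcl hC' hc' hx⟩)
    (fun x hx => mem_inter.2
      ⟨h.closedTwinClass_subset hcl hC hdC hx, h.closedTwinClass_subset hcl hC' hdC' hx⟩))
  rw [card_union_of_disjoint (closedTwinClass_disjoint hcl hcd), hm, hm] at h2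
  have h3 := h.inter_card_add_two_le ho hC hC' hne
  have h4 := card_union_add_card_inter C C'
  rw [hC.card_eq, hC'.card_eq] at h4
  omega

include h ho hcl hm hm2 hk hG in
-- A second clique through c meets C in the class of c, so 2w - m ≤ k + 1 ≤ 8. Two classes in C give
-- 3m ≤ 8, hence m = 2; three classes would give 5m ≤ 8.
theorem clique_eq_union {C : Finset V} (hC : G.IsNClique w C) {c d : V} (hc : c ∈ C)
    (hd : d ∈ C) (hcd : ¬ ClosedTwin G c d) : C = cl c ∪ cl d ∧ m = 2 := by
  obtain ⟨p, hcp, hpC⟩ := h.exists_adj_notMem hG hC c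
  obtain ⟨C', hcC', hpC', hC'⟩ := h.exists_clique_of_adj hcp
  have hne : C ≠ C' := fun hh => hpC (hh ▸ hpC')
  have hint := h.inter_eq_closedTwinClass ho hcl hm hm2 hk hC hC' hne hc hcC'
  have h4 := card_union_add_card_inter C C'
  rw [hC.card_eq, hC'.card_eq, hint, hm] at h4
  have h5 := card_le_card (union_subset (subset_insert_neighborFinset hC.isClique hc)
    (subset_insert_neighborFinset hC'.isClique hcC'))
  rw [h.card_insert_neighborFinset] at h5
  have hsub : cl c ∪ cl d ⊆ C := union_subset (h.closedTwinClass_subset hcl hC hc)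
    (h.closedTwinClass_subset hcl hC hd)
  have h6 := card_le_card hsub
  rw [card_union_of_disjoint (closedTwinClass_disjoint hcl hcd), hm, hm, hC.card_eq] at h6
  refine ⟨Subset.antisymm (fun e he => ?_) hsub, by omega⟩
  by_contra hecd
  rw [mem_union, not_or, hcl, hcl] at hecd
  have h7 : (cl c ∪ cl d) ∪ cl e ⊆ C := union_subset hsub (h.closedTwinClass_subset hcl hC he)
  have h8 := card_le_card h7
  rw [card_union_of_disjoint, card_union_of_disjoint (closedTwinClass_disjoint hcl hcd),
    hm, hm, hm, hC.card_eq] at h8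
  · omega
  · exact disjoint_union_left.2
      ⟨closedTwinClass_disjoint hcl hecd.1, closedTwinClass_disjoint hcl hecd.2⟩

include h ho hcl hm hm2 hk hG in
theorem closedTwin_of_triangle {u v x : V} (huv : G.Adj u v) (hvx : G.Adj v x)
    (hux : G.Adj u x) (huv' : ¬ ClosedTwin G u v) : ClosedTwin G u x ∨ ClosedTwin G v x := by
  obtain ⟨C, hu, hv, hx, hC⟩ := h.exists_clique_of_adj₃ huv hvx hux
  rw [(h.clique_eq_union ho hcl hm hm2 hk hG hC hu hv huv').1, mem_union, hcl, hcl] at hx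
  exact hx

include h ho hcl hm hm2 hk hG in
-- The maximal clique through a and b is the union of their two classes. It is dominated by {p, q},
-- since p sees the class of a and q that of b; hence p and q are adjacent.
theorem adj_of_path {p a b q : V} (hpa : G.Adj p a ∧ ¬ ClosedTwin G p a)
    (hab : G.Adj a b ∧ ¬ ClosedTwin G a b) (hbq : G.Adj b q ∧ ¬ ClosedTwin G b q) :
    G.Adj p q ∧ ¬ ClosedTwin G p q := by
  have htri : ∀ {x}, G.Adj x a → G.Adj b x → ¬ ClosedTwin G x a → ¬ ClosedTwin G b x → False := by
    intro x hxa hbx h1 h2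
    rcases h.closedTwin_of_triangle ho hcl hm hm2 hk hG hab.1 hbx hxa.symm hab.2 with h3 | h3
    exacts [h1 h3.symm, h2 h3]
  obtain ⟨C, ha, hb, hC⟩ := h.exists_clique_of_adj hab.1
  have hCe := (h.clique_eq_union ho hcl hm hm2 hk hG hC ha hb hab.2).1
  have hpq : p ≠ q := fun hpq => htri hpa.1 (hpq ▸ hbq.1) hpa.2 (hpq ▸ hbq.2)
  have hadj : G.Adj p q := by
    by_contra hnadj
    refine h.not_dominated hC (S := {p, q}) ?_ ?_
    · intro u hu v hv huv
      simp only [Set.mem_insert_iff, Set.mem_singleton_iff] at hu hv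
      rcases hu with rfl | rfl <;> rcases hv with rfl | rfl
      · exact absurd rfl huv
      · exact hnadj
      · exact fun h => hnadj h.symm
      · exact absurd rfl huv
    · intro c hc
      rw [hCe, mem_union, hcl, hcl] at hc
      rcases hc with hc | hc
      · exact ⟨p, by simp, hc.adj_of_adj hpa.1.symm fun hpc => hpa.2 (hpc ▸ hc.symm)⟩
      · exact ⟨q, by simp, hc.adj_of_adj hbq.1 fun hpc => hbq.2 (hpc ▸ hc)⟩
  refine ⟨hadj, fun htw => ?_⟩
  by_cases hbp : b = p
  · subst hbp
    exact hbq.2 htw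
  · exact htri hpa.1 (htw.symm.adj_of_adj hbq.1.symm hbp).symm hpa.2
      fun h1 => hbq.2 (h1.trans htw)

include h ho hcl hm hm2 hk hG in
-- Modulo twins the graph is triangle-free, and by `adj_of_path` being joined to a or to b, for a
-- fixed non-twin edge ab, gives a complete bipartition. If a side has j classes then k = 2j + 1;
-- since w = 4 ≤ k ≤ 7, j is 2 or 3 and both sides agree.
theorem lexProduct_of_closed_twins : ∃ j, (j = 2 ∨ j = 3) ∧ Nonempty (G ≃g
    lexProduct (completeBipartiteGraph (Fin j) (Fin j)) (SimpleGraph.completeGraph (Fin 2))) := by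
  classical
  have htri : ∀ {u v x}, G.Adj u v ∧ ¬ ClosedTwin G u v → G.Adj v x ∧ ¬ ClosedTwin G v x →
      G.Adj u x ∧ ¬ ClosedTwin G u x → False := fun h1 h2 h3 => by
    rcases h.closedTwin_of_triangle ho hcl hm hm2 hk hG h1.1 h2.1 h3.1 h1.2 with h4 | h4
    exacts [h3.2 h4, h2.2 h4]
  have hpath := @fun p a b q => h.adj_of_path ho hcl hm hm2 hk hG (p := p) (a := a) (b := b) (q := q)
  have hsymm : ∀ {u v}, G.Adj u v ∧ ¬ ClosedTwin G u v → G.Adj v u ∧ ¬ ClosedTwin G v u :=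
    fun h1 => ⟨h1.1.symm, fun h2 => h1.2 h2.symm⟩
  have htw : ∀ {u v x}, ClosedTwin G u v → G.Adj u x ∧ ¬ ClosedTwin G u x →
      G.Adj v x ∧ ¬ ClosedTwin G v x := fun h1 h2 =>
    ⟨h1.adj_of_adj h2.1 fun h3 => h2.2 (h3 ▸ h1), fun h3 => h2.2 (h1.trans h3)⟩
  obtain ⟨a, b, hab⟩ : ∃ a b, G.Adj a b ∧ ¬ ClosedTwin G a b := by
    by_contra! hcon
    obtain ⟨C, hC⟩ := h.exists_clique
    refine hG (h.eq_top_of_closed_clique hC (card_pos.1 ?_)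
      fun c hc v hcv => (hcon c v hcv).mem_of_mem_clique h hC hc)
    rw [hC.card_eq]; exact h.one_le_cliqueSize
  have hm_eq : m = 2 := by
    obtain ⟨C, ha, hb, hC⟩ := h.exists_clique_of_adj hab.1
    exact (h.clique_eq_union ho hcl hm hm2 hk hG hC ha hb hab.2).2
  -- Moving along a non-twin edge exchanges the two alternatives, by closing a path of length three.
  have hall : ∀ v, (G.Adj v a ∧ ¬ ClosedTwin G v a) ∨ (G.Adj v b ∧ ¬ ClosedTwin G v b) := by
    refine h.eq_univ_of_closed (s := {v | (G.Adj v a ∧ ¬ ClosedTwin G v a) ∨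
      (G.Adj v b ∧ ¬ ClosedTwin G v b)}) ⟨a, Or.inr hab⟩ ?_
    intro u hu v huv
    by_cases huv' : ClosedTwin G u v
    · exact hu.imp (htw huv') (htw huv')
    · rcases hu with hu | hu
      · exact Or.inr (hpath _ _ _ _ (hsymm ⟨huv, huv'⟩) hu hab)
      · exact Or.inl (hpath _ _ _ _ (hsymm ⟨huv, huv'⟩) hu (hsymm hab))
  set P : V → Prop := fun v => G.Adj v a ∧ ¬ ClosedTwin G v a with hP
  have hPb : ∀ v, ¬ P v ↔ G.Adj v b ∧ ¬ ClosedTwin G v b := fun v =>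
    ⟨(hall v).resolve_left, fun h1 h2 => htri h2 hab h1⟩
  have hPtw : ∀ {u v}, ClosedTwin G u v → (P u ↔ P v) := fun h1 => ⟨htw h1, htw h1.symm⟩
  have hadj : ∀ u v, G.Adj u v ↔ ¬ (P u ↔ P v) ∨ (ClosedTwin G u v ∧ u ≠ v) := by
    intro u v
    constructor
    · intro huv
      by_cases huv' : ClosedTwin G u v
      · exact Or.inr ⟨huv', huv.ne⟩
      · refine Or.inl fun hPP => ?_
        by_cases hu : P u
        · exact htri ⟨huv, huv'⟩ (hPP.1 hu) hu
        · exact htri ⟨huv, huv'⟩ ((hPb v).1 (hPP.not.1 hu)) ((hPb u).1 hu)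
    · rintro (huv | huv)
      · by_cases hu : P u
        · have hv : ¬ P v := fun hv => huv (iff_of_true hu hv)
          exact (hpath _ _ _ _ hu hab (hsymm ((hPb v).1 hv))).1
        · have hv : P v := by
            by_contra hv
            exact huv (iff_of_false hu hv)
          exact (hpath _ _ _ _ ((hPb u).1 hu) (hsymm hab) (hsymm hv)).1
      · exact huv.1.adj huv.2
  let S : Setoid V := ⟨ClosedTwin G, ClosedTwin.refl, ClosedTwin.symm, ClosedTwin.trans⟩
  let side : Quotient S → Bool := Quotient.lift (fun v => decide (P v))
    fun u v huv => by simp only [decide_eq_decide]; exact hPtw huv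
  have hfib : ∀ x : Quotient S, (univ.filter fun v => Quotient.mk S v = x).card = 2 := by
    intro x
    obtain ⟨v, rfl⟩ := Quotient.exists_rep x
    rw [← hm_eq, ← hm v]
    congr 1
    ext u
    rw [mem_filter, hcl, Quotient.eq]
    exact ⟨fun h1 => h1.2.symm, fun h1 => ⟨mem_univ _, h1.symm⟩⟩
  have hcount : ∀ s : Bool, ∀ c, (∀ v, decide (P v) = s ↔ G.Adj v c ∧ ¬ ClosedTwin G v c) →
      2 * (univ.filter fun x => side x = s).card + 1 = k := by
    intro s c hc
    have h1 : (univ.filter fun v => decide (P v) = s).card =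
        2 * (univ.filter fun x => side x = s).card := by
      rw [card_eq_sum_card_fiberwise (f := Quotient.mk S)
        (t := univ.filter fun x => side x = s)]
      · rw [sum_congr rfl fun x hx => ?_, sum_const, smul_eq_mul, mul_comm]
        rw [← hfib x, filter_filter]
        congr 1
        ext v
        simp only [mem_filter, mem_univ, true_and]
        refine ⟨fun h => h.2, fun h => ⟨?_, h⟩⟩
        rw [← h] at hx
        simpa [side] using hx
      · intro v hv
        simpa [side] using hv
    have h2 : G.neighborFinset c = (univ.filter fun v => decide (P v) = s) ∪ (cl c).erase c := by
      ext v
      rw [SimpleGraph.mem_neighborFinset, mem_union, mem_filter, hc, mem_erase, hcl]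
      constructor
      · intro hcv
        by_cases hcv' : ClosedTwin G c v
        · exact Or.inr ⟨hcv.ne', hcv'⟩
        · exact Or.inl ⟨mem_univ _, hcv.symm, fun h1 => hcv' h1.symm⟩
      · rintro (h1 | h1)
        exacts [h1.2.1.symm, h1.2.adj h1.1.symm]
    have h3 := h.deg c
    rw [h2, card_union_of_disjoint, card_erase_of_mem ((hcl c c).2 (ClosedTwin.refl c)), hm,
      h1, hm_eq] at h3
    · exact h3
    · rw [Finset.disjoint_left]
      intro v hv hv'
      rw [mem_filter, hc] at hv
      rw [mem_erase, hcl] at hv'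
      exact hv.2.2 hv'.2.symm
  have htrue := hcount true a (fun v => by simp [P])
  have hfalse := hcount false b (fun v => by rw [← hPb]; simp)
  have hj : (univ.filter fun x => side x = true).card = 2 ∨
      (univ.filter fun x => side x = true).card = 3 := by
    have hwk := h.lt_of_ne_top hG
    obtain ⟨C, ha, hb, hC⟩ := h.exists_clique_of_adj hab.1
    have := hC.card_eq
    rw [(h.clique_eq_union ho hcl hm hm2 hk hG hC ha hb hab.2).1,
      card_union_of_disjoint (closedTwinClass_disjoint hcl hab.2), hm, hm] at this
    omega
  refine ⟨_, hj, ?_⟩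
  let H : SimpleGraph (Quotient S) := SimpleGraph.mk (fun x y => side x ≠ side y)
    ⟨fun _ _ h => h.symm⟩ ⟨fun _ h => h rfl⟩
  obtain ⟨e⟩ := nonempty_iso_lexProduct_complete (H := H) (G := G) (Quotient.mk S) hfib
    (fun u v => by
      rw [hadj, Quotient.eq]
      refine or_congr ?_ Iff.rfl
      simp only [H, side, Quotient.lift_mk, ne_eq, decide_eq_decide])
  obtain ⟨e'⟩ := nonempty_iso_completeBipartite (G := H) side
    (m := (univ.filter fun x => side x = true).card)
    (fun x => by cases x <;> omega) (fun u v => Iff.rfl)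
  obtain ⟨e''⟩ := lexProduct_iso_left (SimpleGraph.completeGraph (Fin 2)) e'
  exact ⟨e.trans e''⟩

end ClosedTwins

end IsPureCIS

theorem nonempty_iso_lineGraph_completeBipartite {V : Type*} {n : ℕ} {G : SimpleGraph V}
    (e : V ≃ Fin n × Fin n)
    (hadj : ∀ u v, G.Adj u v ↔ u ≠ v ∧ ((e u).1 = (e v).1 ∨ (e u).2 = (e v).2)) :
    Nonempty (G ≃g (completeBipartiteGraph (Fin n) (Fin n)).lineGraph) := by
  let f : Fin n × Fin n → (completeBipartiteGraph (Fin n) (Fin n)).edgeSet := fun p =>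
    ⟨s(Sum.inl p.1, Sum.inr p.2), by simp⟩
  have hf : Function.Bijective f := by
    constructor
    · rintro ⟨i, j⟩ ⟨i', j'⟩ hij
      simpa [f] using hij
    · rintro ⟨x, hx⟩
      induction x with
      | _ x y =>
        rcases x with i | i <;> rcases y with j | j <;> simp at hx
        · exact ⟨(i, j), rfl⟩
        · exact ⟨(j, i), Subtype.ext Sym2.eq_swap⟩
  refine ⟨⟨e.trans (Equiv.ofBijective f hf), fun {u v} => ?_⟩⟩
  rw [hadj, SimpleGraph.lineGraph_adj_iff_exists]
  refine and_congr ((e.trans (Equiv.ofBijective f hf)).injective.ne_iff) ?_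
  simp [f, Sym2.mem_iff]

namespace IsPureCIS

variable {V : Type*} [Fintype V] [DecidableEq V] {G : SimpleGraph V} [DecidableRel G.Adj]

/-! ### Cliques meeting in at most one vertex, two through each vertex: grids. -/

section Grid

variable {n : ℕ} (h : IsPureCIS G (2 * (n - 1)) n) (hn : 2 ≤ n)
  (hs : ∀ C C', G.IsNClique n C → G.IsNClique n C' → C ≠ C' → (C ∩ C').card ≤ 1)

include hs in
omit [Fintype V] [DecidableRel G.Adj] in
theorem clique_unique {C C' : Finset V} (hC : G.IsNClique n C) (hC' : G.IsNClique n C')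
    {u v : V} (huv : u ≠ v) (hu : u ∈ C) (hv : v ∈ C) (hu' : u ∈ C') (hv' : v ∈ C') : C = C' := by
  by_contra hne
  have h1 := hs C C' hC hC' hne
  have h2 : 1 < (C ∩ C').card := one_lt_card.2
    ⟨u, mem_inter.2 ⟨hu, hu'⟩, v, mem_inter.2 ⟨hv, hv'⟩, huv⟩
  omega

include h hs in
theorem triangle_mem {C : Finset V} (hC : G.IsNClique n C) {u v x : V} (hu : u ∈ C) (hv : v ∈ C)
    (huv : u ≠ v) (hux : G.Adj u x) (hvx : G.Adj v x) : x ∈ C := by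
  obtain ⟨E, hu', hv', hx', hE⟩ := h.exists_clique_of_adj₃ (hC.isClique hu hv huv) hvx hux
  rwa [clique_unique hs hC hE huv hu hv hu' hv']

include h hn hs in
-- Exactly n - 1 neighbours of c lie outside C. Any other clique through c has n - 1 further
-- vertices, all among them, so it uses them up.
theorem exists_other_clique {C : Finset V} (hC : G.IsNClique n C) {c : V} (hc : c ∈ C) :
    ∃ D, G.IsNClique n D ∧ c ∈ D ∧ D ≠ C ∧ ∀ u, G.Adj c u → u ∈ C ∨ u ∈ D := by
  have hsub : C.erase c ⊆ G.neighborFinset c := fun x hx => by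
    rw [SimpleGraph.mem_neighborFinset]
    exact hC.isClique hc (mem_erase.1 hx).2 (mem_erase.1 hx).1.symm
  have hcard : (G.neighborFinset c \ C.erase c).card = n - 1 := by
    rw [card_sdiff_of_subset hsub, h.deg, card_erase_of_mem hc, hC.card_eq]; omega
  obtain ⟨p, hp⟩ : (G.neighborFinset c \ C.erase c).Nonempty := card_pos.1 (by omega)
  rw [mem_sdiff, SimpleGraph.mem_neighborFinset, mem_erase] at hp
  have hpC : p ∉ C := fun hpC => hp.2 ⟨hp.1.ne', hpC⟩
  obtain ⟨D, hcD, hpD, hD⟩ := h.exists_clique_of_adj hp.1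
  have hne : D ≠ C := fun hh => hpC (hh ▸ hpD)
  refine ⟨D, hD, hcD, hne, fun u hu => ?_⟩
  by_contra! huCD
  have hsub2 : D.erase c ⊆ G.neighborFinset c \ C.erase c := fun x hx => by
    have hx' := mem_erase.1 hx
    rw [mem_sdiff, SimpleGraph.mem_neighborFinset]
    refine ⟨hD.isClique hcD hx'.2 hx'.1.symm, fun hxC => hne ?_⟩
    exact clique_unique hs hD hC hx'.1.symm hcD hx'.2 hc (mem_erase.1 hxC).2
  have := eq_of_subset_of_card_le hsub2 (by rw [hcard, card_erase_of_mem hcD, hD.card_eq])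
  have hu' : u ∈ G.neighborFinset c \ C.erase c := by
    rw [mem_sdiff, SimpleGraph.mem_neighborFinset, mem_erase]
    exact ⟨hu, fun h1 => huCD.1 h1.2⟩
  rw [← this] at hu'
  exact huCD.2 (mem_erase.1 hu').2

variable {C : Finset V} (hC : G.IsNClique n C) {D : V → Finset V}
  (hD : ∀ c ∈ C, G.IsNClique n (D c)) (hcD : ∀ c ∈ C, c ∈ D c) (hDC : ∀ c ∈ C, D c ≠ C)
include h hs hC hD hcD hDC

theorem pencil_disjoint {c d x : V} (hc : c ∈ C) (hd : d ∈ C) (hxc : x ∈ D c) (hxd : x ∈ D d) :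
    c = d := by
  by_contra hcd
  have key : ∀ {c d x}, c ∈ C → d ∈ C → c ≠ d → x ∈ D c → x ∈ D d → x ≠ c := by
    rintro c d x hc hd hcd - hxd rfl
    exact hDC d hd (clique_unique hs (hD d hd) hC hcd.symm (hcD d hd) hxd hd hc)
  have hx1 := key hc hd hcd hxc hxd
  have hx2 := key hd hc (Ne.symm hcd) hxd hxc
  have hxC := h.triangle_mem hs hC hc hd hcd ((hD c hc).isClique (hcD c hc) hxc hx1.symm)
    ((hD d hd).isClique (hcD d hd) hxd hx2.symm)
  exact hDC c hc (clique_unique hs (hD c hc) hC hx1 hxc (hcD c hc) hxC hc)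

omit hC hcD hDC in
theorem pencil_nbr_unique {d p q q' : V} (hd : d ∈ C) (hp : p ∉ D d) (hq : q ∈ D d)
    (hq' : q' ∈ D d) (hpq : G.Adj p q) (hpq' : G.Adj p q') : q = q' := by
  by_contra hne
  exact hp (h.triangle_mem hs (hD d hd) hq hq' hne hpq.symm hpq'.symm)

omit hC hDC in
-- Each vertex of S' rules out at most one of the n - 1 vertices of D t other than t. The separate
-- S' allows members of S known to have no neighbour in D t to be discounted, which saves the one
-- unit needed in `exists_pencil_nbr`.
theorem pencil_avoid {t : V} (ht : t ∈ C) {S S' : Finset V} (hS : ∀ s ∈ S, s ∉ D t)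
    (hS' : ∀ s ∈ S, (∃ q ∈ D t, G.Adj s q) → s ∈ S') (hcard : S'.card + 2 ≤ n) :
    ∃ q ∈ D t, q ≠ t ∧ ∀ s ∈ S, ¬ G.Adj s q := by
  classical
  by_contra! hcon
  have hcon' : ∀ q, ∃ s, q ∈ (D t).erase t → s ∈ S ∧ G.Adj s q := by
    intro q
    by_cases hq : q ∈ (D t).erase t
    · obtain ⟨s, hs1, hs2⟩ := hcon q (mem_erase.1 hq).2 (mem_erase.1 hq).1
      exact ⟨s, fun _ => ⟨hs1, hs2⟩⟩
    · exact ⟨q, fun h => absurd h hq⟩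
  choose σ hσ using hcon'
  have h1 : ((D t).erase t).card ≤ S'.card := by
    refine card_le_card_of_injOn σ ?_ ?_
    · intro q hq
      exact hS' _ (hσ q hq).1 ⟨q, (mem_erase.1 hq).2, (hσ q hq).2⟩
    · intro q hq q' hq' hqq'
      have h2 := (hσ q' hq').2
      rw [← hqq'] at h2
      exact h.pencil_nbr_unique hs hD ht (hS _ (hσ q hq).1) (mem_erase.1 hq).2
        (mem_erase.1 hq').2 (hσ q hq).2 h2
  rw [card_erase_of_mem (hcD t ht), (hD t ht).card_eq] at h1
  omega

/-- Greedy choice: starting from p, one vertex is taken from each D t, avoiding the neighbours of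
the earlier ones. Leaving b out of T keeps the set small enough for `pencil_avoid` at every stage.
-/
theorem exists_partial_transversal {a b p : V} (ha : a ∈ C) (hb : b ∈ C) (hab : a ≠ b)
    (hp : p ∈ D a) (T : Finset V) (hT : T ⊆ (C.erase a).erase b) :
    ∃ S : Finset V, p ∈ S ∧ S.card ≤ T.card + 1 ∧ G.IsIndepSet (S : Set V) ∧
      (∀ t ∈ T, ∃ s ∈ S, G.Adj t s) ∧ ∀ s ∈ S, ∃ t ∈ insert a T, s ∈ D t := by
  induction T using Finset.induction_on with
  | empty =>
    exact ⟨{p}, by simp, by simp, by simp, by simp, by simpa using hp⟩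
  | insert t T htT ih =>
    have hT' : T ⊆ (C.erase a).erase b := (subset_insert t T).trans hT
    obtain ⟨S, hpS, hScard, hSind, hSdom, hSmem⟩ := ih hT'
    have ht := hT (mem_insert_self t T)
    simp only [mem_erase] at ht
    have hSt : ∀ s ∈ S, s ∉ D t := by
      intro s hs1 hst
      obtain ⟨u, hu, hsu⟩ := hSmem s hs1
      have huC : u ∈ C := by
        rcases mem_insert.1 hu with rfl | hu
        · exact ha
        · exact (mem_erase.1 (mem_erase.1 (hT' hu)).2).2
      have := h.pencil_disjoint hs hC hD hcD hDC huC ht.2.2 hsu hst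
      subst this
      rcases mem_insert.1 hu with rfl | hu
      · exact ht.2.1 rfl
      · exact htT hu
    have hcard : (insert t T).card ≤ ((C.erase a).erase b).card := card_le_card hT
    rw [card_insert_of_notMem htT, card_erase_of_mem (mem_erase.2 ⟨hab.symm, hb⟩),
      card_erase_of_mem ha, hC.card_eq] at hcard
    obtain ⟨q, hq, hqt, hqS⟩ := h.pencil_avoid hs hD hcD ht.2.2 hSt (S' := S)
      (fun s hs _ => hs) (by omega)
    refine ⟨insert q S, mem_insert_of_mem hpS, ?_, ?_, ?_, ?_⟩
    · rw [card_insert_of_notMem htT]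
      exact (card_insert_le _ _).trans (by omega)
    · rw [coe_insert]
      exact hSind.insert fun s hs1 _ => ⟨fun h1 => hqS s hs1 h1.symm, hqS s hs1⟩
    · intro u hu
      rcases mem_insert.1 hu with rfl | hu
      · exact ⟨q, mem_insert_self _ _, (hD u ht.2.2).isClique (hcD u ht.2.2) hq hqt.symm⟩
      · obtain ⟨s, hs1, hs2⟩ := hSdom u hu
        exact ⟨s, mem_insert_of_mem hs1, hs2⟩
    · intro s hs1
      rcases mem_insert.1 hs1 with rfl | hs1
      · exact ⟨t, by simp, hq⟩
      · obtain ⟨u, hu, hsu⟩ := hSmem s hs1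
        exact ⟨u, by
          rcases mem_insert.1 hu with rfl | hu
          · simp
          · simp [hu], hsu⟩

/-- Otherwise p blocks nothing in D b, and a stable transversal of the other members of the pencil
extends to D b. For p ≠ a it would then dominate C. -/
theorem exists_pencil_nbr {a b p : V} (ha : a ∈ C) (hb : b ∈ C) (hab : a ≠ b) (hp : p ∈ D a) :
    ∃ q ∈ D b, G.Adj p q := by
  by_cases hpa : p = a
  · subst hpa
    exact ⟨b, hcD b hb, hC.isClique ha hb hab⟩
  by_contra hcon
  obtain ⟨S, hpS, hScard, hSind, hSdom, hSmem⟩ :=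
    h.exists_partial_transversal hs hC hD hcD hDC ha hb hab hp _ subset_rfl
  rw [card_erase_of_mem (mem_erase.2 ⟨hab.symm, hb⟩), card_erase_of_mem ha, hC.card_eq] at hScard
  have hn : 2 ≤ n := by
    rw [← hC.card_eq]; exact one_lt_card.2 ⟨a, ha, b, hb, hab⟩
  obtain ⟨q, hq, hqt, hqS⟩ := h.pencil_avoid hs hD hcD hb (S := S) (S' := S.erase p)
    (by
      intro s hs1 hsb
      obtain ⟨u, hu, hsu⟩ := hSmem s hs1
      have hu' : u ∈ C ∧ u ≠ b := by
        rcases mem_insert.1 hu with rfl | hu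
        · exact ⟨ha, hab⟩
        · simp only [mem_erase] at hu
          exact ⟨hu.2.2, hu.1⟩
      exact hu'.2 (h.pencil_disjoint hs hC hD hcD hDC hu'.1 hb hsu hsb))
    (fun s hs1 hsq => mem_erase.2 ⟨fun hsp => hcon (hsp ▸ hsq), hs1⟩)
    (by rw [card_erase_of_mem hpS]; omega)
  refine h.not_dominated hC (S := insert q (S : Set V)) ?_ ?_
  · exact hSind.insert fun s hs1 _ => ⟨fun h1 => hqS s hs1 h1.symm, hqS s hs1⟩
  · intro c hc
    by_cases hca : c = a
    · subst hca
      exact ⟨p, Or.inr hpS, (hD c hc).isClique (hcD c hc) hp (Ne.symm hpa)⟩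
    by_cases hcb : c = b
    · subst hcb
      exact ⟨q, Or.inl rfl, (hD c hc).isClique (hcD c hc) hq hqt.symm⟩
    · obtain ⟨s, hs1, hs2⟩ := hSdom c (by simp [hca, hcb, hc])
      exact ⟨s, Or.inr hs1, hs2⟩

/-- A vertex of D c has n - 1 neighbours in D c and one in each of the other n - 1 pencil members.
These are all 2(n - 1) neighbours, so the union of the pencil is closed under adjacency. -/
theorem exists_pencil_mem (hne : C.Nonempty) (v : V) : ∃ c ∈ C, v ∈ D c := by
  refine h.eq_univ_of_closed (s := {v | ∃ c ∈ C, v ∈ D c}) ?_ ?_ v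
  · obtain ⟨c, hc⟩ := hne
    exact ⟨c, c, hc, hcD c hc⟩
  rintro u ⟨c, hc, huc⟩ v huv
  have hcon' : ∀ b, ∃ q, b ∈ C.erase c → q ∈ D b ∧ G.Adj u q := by
    intro b
    by_cases hb : b ∈ C.erase c
    · obtain ⟨q, hq⟩ := h.exists_pencil_nbr hs hC hD hcD hDC hc (mem_erase.1 hb).2
        (mem_erase.1 hb).1.symm huc
      exact ⟨q, fun _ => hq⟩
    · exact ⟨b, fun h => absurd h hb⟩
  choose σ hσ using hcon'
  have hsub : (D c).erase u ∪ (C.erase c).image σ ⊆ G.neighborFinset u := by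
    intro x hx
    rw [SimpleGraph.mem_neighborFinset]
    rcases mem_union.1 hx with hx | hx
    · exact (hD c hc).isClique huc (mem_erase.1 hx).2 (mem_erase.1 hx).1.symm
    · obtain ⟨b, hb, rfl⟩ := mem_image.1 hx
      exact (hσ b hb).2
  have hinj : Set.InjOn σ (C.erase c) := fun b hb b' hb' hbb' =>
    h.pencil_disjoint hs hC hD hcD hDC (mem_erase.1 hb).2 (mem_erase.1 hb').2 (hσ b hb).1
      (hbb' ▸ (hσ b' hb').1)
  have hdisj : Disjoint ((D c).erase u) ((C.erase c).image σ) := by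
    rw [Finset.disjoint_left]
    intro x hx hx'
    obtain ⟨b, hb, rfl⟩ := mem_image.1 hx'
    exact (mem_erase.1 hb).1 (h.pencil_disjoint hs hC hD hcD hDC (mem_erase.1 hb).2 hc
      (hσ b hb).1 (mem_erase.1 hx).2)
  have heq := eq_of_subset_of_card_le hsub (by
    rw [h.deg, card_union_of_disjoint hdisj, card_erase_of_mem huc, card_image_of_injOn hinj,
      card_erase_of_mem hc, hC.card_eq, (hD c hc).card_eq]
    omega)
  have hv : v ∈ (D c).erase u ∪ (C.erase c).image σ := by rw [heq]; simpa using huv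
  rcases mem_union.1 hv with hv | hv
  · exact ⟨c, hc, (mem_erase.1 hv).2⟩
  · obtain ⟨b, hb, rfl⟩ := mem_image.1 hv
    exact ⟨b, (mem_erase.1 hb).2, (hσ b hb).1⟩

omit hC hD hcD hDC in
include hn in
-- The row of v is the pencil member containing it; the column is the vertex of a fixed member D a
-- equal or adjacent to v.
theorem lineGraph_of_linear : Nonempty (G ≃g
    (completeBipartiteGraph (Fin n) (Fin n)).lineGraph) := by
  obtain ⟨C, hC⟩ := h.exists_clique
  have hex : ∀ c, ∃ D, c ∈ C → G.IsNClique n D ∧ c ∈ D ∧ D ≠ C := by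
    intro c
    by_cases hc : c ∈ C
    · obtain ⟨D, h1, h2, h3, -⟩ := h.exists_other_clique hn hs hC hc
      exact ⟨D, fun _ => ⟨h1, h2, h3⟩⟩
    · exact ⟨∅, fun h => absurd h hc⟩
  choose D hD0 using hex
  have hD := fun c hc => (hD0 c hc).1
  have hcD := fun c hc => (hD0 c hc).2.1
  have hDC := fun c hc => (hD0 c hc).2.2
  have hne : C.Nonempty := card_pos.1 (by rw [hC.card_eq]; omega)
  have hrow := h.exists_pencil_mem hs hC hD hcD hDC hne
  choose row hrowC hrow using hrow
  have hdisj := @fun c d x => h.pencil_disjoint hs hC hD hcD hDC (c := c) (d := d) (x := x)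
  obtain ⟨a, ha⟩ := hne
  have hcol : ∀ v, ∃ x ∈ D a, (v ∈ D a → x = v) ∧ (v ∉ D a → G.Adj v x) := by
    intro v
    by_cases hv : v ∈ D a
    · exact ⟨v, hv, fun _ => rfl, fun h1 => absurd hv h1⟩
    · obtain ⟨x, hx, hvx⟩ := h.exists_pencil_nbr hs hC hD hcD hDC (hrowC v) ha
        (fun h1 => hv (h1 ▸ hrow v)) (hrow v)
      exact ⟨x, hx, fun h1 => absurd h1 hv, fun _ => hvx⟩
  choose col hcolD hcolin hcolout using hcol
  have huniq := @fun d p q q' => h.pencil_nbr_unique hs hD (d := d) (p := p) (q := q)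
    (q' := q')
  have hcolu : ∀ v x, v ∉ D a → x ∈ D a → G.Adj v x → col v = x := fun v x hv hx hvx =>
    huniq _ _ _ _ ha hv (hcolD v) hx (hcolout v hv) hvx
  have hrowu : ∀ {c v}, c ∈ C → v ∈ D c → row v = c := fun hc hv =>
    hdisj _ _ _ (hrowC _) hc (hrow _) hv
  have hadj : ∀ u v, G.Adj u v ↔ u ≠ v ∧ (row u = row v ∨ col u = col v) := by
    intro u v
    constructor
    · refine fun huv => ⟨huv.ne, ?_⟩
      by_contra! hcon
      by_cases hu : u ∈ D a
      · have hv : v ∉ D a := fun hv => hcon.1 ((hrowu ha hu).trans (hrowu ha hv).symm)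
        exact hcon.2 ((hcolin u hu).trans (hcolu v u hv hu huv.symm).symm)
      by_cases hv : v ∈ D a
      · exact hcon.2 ((hcolu u v hu hv huv).trans (hcolin v hv).symm)
      -- The second clique through u holds all neighbours of u outside its row, so it contains both
      -- v and the column of u.
      · obtain ⟨E, hE, huE, -, hN⟩ := h.exists_other_clique hn hs (hD _ (hrowC u)) (hrow u)
        have hvE := (hN v huv).resolve_left fun h1 => hcon.1 (hrowu (hrowC u) h1).symm
        have hxE := (hN _ (hcolout u hu)).resolve_left fun h1 => by
          have h2 := hrowu (hrowC u) h1
          rw [hrowu ha (hcolD u)] at h2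
          exact hu (h2 ▸ hrow u)
        exact hcon.2 (hcolu v _ hv (hcolD u)
          (hE.isClique hvE hxE fun h1 => hv (h1 ▸ hcolD u))).symm
    · rintro ⟨hne, hrc | hrc⟩
      · exact (hD _ (hrowC u)).isClique (hrow u) (hrc ▸ hrow v) hne
      by_cases hu : u ∈ D a
      · rw [hcolin u hu] at hrc
        have hv : v ∉ D a := fun hv => hne (hrc.trans (hcolin v hv))
        exact (hrc ▸ hcolout v hv).symm
      by_cases hv : v ∈ D a
      · rw [hcolin v hv] at hrc
        exact hrc ▸ hcolout u hu
      · obtain ⟨E, hE, -, -, hN⟩ := h.exists_other_clique hn hs (hD a ha) (hcolD u)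
        have huE := (hN u (hcolout u hu).symm).resolve_left hu
        have hvE := (hN v (hrc ▸ (hcolout v hv).symm)).resolve_left hv
        exact hE.isClique huE hvE hne
  let φ : V → C × D a := fun v => (⟨row v, hrowC v⟩, ⟨col v, hcolD v⟩)
  have hφ : Function.Injective φ := by
    intro u v huv
    have hr : row u = row v := congrArg (fun p => (p.1 : V)) huv
    have hc : col u = col v := congrArg (fun p => (p.2 : V)) huv
    by_cases hu : u ∈ D a
    · have hv : v ∈ D a := by rw [← hrowu ha hu, hr]; exact hrow v
      rw [← hcolin u hu, hc, hcolin v hv]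
    · have hv : v ∉ D a := fun hv => hu (by rw [← hrowu ha hv, ← hr]; exact hrow u)
      refine huniq (row u) (col u) u v (hrowC u) (fun h1 => ?_) (hrow u) (hr ▸ hrow v)
        (hcolout u hu).symm (hc ▸ (hcolout v hv).symm)
      have h2 := hrowu (hrowC u) h1
      rw [hrowu ha (hcolD u)] at h2
      exact hu (h2 ▸ hrow u)
  have hcard : Fintype.card V = n * n := by
    have h1 := card_eq_sum_card_fiberwise (s := univ) (t := C) (f := row)
      (fun v _ => hrowC v)
    rw [sum_congr rfl fun c hc => show _ = n by
      rw [← (hD c hc).card_eq]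
      congr 1
      ext v
      simp only [mem_filter, mem_univ, true_and]
      exact ⟨fun h1 => h1 ▸ hrow v, hrowu hc⟩] at h1
    simpa [hC.card_eq] using h1
  have hφb : Function.Bijective φ := by
    rw [Fintype.bijective_iff_injective_and_card]
    refine ⟨hφ, ?_⟩
    rw [hcard, Fintype.card_prod, Fintype.card_coe, Fintype.card_coe, hC.card_eq,
      (hD a ha).card_eq]
  obtain ⟨e₁⟩ : Nonempty (C ≃ Fin n) := by
    rw [← Fintype.card_eq, Fintype.card_coe, hC.card_eq, Fintype.card_fin]
  obtain ⟨e₂⟩ : Nonempty (D a ≃ Fin n) := by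
    rw [← Fintype.card_eq, Fintype.card_coe, (hD a ha).card_eq, Fintype.card_fin]
  refine nonempty_iso_lineGraph_completeBipartite
    ((Equiv.ofBijective φ hφb).trans (e₁.prodCongr e₂)) fun u v => ?_
  rw [hadj]
  simp [φ]

end Grid

end IsPureCIS

namespace IsPureCIS

variable {V : Type*} [Fintype V] [DecidableEq V] {G : SimpleGraph V} [DecidableRel G.Adj]

/-! ### Every edge in a unique triangle. -/

section Triangles

variable {k : ℕ} (h : IsPureCIS G k 3)
  (hs : ∀ C C', G.IsNClique 3 C → G.IsNClique 3 C' → C ≠ C' → (C ∩ C').card ≤ 1)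

include h in
theorem exists_triangle {u v : V} (huv : G.Adj u v) : ∃ x, G.Adj u x ∧ G.Adj v x := by
  obtain ⟨C, hu, hv, hC⟩ := h.exists_clique_of_adj huv
  obtain ⟨x, hx, hxuv⟩ := exists_mem_notMem_of_card_lt_card (s := {u, v}) (t := C)
    (by rw [hC.card_eq, card_pair huv.ne]; omega)
  simp only [mem_insert, mem_singleton, not_or] at hxuv
  exact ⟨x, hC.isClique hu hx (Ne.symm hxuv.1), hC.isClique hv hx (Ne.symm hxuv.2)⟩

include h hs in
theorem triangle_unique {u v x y : V} (huv : G.Adj u v) (hux : G.Adj u x) (hvx : G.Adj v x)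
    (huy : G.Adj u y) (hvy : G.Adj v y) : x = y := by
  by_contra hxy
  obtain ⟨C, hu, hv, hx, hC⟩ := h.exists_clique_of_adj₃ huv hvx hux
  obtain ⟨C', hu', hv', hy, hC'⟩ := h.exists_clique_of_adj₃ huv hvy huy
  obtain rfl := clique_unique hs hC hC' huv.ne hu hv hu' hv'
  have h1 : ({u, v, x, y} : Finset V) ⊆ C := by
    intro z hz
    simp only [mem_insert, mem_singleton] at hz
    rcases hz with rfl | rfl | rfl | rfl <;> assumption
  have h2 := card_le_card h1
  rw [hC.card_eq, card_insert_of_notMem, card_insert_of_notMem, card_pair hxy] at h2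
  · omega
  · simp [hvx.ne, hvy.ne]
  · simp [huv.ne, hux.ne, huy.ne]

include h hs in
theorem exists_partner (c : V) : ∃ τ : V → V, ∀ r, G.Adj c r →
    G.Adj c (τ r) ∧ G.Adj r (τ r) ∧ τ (τ r) = r := by
  have hex : ∀ r, ∃ x, G.Adj c r → G.Adj c x ∧ G.Adj r x := by
    intro r
    by_cases hr : G.Adj c r
    · obtain ⟨x, hx⟩ := h.exists_triangle hr
      exact ⟨x, fun _ => hx⟩
    · exact ⟨r, fun h => absurd h hr⟩
  choose τ hτ using hex
  refine ⟨τ, fun r hr => ⟨(hτ r hr).1, (hτ r hr).2, ?_⟩⟩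
  have h1 := hτ r hr
  have h2 := hτ (τ r) h1.1
  exact h.triangle_unique hs h1.1 h2.1 h2.2 hr h1.2.symm

include h hs in
-- The triangles through c pair off its neighbours without fixed points.
theorem even_valency : Even k := by
  obtain ⟨c⟩ := h.conn.nonempty
  obtain ⟨τ, hτ⟩ := h.exists_partner hs c
  have h1 : ∑ r ∈ G.neighborFinset c, (1 : ZMod 2) = 0 := by
    refine Finset.sum_involution (fun r _ => τ r) ?_ ?_ ?_ ?_
    · intro r _; decide
    · intro r hr _
      exact (hτ r (by simpa using hr)).2.1.ne'
    · intro r hr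
      simpa using (hτ r (by simpa using hr)).1
    · intro r hr
      exact (hτ r (by simpa using hr)).2.2
  rw [sum_const, h.deg, nsmul_eq_mul, mul_one] at h1
  exact (ZMod.natCast_eq_zero_iff_even).1 h1

include h hs in
-- If p ≠ c were adjacent to r and to its partner τ r, the edge from r to τ r would lie in two
-- triangles. So τ injects the neighbours of p into the non-neighbours among the k - 2 remaining
-- neighbours of c.
theorem two_mul_card_common_le {a b c p : V} (hca : G.Adj c a) (hcb : G.Adj c b)
    (hab : G.Adj a b) (hne : p ≠ c) :
    2 * ((((G.neighborFinset c).erase a).erase b).filter fun r => G.Adj p r).card + 2 ≤ k := by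
  obtain ⟨τ, hτ⟩ := h.exists_partner hs c
  set N := ((G.neighborFinset c).erase a).erase b with hN
  have hNmem : ∀ {r}, r ∈ N ↔ r ≠ b ∧ r ≠ a ∧ G.Adj c r := by simp [hN]
  have hNcard : N.card + 2 = k := by
    have hlt : 2 ≤ k := by
      rw [← h.deg c]
      exact one_lt_card.2 ⟨a, by simpa using hca, b, by simpa using hcb, hab.ne⟩
    rw [hN, card_erase_of_mem (by simpa using ⟨hab.ne', hcb⟩), card_erase_of_mem (by simpa using hca),
      h.deg]
    omega
  have h1 : (N.filter fun r => G.Adj p r).card ≤ (N.filter fun r => ¬ G.Adj p r).card := by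
    refine card_le_card_of_injOn τ ?_ ?_
    · intro r hr
      simp only [coe_filter, Set.mem_ofPred_eq, hNmem] at hr ⊢
      have h2 := hτ r hr.1.2.2
      refine ⟨⟨?_, ?_, h2.1⟩, fun h3 => ?_⟩
      · intro h3
        rw [h3] at h2
        exact hr.1.2.1 (h.triangle_unique hs hcb hr.1.2.2 h2.2.1.symm hca hab.symm)
      · intro h3
        rw [h3] at h2
        exact hr.1.1 (h.triangle_unique hs hca hr.1.2.2 h2.2.1.symm hcb hab)
      · exact hne (h.triangle_unique hs h2.2.1 hr.2.symm h3.symm hr.1.2.2.symm h2.1.symm)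
    · intro r hr r' hr' hrr'
      simp only [coe_filter, Set.mem_ofPred_eq, hNmem] at hr hr'
      rw [← (hτ r hr.1.2.2).2.2, hrr', (hτ r' hr'.1.2.2).2.2]
  have h2 := card_filter_add_card_filter_not (s := N) (fun r => G.Adj p r)
  omega

end Triangles

/-- There is no such graph of valency six with clique number three in which every edge lies in a
unique triangle. -/
theorem valency_six_triangles_false (h : IsPureCIS G 6 3)
    (hs : ∀ C C', G.IsNClique 3 C → G.IsNClique 3 C' → C ≠ C' → (C ∩ C').card ≤ 1) : False := by
  have hun := @fun u v x y => h.triangle_unique hs (u := u) (v := v) (x := x) (y := y)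
  have hNcard : ∀ {a b c}, G.Adj c a → G.Adj c b → G.Adj a b →
      (((G.neighborFinset c).erase a).erase b).card = 4 := by
    intro a b c hca hcb hab
    rw [card_erase_of_mem (by simpa using ⟨hab.ne', hcb⟩), card_erase_of_mem (by simpa using hca),
      h.deg]
  have hnadj : ∀ {a b c p}, G.Adj c a → G.Adj c b → G.Adj a b → G.Adj a p → p ≠ b → p ≠ c →
      ¬ G.Adj p c := fun hca hcb hab hap hpb hpc hadj =>
    hpb (hun _ _ _ _ hca hadj.symm hap hcb hab)
  have hcross : ∀ {a b c p q r}, G.Adj c a → G.Adj c b → G.Adj a b → G.Adj a p →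
      G.Adj b q → G.Adj c r → ¬ G.Adj p q → ¬ G.Adj p r → G.Adj q r ∨ q = r := by
    intro a b c p q r hca hcb hab hap hbq hcr hpq hpr
    by_contra! hqr
    obtain ⟨C, ha, hb, hc, hC⟩ := h.exists_clique_of_adj₃ hab hcb.symm hca.symm
    have hCe : C = {a, b, c} := Eq.symm <| eq_of_subset_of_card_le (by
      intro z hz
      simp only [mem_insert, mem_singleton] at hz
      rcases hz with rfl | rfl | rfl <;> assumption)
      (by rw [hC.card_eq, card_eq_three.2 ⟨a, b, c, hab.ne, hca.ne', hcb.ne', rfl⟩])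
    refine h.not_dominated hC (S := {p, q, r}) ?_ ?_
    · intro u hu v hv huv
      simp only [Set.mem_insert_iff, Set.mem_singleton_iff] at hu hv
      rcases hu with rfl | rfl | rfl <;> rcases hv with rfl | rfl | rfl <;>
        first | exact absurd rfl huv | assumption | (rw [SimpleGraph.adj_comm]; assumption) |
          exact hqr.1 | exact fun h1 => hqr.1 h1.symm
    · intro z hz
      rw [hCe] at hz
      simp only [mem_insert, mem_singleton] at hz
      rcases hz with rfl | rfl | rfl
      exacts [⟨p, by simp, hap⟩, ⟨q, by simp, hbq⟩, ⟨r, by simp, hcr⟩]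
  -- At least two of the four outer neighbours of b miss p; take such a q. By domination q sees
  -- every outer neighbour of c that p misses, and q sees at most two of the four, so p sees at
  -- least two.
  have htwo : ∀ {a b c p}, G.Adj c a → G.Adj c b → G.Adj a b → G.Adj a p → p ≠ b → p ≠ c →
      2 ≤ ((((G.neighborFinset c).erase a).erase b).filter fun r => G.Adj p r).card := by
    intro a b c p hca hcb hab hap hpb hpc
    have h1 := h.two_mul_card_common_le hs (p := p) hab.symm hcb.symm hca.symm hpb
    have h2 := card_filter_add_card_filter_not
      (s := ((G.neighborFinset b).erase a).erase c) (fun r => G.Adj p r)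
    rw [hNcard hab.symm hcb.symm hca.symm] at h2
    obtain ⟨q, hq⟩ : ((((G.neighborFinset b).erase a).erase c).filter
      fun r => ¬ G.Adj p r).Nonempty := card_pos.1 (by omega)
    simp only [mem_filter, mem_erase, SimpleGraph.mem_neighborFinset] at hq
    have hqc : ¬ G.Adj q c := hnadj hcb hca hab.symm hq.1.2.2 hq.1.2.1 hq.1.1
    have h3 := h.two_mul_card_common_le hs (p := q) hca hcb hab hq.1.1
    have h4 := card_filter_add_card_filter_not
      (s := ((G.neighborFinset c).erase a).erase b) (fun r => G.Adj p r)
    rw [hNcard hca hcb hab] at h4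
    have h5 : ((((G.neighborFinset c).erase a).erase b).filter fun r => ¬ G.Adj p r) ⊆
        ((((G.neighborFinset c).erase a).erase b).filter fun r => G.Adj q r) := by
      intro r hr
      simp only [mem_filter, mem_erase, SimpleGraph.mem_neighborFinset] at hr ⊢
      refine ⟨hr.1, (hcross hca hcb hab hap hq.1.2.2 hr.1.2.2 hq.2 hr.2).resolve_right ?_⟩
      rintro rfl
      exact hqc hr.1.2.2.symm
    have h6 := card_le_card h5
    omega
  obtain ⟨a⟩ := h.conn.nonempty
  obtain ⟨b, hb⟩ : (G.neighborFinset a).Nonempty := card_pos.1 (by rw [h.deg]; omega)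
  have hab : G.Adj a b := by simpa using hb
  obtain ⟨c, hac, hbc⟩ := h.exists_triangle hab
  obtain ⟨p, hp⟩ : (((G.neighborFinset a).erase b).erase c).Nonempty :=
    card_pos.1 (by rw [hNcard hab hac hbc]; omega)
  simp only [mem_erase, SimpleGraph.mem_neighborFinset] at hp
  obtain ⟨p', hap', hpp'⟩ := h.exists_triangle hp.2.2
  have h1 := htwo hab.symm hbc hac hp.2.2 hp.1 hp.2.1
  have h2 := htwo hac.symm hbc.symm hab hp.2.2 hp.2.1 hp.1
  obtain ⟨q, hq⟩ := card_pos.1 (lt_of_lt_of_le two_pos h1)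
  obtain ⟨r, hr, r', hr', hrr'⟩ := one_lt_card.1 h2
  simp only [mem_filter, mem_erase, SimpleGraph.mem_neighborFinset] at hq hr hr'
  -- The third vertex p' of the triangle on a and p shares no neighbour other than a with p.
  -- Domination applied to p' therefore makes q adjacent to both r and r', and the edge pq lies in
  -- two triangles.
  have hpq' : ¬ G.Adj p' q := fun h3 =>
    hq.1.2.1 (hun _ _ _ _ hpp' hq.2 h3 hp.2.2.symm hap'.symm)
  have key : ∀ {s}, G.Adj c s → s ≠ a → G.Adj p s → G.Adj q s ∨ q = s := by
    intro s hcs hsa hps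
    refine hcross hac.symm hbc.symm hab hap' hq.1.2.2 hcs hpq' fun h3 => ?_
    exact hsa (hun _ _ _ _ hpp' hps h3 hp.2.2.symm hap'.symm)
  have hqc : ¬ G.Adj q c := hnadj hbc.symm hac.symm hab.symm hq.1.2.2 hq.1.2.1 hq.1.1
  have hqr := (key hr.1.2.2 hr.1.2.1 hr.2).resolve_right (fun h3 => hqc (h3 ▸ hr.1.2.2.symm))
  have hqr' := (key hr'.1.2.2 hr'.1.2.1 hr'.2).resolve_right (fun h3 => hqc (h3 ▸ hr'.1.2.2.symm))
  exact hrr' (hun _ _ _ _ hq.2 hr.2 hqr hr'.2 hqr')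

/-! ### Graphs without twins: reduction to the linear case or to valency seven. -/

section NoTwins

variable {k w : ℕ} (h : IsPureCIS G k w)
  (ho : ∀ u v, (∀ x, G.Adj u x ↔ G.Adj v x) → u = v)
  (hc : ∀ u v, ClosedTwin G u v → u = v)
include h ho

theorem card_nbrs_in_clique {C : Finset V} (hC : G.IsNClique w C) {p : V} (hp : p ∉ C) :
    (C.filter fun c => G.Adj p c).card + 2 ≤ w := by
  obtain ⟨E, hE, hEc⟩ := h.ext (insert p (C.filter fun c => G.Adj p c)) (by
    rw [coe_insert]
    refine SimpleGraph.IsClique.insert (hC.isClique.subset (filter_subset _ _)) ?_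
    intro b hb _
    exact (mem_filter.1 (mem_coe.1 hb)).2)
  have hne : C ≠ E := fun h1 => hp (h1 ▸ hE (mem_insert_self _ _))
  have h1 := h.inter_card_add_two_le ho hC hEc hne
  have h2 : (C.filter fun c => G.Adj p c) ⊆ C ∩ E := fun x hx =>
    mem_inter.2 ⟨(mem_filter.1 hx).1, hE (mem_insert_of_mem hx)⟩
  have := card_le_card h2
  omega

omit ho in
theorem card_neighborFinset_sdiff {C : Finset V} (hC : G.IsNClique w C) {c : V} (hcC : c ∈ C) :
    (G.neighborFinset c \ C).card + w = k + 1 := by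
  have h1 : G.neighborFinset c \ C = insert c (G.neighborFinset c) \ C := by
    rw [insert_sdiff_of_mem _ hcC]
  have h2 : C ⊆ insert c (G.neighborFinset c) := subset_insert_neighborFinset hC.isClique hcC
  rw [h1, ← hC.card_eq, card_sdiff_add_card_eq_card h2, h.card_insert_neighborFinset]

include hc in
omit ho in
-- If C and C' cover N[c], any vertex of C ∩ C' has closed neighbourhood containing N[c], hence
-- equal to it.
theorem inter_eq_singleton_of_sdiff_eq {C C' : Finset V} (hC : G.IsNClique w C)
    (hC' : G.IsNClique w C') {c : V} (hcC : c ∈ C) (hcC' : c ∈ C')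
    (heq : C' \ C = G.neighborFinset c \ C) : C ∩ C' = {c} := by
  refine Subset.antisymm (fun d hd => ?_) (by simp [hcC, hcC'])
  rw [mem_singleton]
  obtain ⟨hdC, hdC'⟩ := mem_inter.1 hd
  have h1 : insert c (G.neighborFinset c) ⊆ insert d (G.neighborFinset d) := by
    intro x hx
    by_cases hxC : x ∈ C
    · exact subset_insert_neighborFinset hC.isClique hdC hxC
    · have h2 : x ∈ C' \ C := by
        rw [heq, mem_sdiff]
        rcases mem_insert.1 hx with rfl | hx
        exacts [absurd hcC hxC, ⟨hx, hxC⟩]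
      exact subset_insert_neighborFinset hC'.isClique hdC' (mem_sdiff.1 h2).1
  have h2 := eq_of_subset_of_card_le h1
    (by rw [h.card_insert_neighborFinset, h.card_insert_neighborFinset])
  refine hc d c fun x => ?_
  have h3 : x ∈ insert d (G.neighborFinset d) ↔ x ∈ insert c (G.neighborFinset c) := by rw [h2]
  simpa using h3

omit h ho in
theorem sdiff_subset_neighborFinset {C C' : Finset V} (hC' : G.IsNClique w C') {c : V}
    (hcC : c ∈ C) (hcC' : c ∈ C') : C' \ C ⊆ G.neighborFinset c \ C := by
  intro x hx
  rw [mem_sdiff] at hx ⊢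
  refine ⟨?_, hx.2⟩
  rw [SimpleGraph.mem_neighborFinset]
  exact hC'.isClique hcC' hx.1 fun h1 => hx.2 (h1 ▸ hcC)

include hc in
-- Let c lie in C ∩ C' with at least two common vertices. Then c has exactly three neighbours
-- outside C. C' and a clique E through c and the one it misses each use two of these three, so they
-- share a vertex p. Its at most w - 2 neighbours in C are both C ∩ C' and C ∩ E, and C' ∩ E becomes
-- too large.
theorem linear_or_valency_seven (hk : k ≤ 7) :
    (∀ C C', G.IsNClique w C → G.IsNClique w C' → C ≠ C' → (C ∩ C').card ≤ 1) ∨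
      (w = 4 ∧ k = 7) := by
  by_contra! hcon
  obtain ⟨⟨C, C', hC, hC', hne, hint⟩, hwk⟩ := hcon
  obtain ⟨c, hcc⟩ : (C ∩ C').Nonempty := card_pos.1 (by omega)
  obtain ⟨hcC, hcC'⟩ := mem_inter.1 hcc
  have hP := h.card_neighborFinset_sdiff hC hcC
  have hint2 := h.inter_card_add_two_le ho hC hC' hne
  have hsd := card_sdiff_add_card_inter C' C
  rw [hC'.card_eq, inter_comm] at hsd
  have hsub := sdiff_subset_neighborFinset hC' hcC hcC'
  have hss : (C' \ C).card < (G.neighborFinset c \ C).card := by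
    refine card_lt_card (hsub.ssubset_of_ne fun heq => ?_)
    rw [h.inter_eq_singleton_of_sdiff_eq hc hC hC' hcC hcC' heq] at hint
    simp at hint
  have hwk' := hwk
  -- At least three, since C' \ C has at least two elements and is a proper subset. At most three,
  -- since this number is k + 1 - w and either w ≥ 5, or w = 4 and k ≠ 7.
  have h3 : (G.neighborFinset c \ C).card = 3 := by
    rcases Nat.lt_or_ge w 5 with hw | hw
    · have : w = 4 := by omega
      have := hwk this
      omega
    · omega
  obtain ⟨r, hr, hrC'⟩ := exists_of_ssubset (hsub.ssubset_of_ne fun heq => by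
    rw [heq] at hss; omega)
  have hrC : r ∉ C := (mem_sdiff.1 hr).2
  have hcr : G.Adj c r := by simpa using (mem_sdiff.1 hr).1
  obtain ⟨E, hcE, hrE, hE⟩ := h.exists_clique_of_adj hcr
  have hneE : C ≠ E := fun h1 => hrC (h1 ▸ hrE)
  have hintE := h.inter_card_add_two_le ho hC hE hneE
  have hsdE := card_sdiff_add_card_inter E C
  rw [hE.card_eq, inter_comm] at hsdE
  have hsubE := sdiff_subset_neighborFinset hE hcC hcE
  have hneE' : C' ≠ E := fun h1 => hrC' (h1 ▸ mem_sdiff.2 ⟨hrE, hrC⟩)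
  have hintE' := h.inter_card_add_two_le ho hC' hE hneE'
  have hcardE := card_le_card hsubE
  have hE2 : (E \ C).card = 2 := by
    by_contra hE3
    have heq := eq_of_subset_of_card_le hsubE (by omega)
    have h1 := h.inter_eq_singleton_of_sdiff_eq hc hC hE hcC hcE heq
    have h2 : insert c (C' \ C) ⊆ C' ∩ E := by
      refine insert_subset (mem_inter.2 ⟨hcC', hcE⟩) fun x hx => mem_inter.2
        ⟨(mem_sdiff.1 hx).1, ?_⟩
      have := hsub hx
      rw [← heq] at this
      exact (mem_sdiff.1 this).1
    have h4 := card_le_card h2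
    rw [card_insert_of_notMem (fun hx => (mem_sdiff.1 hx).2 hcC)] at h4
    rw [h1, card_singleton] at hsdE
    omega
  obtain ⟨p, hp⟩ : ((C' \ C) ∩ (E \ C)).Nonempty := by
    rw [← card_pos]
    have h1 := card_union_add_card_inter (C' \ C) (E \ C)
    have h2 := card_le_card (union_subset hsub hsubE)
    omega
  simp only [mem_inter, mem_sdiff] at hp
  have hpn := h.card_nbrs_in_clique ho hC hp.1.2
  have hA : C ∩ C' ⊆ C.filter fun c => G.Adj p c := fun x hx => by
    rw [mem_inter] at hx
    exact mem_filter.2 ⟨hx.1, hC'.isClique hp.1.1 hx.2 fun h1 => hp.1.2 (h1 ▸ hx.1)⟩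
  have hB : C ∩ E ⊆ C.filter fun c => G.Adj p c := fun x hx => by
    rw [mem_inter] at hx
    exact mem_filter.2 ⟨hx.1, hE.isClique hp.2.1 hx.2 fun h1 => hp.1.2 (h1 ▸ hx.1)⟩
  have hA' := eq_of_subset_of_card_le hA (by omega)
  have hB' := eq_of_subset_of_card_le hB (by omega)
  have hAB : insert p (C ∩ C') ⊆ C' ∩ E := by
    refine insert_subset (mem_inter.2 ⟨hp.1.1, hp.2.1⟩) fun x hx => mem_inter.2
      ⟨(mem_inter.1 hx).2, ?_⟩
    rw [hA', ← hB'] at hx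
    exact (mem_inter.1 hx).2
  have h4 := card_le_card hAB
  rw [card_insert_of_notMem (fun hx => hp.1.2 (mem_inter.1 hx).1)] at h4
  omega

include hc in
theorem lineGraph_or_valency_seven (hk : k ≤ 7) (hG : G ≠ ⊤) :
    Nonempty (G ≃g (completeBipartiteGraph (Fin 3) (Fin 3)).lineGraph) ∨
    Nonempty (G ≃g (completeBipartiteGraph (Fin 4) (Fin 4)).lineGraph) ∨ (w = 4 ∧ k = 7) := by
  rcases h.linear_or_valency_seven ho hc hk with hs | hs
  swap
  · exact Or.inr (Or.inr hs)
  obtain ⟨C, hC⟩ := h.exists_clique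
  obtain ⟨c, hcC⟩ : C.Nonempty := card_pos.1 (by rw [hC.card_eq]; exact h.one_le_cliqueSize)
  obtain ⟨p, hcp, hpC⟩ := h.exists_adj_notMem hG hC c
  obtain ⟨E, hcE, hpE, hE⟩ := h.exists_clique_of_adj hcp
  have hneE : C ≠ E := fun h1 => hpC (h1 ▸ hpE)
  have h1 := h.inter_card_add_two_le ho hC hE hneE
  have h2 : 0 < (C ∩ E).card := card_pos.2 ⟨c, mem_inter.2 ⟨hcC, hcE⟩⟩
  have h3 := card_sdiff_add_card_inter E C
  rw [hE.card_eq, inter_comm] at h3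
  have h4 := card_le_card (sdiff_subset_neighborFinset hE hcC hcE)
  have h5 := h.card_neighborFinset_sdiff hC hcC
  have h6 := hs C E hC hE hneE
  -- The intersection is a single vertex, so 3 ≤ w; and E \ C has w - 1 vertices among k + 1 - w, so
  -- 2w ≤ k + 2 ≤ 9.
  have hw : w = 3 ∨ w = 4 := by omega
  rcases hw with rfl | rfl
  · obtain ⟨j, hj⟩ := h.even_valency hs
    have hk' : k = 4 ∨ k = 6 := by omega
    rcases hk' with rfl | rfl
    · exact Or.inl (h.lineGraph_of_linear (by omega) hs)
    · exact (h.valency_six_triangles_false hs).elim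
  · have hk' : k = 6 ∨ k = 7 := by omega
    rcases hk' with rfl | rfl
    · exact Or.inr (Or.inl (h.lineGraph_of_linear (by omega) hs))
    · exact Or.inr (Or.inr ⟨rfl, rfl⟩)

end NoTwins

end IsPureCIS

/-- Four pairwise adjacent vertices. -/
structure Quad {V : Type*} (G : SimpleGraph V) (a b c d : V) : Prop where
  ab : G.Adj a b
  ac : G.Adj a c
  ad : G.Adj a d
  bc : G.Adj b c
  bd : G.Adj b d
  cd : G.Adj c d

/-- The local properties of twin-free vertex-transitive CIS graphs of valency seven and clique
number four that are used to recognise the graphs `Q_n`. -/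
structure IsLocallyQ {V : Type*} (G : SimpleGraph V) : Prop where
  ext₂ : ∀ {a b}, G.Adj a b → ∃ c d, Quad G a b c d
  ext₃ : ∀ {a b c}, G.Adj a b → G.Adj a c → G.Adj b c → ∃ d, Quad G a b c d
  unique : ∀ {a b c d p}, Quad G a b c d → G.Adj p a → G.Adj p b → G.Adj p c → p = d
  deg : ∀ a, ∃ N : Finset V, N.card = 7 ∧ ∀ v, v ∈ N ↔ G.Adj a v
  twin : ∀ {u v}, ClosedTwin G u v → u = v
  dom : ∀ {a b c d}, Quad G a b c d → ∀ S : Set V, G.IsIndepSet S →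
    (∃ s ∈ S, G.Adj a s) → (∃ s ∈ S, G.Adj b s) → (∃ s ∈ S, G.Adj c s) →
    (∃ s ∈ S, G.Adj d s) → False

/-! ### Twin-free graphs with k = 7 and w = 4: local structure. -/

namespace Quad

variable {V : Type*} {G : SimpleGraph V} {a b c d : V}

theorem swap₁₂ (h : Quad G a b c d) : Quad G b a c d :=
  ⟨h.ab.symm, h.bc, h.bd, h.ac, h.ad, h.cd⟩

theorem swap₂₃ (h : Quad G a b c d) : Quad G a c b d :=
  ⟨h.ac, h.ab, h.ad, h.bc.symm, h.cd, h.bd⟩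

theorem swap₃₄ (h : Quad G a b c d) : Quad G a b d c :=
  ⟨h.ab, h.ad, h.ac, h.bd, h.bc, h.cd.symm⟩

theorem rotate {u : V} (h : Quad G a b c d) (hu : u = b ∨ u = c ∨ u = d) :
    ∃ c' d', Quad G a u c' d' ∧ ∀ x, (x = u ∨ x = c' ∨ x = d') ↔ (x = b ∨ x = c ∨ x = d) := by
  rcases hu with rfl | rfl | rfl
  · exact ⟨c, d, h, fun x => Iff.rfl⟩
  · exact ⟨b, d, h.swap₂₃, fun x => by tauto⟩
  · exact ⟨b, c, h.swap₃₄.swap₂₃, fun x => by tauto⟩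

theorem isNClique [DecidableEq V] (h : Quad G a b c d) : G.IsNClique 4 {a, b, c, d} := by
  rw [SimpleGraph.isNClique_iff]
  constructor
  · have h1 := (SimpleGraph.is3Clique_triple_iff (a := b) (b := c) (c := d)).2 ⟨h.bc, h.bd, h.cd⟩
    rw [coe_insert]
    refine h1.isClique.insert fun x hx _ => ?_
    simp only [coe_insert, coe_singleton, Set.mem_insert_iff, Set.mem_singleton_iff] at hx
    rcases hx with rfl | rfl | rfl
    exacts [h.ab, h.ac, h.ad]
  · rw [card_insert_of_notMem, card_eq_three.2 ⟨b, c, d, h.bc.ne, h.bd.ne, h.cd.ne, rfl⟩]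
    simp [h.ab.ne, h.ac.ne, h.ad.ne]

end Quad

theorem IsPureCIS.isLocallyQ {V : Type*} [Fintype V] [DecidableEq V] {G : SimpleGraph V}
    [DecidableRel G.Adj] (h : IsPureCIS G 7 4)
    (ho : ∀ u v, (∀ x, G.Adj u x ↔ G.Adj v x) → u = v)
    (hc : ∀ u v, ClosedTwin G u v → u = v) : IsLocallyQ G := by
  have ext₃ : ∀ {a b c}, G.Adj a b → G.Adj a c → G.Adj b c → ∃ d, Quad G a b c d := by
    intro a b c hab hac hbc
    obtain ⟨C, ha, hb, hc, hC⟩ := h.exists_clique_of_adj₃ hab hbc hac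
    obtain ⟨d, hd, hdn⟩ := exists_mem_notMem_of_card_lt_card (s := {a, b, c}) (t := C)
      (by rw [hC.card_eq]; exact card_le_three.trans_lt (by omega))
    simp only [mem_insert, mem_singleton, not_or] at hdn
    exact ⟨d, hab, hac, hC.isClique ha hd (Ne.symm hdn.1), hbc,
      hC.isClique hb hd (Ne.symm hdn.2.1), hC.isClique hc hd (Ne.symm hdn.2.2)⟩
  refine ⟨fun {a b} hab => ?_, ext₃, fun {a b c d p} hq ha hb hc => ?_,
    fun a => ⟨_, h.deg a, by simp⟩, fun h1 => hc _ _ h1, fun {a b c d} hq S hS h1 h2 h3 h4 => ?_⟩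
  · obtain ⟨C, ha, hb, hC⟩ := h.exists_clique_of_adj hab
    obtain ⟨c, hc, hcn⟩ := exists_mem_notMem_of_card_lt_card (s := {a, b}) (t := C)
      (by rw [hC.card_eq]; exact card_le_two.trans_lt (by omega))
    simp only [mem_insert, mem_singleton, not_or] at hcn
    obtain ⟨d, hd⟩ := ext₃ hab (hC.isClique ha hc (Ne.symm hcn.1))
      (hC.isClique hb hc (Ne.symm hcn.2))
    exact ⟨c, d, hd⟩
  · by_contra hpd
    have h1 := h.card_nbrs_in_clique ho hq.isNClique (p := p)
      (by simp [ha.ne, hb.ne, hc.ne, hpd])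
    have h2 : ({a, b, c} : Finset V) ⊆ ({a, b, c, d} : Finset V).filter fun c => G.Adj p c := by
      intro x hx
      simp only [mem_insert, mem_singleton] at hx
      rcases hx with rfl | rfl | rfl <;> simp [*]
    have h3 := card_le_card h2
    rw [card_eq_three.2 ⟨a, b, c, hq.ab.ne, hq.ac.ne, hq.bc.ne, rfl⟩] at h3
    omega
  · refine h.not_dominated hq.isNClique hS fun x hx => ?_
    simp only [mem_insert, mem_singleton] at hx
    rcases hx with rfl | rfl | rfl | rfl <;> assumption

/-- The neighbourhood of a vertex `a`: it consists of three maximal cliques arranged in a path. -/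
structure Frame {V : Type*} (G : SimpleGraph V) (a x y z p q r s : V) : Prop where
  mid : Quad G a x y z
  left : Quad G a x p q
  right : Quad G a y r s
  xr : ¬ G.Adj x r
  xs : ¬ G.Adj x s
  yp : ¬ G.Adj y p
  yq : ¬ G.Adj y q
  zp : ¬ G.Adj z p
  zq : ¬ G.Adj z q
  zr : ¬ G.Adj z r
  zs : ¬ G.Adj z s
  pr : ¬ G.Adj p r
  ps : ¬ G.Adj p s
  qr : ¬ G.Adj q r
  qs : ¬ G.Adj q s
  all : ∀ v, G.Adj a v → v = x ∨ v = y ∨ v = z ∨ v = p ∨ v = q ∨ v = r ∨ v = s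

namespace IsLocallyQ

variable {V : Type*} {G : SimpleGraph V} (h : IsLocallyQ G)
include h

theorem exists_adj_notMem [DecidableEq V] (a : V) (T : Finset V) (hT : T.card < 7) :
    ∃ v, G.Adj a v ∧ v ∉ T := by
  obtain ⟨N, hN, hNa⟩ := h.deg a
  obtain ⟨v, hv, hvT⟩ := exists_mem_notMem_of_card_lt_card (hN ▸ hT)
  exact ⟨v, (hNa v).1 hv, hvT⟩

theorem mem_of_adj [DecidableEq V] {a : V} {T : Finset V} (hT : T.card = 7)
    (hTa : ∀ v ∈ T, G.Adj a v) {v : V} (hv : G.Adj a v) : v ∈ T := by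
  obtain ⟨N, hN, hNa⟩ := h.deg a
  rw [eq_of_subset_of_card_le (fun v hv => (hNa v).2 (hTa v hv)) (by omega)]
  exact (hNa v).2 hv

/-- The seven listed vertices exhaust N(a). An unwanted edge either gives a vertex three neighbours
in a 4-clique not containing it, or spans with a a triangle whose fourth clique vertex can be none
of the seven. -/
theorem frame_of_quads {a x y z p q r s : V} (h1 : Quad G a x y z) (h2 : Quad G a x p q)
    (h3 : Quad G a y r s) (hpy : p ≠ y) (hpz : p ≠ z) (hqy : q ≠ y) (hqz : q ≠ z)
    (hrx : r ≠ x) (hrz : r ≠ z) (hsx : s ≠ x) (hsz : s ≠ z) (hpr : p ≠ r) (hps : p ≠ s)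
    (hqr : q ≠ r) (hqs : q ≠ s) : Frame G a x y z p q r s := by
  classical
  have hall : ∀ v, G.Adj a v →
      v = x ∨ v = y ∨ v = z ∨ v = p ∨ v = q ∨ v = r ∨ v = s := by
    intro v hv
    have := h.mem_of_adj (a := a) (T := {x, y, z, p, q, r, s}) (by
      have := h1.bc.ne; have := h1.bd.ne; have := h1.cd.ne; have := h2.bc.ne
      have := h2.bd.ne; have := h2.cd.ne; have := h3.bc.ne; have := h3.bd.ne
      have := h3.cd.ne
      rw [card_insert_of_notMem, card_insert_of_notMem, card_insert_of_notMem,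
        card_insert_of_notMem, card_insert_of_notMem, card_pair] <;> grind) (by
      intro v hv
      simp only [mem_insert, mem_singleton] at hv
      rcases hv with rfl | rfl | rfl | rfl | rfl | rfl | rfl
      exacts [h1.ab, h1.ac, h1.ad, h2.ac, h2.ad, h3.ac, h3.ad]) hv
    simpa using this
  have xr : ¬ G.Adj x r := fun h4 => hsx (h.unique h3 h1.ab.symm h1.bc h4).symm
  have xs : ¬ G.Adj x s := fun h4 => hrx (h.unique h3.swap₃₄ h1.ab.symm h1.bc h4).symm
  have yp : ¬ G.Adj y p := fun h4 => hqy (h.unique h2 h1.ac.symm h1.bc.symm h4).symm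
  have yq : ¬ G.Adj y q := fun h4 => hpy (h.unique h2.swap₃₄ h1.ac.symm h1.bc.symm h4).symm
  have zp : ¬ G.Adj z p := fun h4 => hqz (h.unique h2 h1.ad.symm h1.bd.symm h4).symm
  have zq : ¬ G.Adj z q := fun h4 => hpz (h.unique h2.swap₃₄ h1.ad.symm h1.bd.symm h4).symm
  have zr : ¬ G.Adj z r := fun h4 => hsz (h.unique h3 h1.ad.symm h1.cd.symm h4).symm
  have zs : ¬ G.Adj z s := fun h4 => hrz (h.unique h3.swap₃₄ h1.ad.symm h1.cd.symm h4).symm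
  have cross : ∀ {p q r s}, Quad G a x p q → Quad G a y r s → r ≠ x → p ≠ y →
      ¬ G.Adj x r → ¬ G.Adj y p → ¬ G.Adj z p →
      (∀ v, G.Adj a v → v = x ∨ v = y ∨ v = z ∨ v = p ∨ v = q ∨ v = r ∨ v = s) →
      ¬ G.Adj p r := by
    intro p q r s h2 h3 hrx hpy xr yp zp hall hadj
    obtain ⟨w, hw⟩ := h.ext₃ h2.ac h3.ac hadj
    rcases hall w hw.ad with rfl | rfl | rfl | rfl | rfl | rfl | rfl
    · exact xr hw.cd.symm
    · exact yp hw.bd.symm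
    · exact zp hw.bd.symm
    · exact hw.bd.ne rfl
    · exact hrx (h.unique h2.swap₂₃.swap₃₄ h3.ac.symm hadj.symm hw.cd)
    · exact hw.cd.ne rfl
    · exact hpy (h.unique h3.swap₂₃.swap₃₄ h2.ac.symm hadj hw.bd)
  exact ⟨h1, h2, h3, xr, xs, yp, yq, zp, zq, zr, zs,
    cross h2 h3 hrx hpy xr yp zp hall,
    cross h2 h3.swap₃₄ hsx hpy xs yp zp (by grind),
    cross h2.swap₃₄ h3 hrx hqy xr yq zq (by grind),
    cross h2.swap₃₄ h3.swap₃₄ hsx hqy xs yq zq (by grind), hall⟩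

theorem closedTwin_of_subset {a b : V} (hab : G.Adj a b) (hsub : ∀ v, G.Adj a v → v = b ∨ G.Adj b v) :
    a = b := by
  classical
  obtain ⟨N, hN, hNa⟩ := h.deg a
  obtain ⟨M, hM, hMb⟩ := h.deg b
  have h1 : insert a N ⊆ insert b M := by
    intro v hv
    rcases mem_insert.1 hv with rfl | hv
    · exact mem_insert_of_mem ((hMb _).2 hab.symm)
    · rcases hsub v ((hNa v).1 hv) with rfl | h2
      · exact mem_insert_self _ _
      · exact mem_insert_of_mem ((hMb v).2 h2)
  have h2 := eq_of_subset_of_card_le h1 (by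
    rw [card_insert_of_notMem, card_insert_of_notMem, hN, hM]
    · rw [hNa]; exact fun h => h.ne rfl
    · rw [hMb]; exact fun h => h.ne rfl)
  refine h.twin fun v => ?_
  rw [← hNa, ← hMb, ← mem_insert, ← mem_insert, h2]

/-- Two maximal cliques through a vertex `a` that meet only in `a`. -/
theorem exists_frame_of_disjoint {a b c d p q r : V} (h1 : Quad G a b c d) (h2 : Quad G a p q r)
    (hpb : p ≠ b) (hpc : p ≠ c) (hpd : p ≠ d) (hqb : q ≠ b) (hqc : q ≠ c) (hqd : q ≠ d)
    (hrb : r ≠ b) (hrc : r ≠ c) (hrd : r ≠ d) :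
    ∃ x y z p q r s, Frame G a x y z p q r s := by
  classical
  obtain ⟨s, has, hs⟩ := h.exists_adj_notMem a {b, c, d, p, q, r} (card_le_six.trans_lt (by omega))
  simp only [mem_insert, mem_singleton, not_or] at hs
  obtain ⟨hsb, hsc, hsd, hsp, hsq, hsr⟩ := hs
  obtain ⟨u, v, huv⟩ := h.ext₂ has
  have hall : ∀ w, G.Adj a w → w = b ∨ w = c ∨ w = d ∨ w = p ∨ w = q ∨ w = r ∨ w = s := by
    intro w hw
    have := h.mem_of_adj (a := a) (T := {b, c, d, p, q, r, s}) (by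
      have := h1.bc.ne; have := h1.bd.ne; have := h1.cd.ne; have := h2.bc.ne
      have := h2.bd.ne; have := h2.cd.ne
      rw [card_insert_of_notMem, card_insert_of_notMem, card_insert_of_notMem,
        card_insert_of_notMem, card_insert_of_notMem, card_pair] <;> grind) (by
      intro v hv
      simp only [mem_insert, mem_singleton] at hv
      rcases hv with rfl | rfl | rfl | rfl | rfl | rfl | rfl
      exacts [h1.ab, h1.ac, h1.ad, h2.ab, h2.ac, h2.ad, has]) hw
    simpa using this
  have main : ∀ {u v}, Quad G a s u v → (u = b ∨ u = c ∨ u = d) → (v = p ∨ v = q ∨ v = r) →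
      ∃ x y z p q r s, Frame G a x y z p q r s := by
    intro u v huv hu hv
    obtain ⟨c', d', h1', e1⟩ := h1.rotate hu
    obtain ⟨q', r', h2', e2⟩ := h2.rotate hv
    have := e1 c'; have := e1 d'; have := e2 q'; have := e2 r'
    have := e1 u; have := e2 v
    refine ⟨u, v, s, c', d', q', r', h.frame_of_quads huv.swap₂₃.swap₃₄ h1' h2' ?_ ?_ ?_ ?_ ?_ ?_
      ?_ ?_ ?_ ?_ ?_ ?_⟩ <;> grind
  -- The clique through the seventh neighbour s cannot take two vertices from the same triple: s
  -- would be adjacent to three vertices of that 4-clique. So it takes one from each and is the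
  -- middle clique.
  have two : ∀ {b c d u v}, Quad G a b c d → Quad G a s u v → s ≠ b → s ≠ c → s ≠ d →
      (u = b ∨ u = c ∨ u = d) → (v = b ∨ v = c ∨ v = d) → False := by
    intro b c d u v h1 huv hsb hsc hsd hu hv
    obtain ⟨c', d', h1', e1⟩ := h1.rotate hu
    have hv' := (e1 v).2 hv
    have := e1 c'
    have := e1 d'
    rcases hv' with rfl | rfl | rfl
    · exact huv.cd.ne rfl
    · have := h.unique h1' huv.ab.symm huv.bc huv.bd
      grind
    · have := h.unique h1'.swap₃₄ huv.ab.symm huv.bc huv.bd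
      grind
  have hus := huv.bc.ne'
  have hvs := huv.bd.ne'
  have hu : (u = b ∨ u = c ∨ u = d) ∨ (u = p ∨ u = q ∨ u = r) := by
    have := hall u huv.ac; grind
  have hv : (v = b ∨ v = c ∨ v = d) ∨ (v = p ∨ v = q ∨ v = r) := by
    have := hall v huv.ad; grind
  rcases hu with hu | hu <;> rcases hv with hv | hv
  · exact (two h1 huv hsb hsc hsd hu hv).elim
  · exact main huv hu hv
  · exact main huv.swap₃₄ hv hu
  · exact (two h2 huv hsp hsq hsr hu hv).elim

/-- The neighbourhood of every vertex consists of three maximal cliques arranged in a path. -/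
theorem exists_frame (a : V) : ∃ x y z p q r s, Frame G a x y z p q r s := by
  classical
  by_contra hcon
  obtain ⟨b₀, hab₀, -⟩ := h.exists_adj_notMem a ∅ (by simp)
  obtain ⟨c₀, d₀, h₀⟩ := h.ext₂ hab₀
  -- If no frame exists, two cliques through a never meet in a alone; by uniqueness they cannot
  -- share three vertices either.
  have key : ∀ p, G.Adj a p → ∀ {b c d}, Quad G a b c d → p ≠ b → p ≠ c → p ≠ d →
      ∃ u q, Quad G a u p q ∧ (u = b ∨ u = c ∨ u = d) ∧ q ≠ b ∧ q ≠ c ∧ q ≠ d := by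
    intro p hap b c d hq hpb hpc hpd
    obtain ⟨u, v, huv⟩ := h.ext₂ hap
    have two : (u = b ∨ u = c ∨ u = d) → (v = b ∨ v = c ∨ v = d) → False := by
      intro hu hv
      obtain ⟨c', d', hq', e⟩ := hq.rotate hu
      have hv' := (e v).2 hv
      have := e c'
      have := e d'
      rcases hv' with rfl | rfl | rfl
      · exact huv.cd.ne rfl
      · have := h.unique hq' huv.ab.symm huv.bc huv.bd
        grind
      · have := h.unique hq'.swap₃₄ huv.ab.symm huv.bc huv.bd
        grind
    by_cases hu : u = b ∨ u = c ∨ u = d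
    · exact ⟨u, v, huv.swap₂₃, hu, by grind⟩
    by_cases hv : v = b ∨ v = c ∨ v = d
    · exact ⟨v, u, huv.swap₃₄.swap₂₃, hv, by grind⟩
    · exact (hcon (h.exists_frame_of_disjoint hq huv hpb hpc hpd (by grind) (by grind) (by grind)
        (by grind) (by grind) (by grind))).elim
  obtain ⟨p, hap, hp⟩ := h.exists_adj_notMem a {b₀, c₀, d₀} (card_le_three.trans_lt (by omega))
  simp only [mem_insert, mem_singleton, not_or] at hp
  obtain ⟨b, q, hbq, hb, hq⟩ := key p hap h₀ hp.1 hp.2.1 hp.2.2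
  obtain ⟨c, d, h1, e⟩ := h₀.rotate hb
  have ec := e c
  have ed := e d
  obtain ⟨r, har, hr⟩ := h.exists_adj_notMem a {b, c, d, p, q} (card_le_five.trans_lt (by omega))
  simp only [mem_insert, mem_singleton, not_or] at hr
  obtain ⟨u, s, hus, hu, hs⟩ := key r har h1 hr.1 hr.2.1 hr.2.2.1
  have hp' : p ≠ b ∧ p ≠ c ∧ p ≠ d := by grind
  have hq' : q ≠ b ∧ q ≠ c ∧ q ≠ d := by grind
  have hrb := hus.bc.ne
  have excl : ∀ {p q}, Quad G a b p q → p ≠ b ∧ p ≠ c ∧ p ≠ d → r ≠ q → s ≠ p := by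
    rintro p q hbq hp hrq rfl
    rcases hu with rfl | rfl | rfl
    · exact hrq (h.unique hbq hus.ac.symm hus.bc.symm hus.cd)
    · exact hp.2.2 (h.unique h1 hbq.ac.symm hbq.bc.symm hus.bd.symm)
    · exact hp.2.1 (h.unique h1.swap₃₄ hbq.ac.symm hbq.bc.symm hus.bd.symm)
  have hsp := excl hbq hp' hr.2.2.2.2
  have hsq := excl hbq.swap₃₄ hq' hr.2.2.2.1
  rcases hu with rfl | rfl | rfl
  -- All three cliques pass through the edge from a to u, so every neighbour of a is u or a
  -- neighbour of u, making them closed twins.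
  · refine h1.ab.ne (h.closedTwin_of_subset h1.ab fun v hv => ?_)
    have := h.mem_of_adj (a := a) (T := {u, c, d, p, q, r, s}) (by
      have := h1.bc.ne; have := h1.bd.ne; have := h1.cd.ne; have := hbq.bc.ne
      have := hbq.bd.ne; have := hbq.cd.ne; have := hus.cd.ne
      rw [card_insert_of_notMem, card_insert_of_notMem, card_insert_of_notMem,
        card_insert_of_notMem, card_insert_of_notMem, card_pair] <;> grind) (by
      intro v hv
      simp only [mem_insert, mem_singleton] at hv
      rcases hv with rfl | rfl | rfl | rfl | rfl | rfl | rfl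
      exacts [h1.ab, h1.ac, h1.ad, hbq.ac, hbq.ad, har, hus.ad]) hv
    simp only [mem_insert, mem_singleton] at this
    rcases this with rfl | rfl | rfl | rfl | rfl | rfl | rfl
    exacts [Or.inl rfl, Or.inr h1.bc, Or.inr h1.bd, Or.inr hbq.bc, Or.inr hbq.bd, Or.inr hus.bc,
      Or.inr hus.bd]
  · exact hcon ⟨b, u, d, p, q, r, s, h.frame_of_quads h1 hbq hus (by grind) (by grind) (by grind)
      (by grind) (by grind) (by grind) (by grind) (by grind) (by grind) (by grind) (by grind)
      (by grind)⟩
  · exact hcon ⟨b, u, c, p, q, r, s, h.frame_of_quads h1.swap₃₄ hbq hus (by grind) (by grind)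
      (by grind) (by grind) (by grind) (by grind) (by grind) (by grind) (by grind) (by grind)
      (by grind) (by grind)⟩

end IsLocallyQ

/-- An edge lying in two different maximal cliques of size four. -/
def Heavy {V : Type*} (G : SimpleGraph V) (a x : V) : Prop :=
  ∃ b c d e, Quad G a x b c ∧ Quad G a x d e ∧ b ≠ d ∧ b ≠ e

theorem Heavy.symm {V : Type*} {G : SimpleGraph V} {a x : V} : Heavy G a x → Heavy G x a := by
  rintro ⟨b, c, d, e, h1, h2, h3⟩
  exact ⟨b, c, d, e, h1.swap₁₂, h2.swap₁₂, h3⟩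

/-! ### Heavy edges at a vertex. -/

namespace Frame

variable {V : Type*} {G : SimpleGraph V} {a x y z p q r s : V}

theorem swap (h : Frame G a x y z p q r s) : Frame G a y x z r s p q where
  mid := h.mid.swap₂₃
  left := h.right
  right := h.left
  xr := h.yp
  xs := h.yq
  yp := h.xr
  yq := h.xs
  zp := h.zr
  zq := h.zs
  zr := h.zp
  zs := h.zq
  pr := fun h' => h.pr h'.symm
  ps := fun h' => h.qr h'.symm
  qr := fun h' => h.ps h'.symm
  qs := fun h' => h.qs h'.symm
  all := fun v hv => by have := h.all v hv; tauto

theorem swapLeft (h : Frame G a x y z p q r s) : Frame G a x y z q p r s where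
  mid := h.mid
  left := h.left.swap₃₄
  right := h.right
  xr := h.xr
  xs := h.xs
  yp := h.yq
  yq := h.yp
  zp := h.zq
  zq := h.zp
  zr := h.zr
  zs := h.zs
  pr := h.qr
  ps := h.qs
  qr := h.pr
  qs := h.ps
  all := fun v hv => by have := h.all v hv; tauto

theorem swapRight (h : Frame G a x y z p q r s) : Frame G a x y z p q s r :=
  h.swap.swapLeft.swap

theorem ne_yp (h : Frame G a x y z p q r s) : y ≠ p := fun h' => h.yq (h' ▸ h.left.cd)
theorem ne_zp (h : Frame G a x y z p q r s) : z ≠ p := fun h' => h.zq (h' ▸ h.left.cd)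
theorem ne_pr (h : Frame G a x y z p q r s) : p ≠ r := fun h' => h.ps (h' ▸ h.right.cd)
theorem ne_yq (h : Frame G a x y z p q r s) : y ≠ q := h.swapLeft.ne_yp
theorem ne_zq (h : Frame G a x y z p q r s) : z ≠ q := h.swapLeft.ne_zp
theorem ne_xr (h : Frame G a x y z p q r s) : x ≠ r := h.swap.ne_yp
theorem ne_xs (h : Frame G a x y z p q r s) : x ≠ s := h.swap.ne_yq
theorem ne_zr (h : Frame G a x y z p q r s) : z ≠ r := h.swap.ne_zp
theorem ne_zs (h : Frame G a x y z p q r s) : z ≠ s := h.swap.ne_zq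
theorem ne_ps (h : Frame G a x y z p q r s) : p ≠ s := h.swapRight.ne_pr
theorem ne_qr (h : Frame G a x y z p q r s) : q ≠ r := h.swapLeft.ne_pr

theorem adj_x (h : Frame G a x y z p q r s) {v : V} (hv : G.Adj a v) (hxv : G.Adj x v) :
    v = y ∨ v = z ∨ v = p ∨ v = q := by
  rcases h.all v hv with rfl | rfl | rfl | rfl | rfl | rfl | rfl
  exacts [(hxv.ne rfl).elim, by tauto, by tauto, by tauto, by tauto, (h.xr hxv).elim,
    (h.xs hxv).elim]

theorem adj_z (h : Frame G a x y z p q r s) {v : V} (hv : G.Adj a v) (hxv : G.Adj z v) :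
    v = x ∨ v = y := by
  rcases h.all v hv with rfl | rfl | rfl | rfl | rfl | rfl | rfl
  exacts [by tauto, by tauto, (hxv.ne rfl).elim, (h.zp hxv).elim, (h.zq hxv).elim,
    (h.zr hxv).elim, (h.zs hxv).elim]

theorem adj_p (h : Frame G a x y z p q r s) {v : V} (hv : G.Adj a v) (hxv : G.Adj p v) :
    v = x ∨ v = q := by
  rcases h.all v hv with rfl | rfl | rfl | rfl | rfl | rfl | rfl
  exacts [by tauto, (h.yp hxv.symm).elim, (h.zp hxv.symm).elim, (hxv.ne rfl).elim, by tauto,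
    (h.pr hxv).elim, (h.ps hxv).elim]

theorem heavy_x (h : Frame G a x y z p q r s) : Heavy G a x :=
  ⟨y, z, p, q, h.mid, h.left, h.ne_yp, h.ne_yq⟩

theorem heavy_y (h : Frame G a x y z p q r s) : Heavy G a y := h.swap.heavy_x

theorem not_heavy_z (h : Frame G a x y z p q r s) : ¬ Heavy G a z := by
  rintro ⟨b, c, d, e, h1, h2, h3, h4⟩
  have e1 := h.adj_z h1.ac h1.bc
  have e2 := h.adj_z h1.ad h1.bd
  have e3 := h.adj_z h2.ac h2.bc
  have e4 := h.adj_z h2.ad h2.bd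
  have e5 := h1.cd.ne
  have e6 := h2.cd.ne
  grind

theorem not_heavy_p (h : Frame G a x y z p q r s) : ¬ Heavy G a p := by
  rintro ⟨b, c, d, e, h1, h2, h3, h4⟩
  have e1 := h.adj_p h1.ac h1.bc
  have e2 := h.adj_p h1.ad h1.bd
  have e3 := h.adj_p h2.ac h2.bc
  have e4 := h.adj_p h2.ad h2.bd
  have e5 := h1.cd.ne
  have e6 := h2.cd.ne
  grind

/-- Each vertex thus has exactly two heavy edges, so x and y are determined by a up to order; the
heavy edges form a graph of valency two. -/
theorem heavy_iff (h : Frame G a x y z p q r s) {v : V} : Heavy G a v ↔ v = x ∨ v = y := by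
  constructor
  · intro hv
    obtain ⟨b, c, d, e, h1, -⟩ := id hv
    rcases h.all v h1.ab with rfl | rfl | rfl | rfl | rfl | rfl | rfl
    exacts [by tauto, by tauto, (h.not_heavy_z hv).elim, (h.not_heavy_p hv).elim,
      (h.swapLeft.not_heavy_p hv).elim, (h.swap.not_heavy_p hv).elim,
      (h.swap.swapLeft.not_heavy_p hv).elim]
  · rintro (rfl | rfl)
    exacts [h.heavy_x, h.heavy_y]

theorem reframe (h : Frame G a x y z p q r s) {u v : V} (hu : Heavy G a u) (hv : Heavy G a v)
    (huv : u ≠ v) : ∃ z p q r s, Frame G a u v z p q r s := by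
  rw [h.heavy_iff] at hu hv
  rcases hu with rfl | rfl <;> rcases hv with rfl | rfl
  exacts [(huv rfl).elim, ⟨_, _, _, _, _, h⟩, ⟨_, _, _, _, _, h.swap⟩, (huv rfl).elim]

theorem heavy_of_quad (h : Frame G a x y z p q r s) {u v w : V} (hq : Quad G a u v w) :
    Heavy G a u ∨ Heavy G a v ∨ Heavy G a w := by
  simp only [h.heavy_iff]
  have e1 := h.all u hq.ab
  have e2 := @h.adj_z
  have e3 := @h.adj_p
  have e4 := @h.swapLeft.adj_p
  have e5 := @h.swap.adj_p
  have e6 := @h.swap.swapLeft.adj_p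
  have e7 := hq.cd.ne
  rcases e1 with rfl | rfl | rfl | rfl | rfl | rfl | rfl
  · tauto
  · tauto
  · have := e2 hq.ac hq.bc; tauto
  · have := e3 hq.ac hq.bc; have := e3 hq.ad hq.bd; grind
  · have := e4 hq.ac hq.bc; have := e4 hq.ad hq.bd; grind
  · have := e5 hq.ac hq.bc; have := e5 hq.ad hq.bd; grind
  · have := e6 hq.ac hq.bc; have := e6 hq.ad hq.bd; grind

end Frame

/-! ### Heavy edges form 4-cycles. -/

namespace IsLocallyQ

variable {V : Type*} {G : SimpleGraph V} (h : IsLocallyQ G)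
include h

theorem adj_of_dominating_pair {a b c d u v : V} (hq : Quad G a b c d) (ha : G.Adj a u)
    (hb : G.Adj b u) (hc : G.Adj c v) (hd : G.Adj d v) : G.Adj u v := by
  by_contra huv
  refine h.dom hq {u, v} ?_ ⟨u, by simp, ha⟩ ⟨u, by simp, hb⟩ ⟨v, by simp, hc⟩ ⟨v, by simp, hd⟩
  intro s hs t ht hst
  simp only [Set.mem_insert_iff, Set.mem_singleton_iff] at hs ht
  rcases hs with rfl | rfl <;> rcases ht with rfl | rfl
  exacts [(hst rfl).elim, huv, fun h => huv h.symm, (hst rfl).elim]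

theorem adj_of_dominating_triple {a b c d u v w : V} (hq : Quad G a b c d) (ha : G.Adj a u)
    (hb : G.Adj b v) (hc : G.Adj c v) (hd : G.Adj d w) : G.Adj u v ∨ G.Adj u w ∨ G.Adj v w := by
  by_contra! hcon
  refine h.dom hq {u, v, w} ?_ ⟨u, by simp, ha⟩ ⟨v, by simp, hb⟩ ⟨v, by simp, hc⟩ ⟨w, by simp, hd⟩
  intro s hs t ht hst
  simp only [Set.mem_insert_iff, Set.mem_singleton_iff] at hs ht
  rcases hs with rfl | rfl | rfl <;> rcases ht with rfl | rfl | rfl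
  exacts [(hst rfl).elim, hcon.1, hcon.2.1, fun h => hcon.1 h.symm, (hst rfl).elim, hcon.2.2,
    fun h => hcon.2.1 h.symm, fun h => hcon.2.2 h.symm, (hst rfl).elim]

/-- An edge lies in at most two maximal cliques. -/
theorem mem_of_three_quads {a b c d u v g g' : V} (h1 : Quad G a b c d) (h2 : Quad G a b u v)
    (h3 : Quad G a b g g') (huc : u ≠ c) (hud : u ≠ d) (hgc : g ≠ c) (hgd : g ≠ d) :
    g = u ∨ g = v := by
  obtain ⟨x, y, z, p, q, r, s, hF⟩ := h.exists_frame a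
  have key : ∀ {x y z p q r s}, Frame G a x y z p q r s → b = x → g = u ∨ g = v := by
    rintro x y z p q r s hF rfl
    have n1 := hF.yp; have n2 := hF.yq; have n3 := hF.zp; have n4 := hF.zq
    have m1 := hF.adj_x h1.ac h1.bc
    have m2 := hF.adj_x h1.ad h1.bd
    have m3 := hF.adj_x h2.ac h2.bc
    have m4 := hF.adj_x h2.ad h2.bd
    have m5 := hF.adj_x h3.ac h3.bc
    have e1 := h1.cd
    have e2 := h2.cd
    have e3 := h1.cd.ne
    have e4 := h2.cd.ne
    grind [SimpleGraph.adj_comm]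
  have hb : Heavy G a b := ⟨u, v, c, d, h2, h1, huc, hud⟩
  rw [hF.heavy_iff] at hb
  rcases hb with hb | hb
  exacts [key hF hb, key hF.swap hb]

theorem frame_inner {a x y z p q r s : V} (hF : Frame G a x y z p q r s) (hxz : Heavy G x z) :
    ∃ m n, Frame G x a z y p q m n := by
  obtain ⟨_, _, _, _, _, _, _, hX⟩ := h.exists_frame x
  obtain ⟨y', p', q', m, n, hX⟩ := hX.reframe hF.heavy_x.symm hxz hF.mid.ad.ne
  obtain rfl : y' = y :=
    h.unique hF.mid.swap₃₄ hX.mid.bd.symm hX.mid.ad.symm hX.mid.cd.symm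
  refine ⟨m, n, ?_⟩
  have hp := hX.adj_x hF.left.bc hF.left.ac
  have hq := hX.adj_x hF.left.bd hF.left.ad
  have := hF.ne_yp; have := hF.ne_zp; have := hF.ne_yq; have := hF.ne_zq
  have := hF.left.cd.ne
  have hpq : (p = p' ∧ q = q') ∨ (p = q' ∧ q = p') := by grind
  rcases hpq with ⟨rfl, rfl⟩ | ⟨rfl, rfl⟩
  exacts [hX, hX.swapLeft]

/-- The second heavy edge at y, besides the one to a, must leave the clique {a, x, y, z}, and the
only other common neighbours of a and y are r and s. -/
theorem frame_outer {a x y z p q r s : V} (hF : Frame G a x y z p q r s) (hyx : ¬ Heavy G y x)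
    (hyz : ¬ Heavy G y z) :
    ∃ u v, Frame G y a r s x z u v ∨ Frame G y a s r x z u v := by
  obtain ⟨b, c, _, _, _, _, _, hY⟩ := h.exists_frame y
  obtain ⟨t, hta, hyt⟩ : ∃ t, t ≠ a ∧ Heavy G y t := by
    by_cases hb : b = a
    · exact ⟨c, hb ▸ hY.mid.bc.ne', hY.heavy_y⟩
    · exact ⟨b, hb, hY.heavy_x⟩
  obtain ⟨w, x', z', u, v, hY⟩ := hY.reframe hF.heavy_y.symm hyt hta.symm
  have ht := hF.swap.adj_x hY.mid.bc hY.mid.ac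
  have key : ∀ {r s}, Frame G a x y z p q r s → t = r → Frame G y a r s x z u v := by
    rintro r s hF rfl
    obtain rfl : w = s := h.unique hF.right hY.mid.bd.symm hY.mid.ad.symm hY.mid.cd.symm
    have hx := hY.adj_x hF.mid.bc.symm hF.mid.ab
    have hz := hY.adj_x hF.mid.cd hF.mid.ad
    have := hF.ne_xr; have := hF.ne_xs; have := hF.ne_zr; have := hF.ne_zs
    have := hF.mid.bd.ne
    have hxz : (x = x' ∧ z = z') ∨ (x = z' ∧ z = x') := by grind
    rcases hxz with ⟨rfl, rfl⟩ | ⟨rfl, rfl⟩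
    exacts [hY, hY.swapLeft]
  rcases ht with rfl | rfl | ht | ht
  · exact (hyx hyt).elim
  · exact (hyz hyt).elim
  · exact ⟨u, v, Or.inl (key hF ht)⟩
  · exact ⟨u, v, Or.inr (key hF.swapRight ht)⟩

section Twisted

variable {a x y z p q r s m n u v g g' : V} (hA : Frame G a x y z p q r s)
  (hX : Frame G x a z y p q m n) (hY : Frame G y a r s x z u v) (hZ : Frame G z x m n a y g g')
include hA hX hY hZ

omit hY hZ in
theorem twisted_quad : Quad G r s m n := by
  have h1 := hA.mid.swap₂₃
  refine ⟨hA.right.cd, ?_, ?_, ?_, ?_, hX.right.cd⟩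
  exacts [h.adj_of_dominating_pair h1 hA.right.ac hA.right.bc hX.right.ac hX.right.bc,
    h.adj_of_dominating_pair h1 hA.right.ac hA.right.bc hX.right.ad hX.right.bd,
    h.adj_of_dominating_pair h1 hA.right.ad hA.right.bd hX.right.ac hX.right.bc,
    h.adj_of_dominating_pair h1 hA.right.ad hA.right.bd hX.right.ad hX.right.bd]

omit hZ in
-- If p and u are not adjacent, domination of {a, x, z, y} by p, m, u and by p, n, u makes u
-- adjacent to m and n. With r this is three vertices of the clique {r, s, m, n}, so u = s,
-- contradicting the frame at y.
theorem twisted_adj : G.Adj p u := by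
  have hq := h.twisted_quad hA hX
  have h1 : Quad G a x z y := hA.mid.swap₃₄
  by_contra hpu
  have hm := h.adj_of_dominating_triple (u := p) (v := m) (w := u) h1 hA.left.ac hX.right.ac
    hX.right.bc hY.right.ac
  have hn := h.adj_of_dominating_triple (u := p) (v := n) (w := u) h1 hA.left.ac hX.right.ad
    hX.right.bd hY.right.ac
  have hum : G.Adj u m := (((hm.resolve_left hX.pr).resolve_left hpu)).symm
  have hun : G.Adj u n := (((hn.resolve_left hX.ps).resolve_left hpu)).symm
  have hus : u = s := h.unique hq.swap₂₃.swap₃₄ hY.right.bc.symm hum hun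
  exact hY.zs (hus ▸ hY.right.cd)

omit hA hX hY hZ in
-- This configuration is a heavy path r, y, a, x, z, m that does not close up at y and z. The edge
-- pq lies in cliques with {a, x}, {u, v} and {g, g'}, so the last two pairs coincide. Then uv lies
-- in cliques with {p, q}, {y, r} and {z, m}, one too many.
theorem twisted_false (hA : Frame G a x y z p q r s) (hX : Frame G x a z y p q m n)
    (hY : Frame G y a r s x z u v) (hZ : Frame G z x m n a y g g') : False := by
  have h1 : Quad G p q u v := ⟨hA.left.cd, h.twisted_adj hA hX hY,
    h.twisted_adj hA hX hY.swapRight, h.twisted_adj hA.swapLeft hX.swapLeft hY,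
    h.twisted_adj hA.swapLeft hX.swapLeft hY.swapRight, hY.right.cd⟩
  have h2 : Quad G p q g g' := ⟨hA.left.cd, h.twisted_adj hX hA hZ,
    h.twisted_adj hX hA hZ.swapRight, h.twisted_adj hX.swapLeft hA.swapLeft hZ,
    h.twisted_adj hX.swapLeft hA.swapLeft hZ.swapRight, hZ.right.cd⟩
  have h3 : Quad G p q a x := ⟨hA.left.cd, hA.left.ac.symm, hA.left.bc.symm, hA.left.ad.symm,
    hA.left.bd.symm, hA.left.ab⟩
  have e1 := h.mem_of_three_quads h3 h1 h2 hY.ne_xr.symm hY.ne_pr.symm hZ.ne_pr.symm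
    hZ.ne_xr.symm
  have e2 := h.mem_of_three_quads h3 h1 h2.swap₃₄ hY.ne_xr.symm hY.ne_pr.symm hZ.ne_ps.symm
    hZ.ne_xs.symm
  have h4 : Quad G u v p q := ⟨h1.cd, h1.ac.symm, h1.bc.symm, h1.ad.symm, h1.bd.symm, h1.ab⟩
  have h5 : Quad G u v y r := ⟨h1.cd, hY.right.ac.symm, hY.right.bc.symm, hY.right.ad.symm,
    hY.right.bd.symm, hY.right.ab⟩
  have h6 : Quad G g g' z m := ⟨h2.cd, hZ.right.ac.symm, hZ.right.bc.symm, hZ.right.ad.symm,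
    hZ.right.bd.symm, hZ.right.ab⟩
  have h7 : Quad G u v z m := by
    have := h2.cd.ne
    have hgu : (g = u ∧ g' = v) ∨ (g = v ∧ g' = u) := by grind
    rcases hgu with ⟨rfl, rfl⟩ | ⟨rfl, rfl⟩
    exacts [h6, h6.swap₁₂]
  rcases h.mem_of_three_quads h4 h5 h7 hA.ne_yp hA.ne_yq hA.ne_zp hA.ne_zq with h8 | h8
  exacts [hA.mid.cd.ne h8.symm, hA.ne_zr h8]

end Twisted

/-- The clique {a, x, y, z} contains a heavy edge at z, and za is not heavy. If only one of zx and
zy were heavy, the outer frames would give the twisted configuration. -/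
theorem heavy_zx_and_zy {a x y z p q r s : V} (hF : Frame G a x y z p q r s) :
    Heavy G z x ∧ Heavy G z y := by
  have key : ∀ {x y p q r s}, Frame G a x y z p q r s → Heavy G z x → Heavy G z y := by
    intro x y p q r s hA hzx
    by_contra hzy
    obtain ⟨m, n, hX⟩ := h.frame_inner hA hzx.symm
    have hxy : ¬ Heavy G x y := hX.not_heavy_z
    obtain ⟨u, v, hY⟩ := h.frame_outer hA (fun h1 => hxy h1.symm) (fun h1 => hzy h1.symm)
    obtain ⟨g, g', hZ⟩ := h.frame_outer hX (fun h1 => hA.not_heavy_z h1.symm) hzy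
    rcases hY with hY | hY <;> rcases hZ with hZ | hZ
    exacts [h.twisted_false hA hX hY hZ, h.twisted_false hA hX.swapRight hY hZ,
      h.twisted_false hA.swapRight hX hY hZ, h.twisted_false hA.swapRight hX.swapRight hY hZ]
  obtain ⟨_, _, _, _, _, _, _, hZ⟩ := h.exists_frame z
  rcases hZ.heavy_of_quad (u := a) (v := x) (w := y) ⟨hF.mid.ad.symm, hF.mid.bd.symm,
    hF.mid.cd.symm, hF.mid.ab, hF.mid.ac, hF.mid.bc⟩ with h1 | h1 | h1
  · exact (hF.not_heavy_z h1.symm).elim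
  · exact ⟨h1, key hF h1⟩
  · exact ⟨key hF.swap h1, h1⟩

end IsLocallyQ

/-! ### Finite connected graphs of valency two. -/

section Cycle

variable {K : Type*} {H : SimpleGraph K}

theorem exists_other_nbr (h2 : ∀ u, ∃ v w, v ≠ w ∧ ∀ x, H.Adj u x ↔ x = v ∨ x = w) :
    ∃ o : K → K → K, ∀ v u, H.Adj v u →
      H.Adj v (o v u) ∧ o v u ≠ u ∧ (∀ x, H.Adj v x → x = u ∨ x = o v u) := by
  have hex : ∀ v u, ∃ w, H.Adj v u → H.Adj v w ∧ w ≠ u ∧ (∀ x, H.Adj v x → x = u ∨ x = w) := by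
    intro v u
    by_cases hvu : H.Adj v u
    · obtain ⟨a, b, hab, hv⟩ := h2 v
      rcases (hv u).1 hvu with rfl | rfl
      · exact ⟨b, fun _ => ⟨(hv b).2 (Or.inr rfl), hab.symm, fun x hx => (hv x).1 hx⟩⟩
      · exact ⟨a, fun _ => ⟨(hv a).2 (Or.inl rfl), hab, fun x hx => ((hv x).1 hx).symm⟩⟩
    · exact ⟨u, fun h => absurd h hvu⟩
  choose o ho using hex
  exact ⟨o, ho⟩

/-- A bi-infinite walk without backtracking in a graph of valency two. -/
structure IsNonBacktracking (H : SimpleGraph K) (x : ℤ → K) : Prop where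
  adj : ∀ i, H.Adj (x i) (x (i + 1))
  nbr : ∀ i y, H.Adj (x i) y → y = x (i + 1) ∨ y = x (i - 1)
  ne : ∀ i, x (i + 1) ≠ x (i - 1)

namespace IsNonBacktracking

variable {x : ℤ → K} (h : IsNonBacktracking H x)
include h

theorem adj' (i : ℤ) : H.Adj (x i) (x (i - 1)) := by
  have := h.adj (i - 1)
  rw [sub_add_cancel] at this
  exact this.symm

theorem reflect {i j : ℤ} (h0 : x i = x j) (h1 : x (i - 1) = x (j + 1)) (m : ℕ) :
    x (i - m) = x (j + m) ∧ x (i - m - 1) = x (j + m + 1) := by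
  induction m with
  | zero => simpa using ⟨h0, h1⟩
  | succ m ih =>
    push_cast
    have e1 : i - (m + 1 : ℤ) = i - m - 1 := by ring
    have e2 : j + (m + 1 : ℤ) = j + m + 1 := by ring
    rw [e1, e2]
    refine ⟨ih.2, ?_⟩
    have h3 := h.adj' (i - m - 1)
    rw [ih.2] at h3
    rcases h.nbr _ _ h3 with h4 | h4
    · exact h4
    · have h5 := h.ne (i - m - 1)
      rw [h4, sub_add_cancel, add_sub_cancel_right] at h5
      exact (h5 ih.1).elim

theorem reflect_false {j : ℤ} (d : ℕ) (h0 : x (j + d) = x j) (h1 : x (j + d - 1) = x (j + 1)) :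
    False := by
  rcases Nat.even_or_odd' d with ⟨m, rfl | rfl⟩
  · have h2 := (h.reflect h0 h1 m).2
    push_cast at h2
    have h3 := h.ne (j + m)
    rw [show j + 2 * (m : ℤ) - m - 1 = j + m - 1 by ring] at h2
    exact h3 h2.symm
  · have h2 := (h.reflect h0 h1 m).1
    push_cast at h2
    rw [show j + (2 * (m : ℤ) + 1) - m = j + m + 1 by ring] at h2
    exact (h.adj (j + m)).ne h2.symm

/-- On a return to the same vertex, leaving in the opposite direction would make the walk between
the two visits a palindrome. Its midpoint would be a backtrack or a loop. -/
theorem next_eq {i j : ℤ} (h0 : x i = x j) : x (i + 1) = x (j + 1) := by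
  have key : ∀ {i j : ℤ}, j ≤ i → x i = x j → x (i + 1) = x (j + 1) := by
    intro i j hij h0
    obtain ⟨d, rfl⟩ := Int.le.dest hij
    have h1 := h.adj (j + d)
    have h2 := h.adj' (j + d)
    rw [h0] at h1 h2
    rcases h.nbr _ _ h1 with h3 | h3
    · exact h3
    · rcases h.nbr _ _ h2 with h4 | h4
      · exact (h.reflect_false d h0 h4).elim
      · exact (h.ne (j + d) (h3.trans h4.symm)).elim
  rcases le_total j i with hij | hij
  · exact key hij h0
  · exact (key hij h0.symm).symm

end IsNonBacktracking

theorem exists_isNonBacktracking (hconn : H.Connected)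
    (h2 : ∀ u, ∃ v w, v ≠ w ∧ ∀ x, H.Adj u x ↔ x = v ∨ x = w) [Finite K] :
    ∃ (x : ℤ → K) (n : ℕ), 0 < n ∧ IsNonBacktracking H x ∧
      ∀ i j : ℤ, x i = x j ∧ x (i + 1) = x (j + 1) ↔ (n : ℤ) ∣ i - j := by
  obtain ⟨o, ho⟩ := exists_other_nbr h2
  have hoo : ∀ v u, H.Adj v u → o v (o v u) = u := by
    intro v u hvu
    have h3 := ho v u hvu
    have h4 := ho v _ h3.1
    rcases h3.2.2 _ h4.1 with h5 | h5
    · exact h5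
    · exact (h4.2.1 h5).elim
  let D := {p : K × K // H.Adj p.1 p.2}
  -- The walk is the orbit of a dart under the permutation that steps forward to the other
  -- neighbour; n is the period of that orbit.
  let τ : Equiv.Perm D :=
    { toFun := fun d => ⟨(d.1.2, o d.1.2 d.1.1), (ho _ _ d.2.symm).1⟩
      invFun := fun d => ⟨(o d.1.1 d.1.2, d.1.1), (ho _ _ d.2).1.symm⟩
      left_inv := fun d => Subtype.ext (Prod.ext (hoo _ _ d.2.symm) rfl)
      right_inv := fun d => Subtype.ext (Prod.ext rfl (hoo _ _ d.2)) }
  obtain ⟨u₀⟩ := hconn.nonempty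
  obtain ⟨v₀, w₀, -, hu₀⟩ := h2 u₀
  let d₀ : D := ⟨(u₀, v₀), (hu₀ v₀).2 (Or.inl rfl)⟩
  let x : ℤ → K := fun i => ((τ ^ i) d₀).1.1
  have hx1 : ∀ i, ((τ ^ i) d₀).1.2 = x (i + 1) := by
    intro i
    simp only [x, add_comm i 1, zpow_add, zpow_one]
    rfl
  have hx2 : ∀ i, x (i + 2) = o (x (i + 1)) (x i) := by
    intro i
    rw [show i + 2 = i + 1 + 1 by ring, ← hx1 (i + 1), ← hx1 i]
    rw [add_comm i 1, zpow_add, zpow_one]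
    rfl
  have hadj : ∀ i, H.Adj (x i) (x (i + 1)) := fun i => by
    rw [← hx1]; exact ((τ ^ i) d₀).2
  refine ⟨x, Function.minimalPeriod (τ • ·) d₀, ?_, ⟨hadj, fun i y hy => ?_, fun i => ?_⟩,
    fun i j => ?_⟩
  · exact Function.minimalPeriod_pos_of_mem_periodicPts
      ((MulAction.injective τ).mem_periodicPts d₀)
  · have h3 := hadj (i - 1)
    have h4 := hx2 (i - 1)
    rw [sub_add_cancel] at h3
    rw [sub_add_cancel, show i - 1 + 2 = i + 1 by ring] at h4
    rw [h4]
    exact ((ho _ _ h3.symm).2.2 y hy).symm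
  · have h3 := hadj (i - 1)
    have h4 := hx2 (i - 1)
    rw [sub_add_cancel] at h3
    rw [sub_add_cancel, show i - 1 + 2 = i + 1 by ring] at h4
    rw [h4]
    exact (ho _ _ h3.symm).2.1
  · rw [← MulAction.zpow_smul_eq_iff_minimalPeriod_dvd, ← hx1, ← hx1, sub_eq_neg_add, zpow_add,
      zpow_neg, mul_smul, inv_smul_eq_iff]
    constructor
    · rintro ⟨h3, h4⟩
      exact Subtype.ext (Prod.ext h3 h4)
    · intro h3
      have h4 : (τ ^ i) d₀ = (τ ^ j) d₀ := h3
      exact ⟨congrArg (fun d : D => d.1.1) h4, congrArg (fun d : D => d.1.2) h4⟩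

/-- A finite connected graph of valency two is a cycle. -/
theorem exists_cycle_equiv [Finite K] (hconn : H.Connected)
    (h2 : ∀ u, ∃ v w, v ≠ w ∧ ∀ x, H.Adj u x ↔ x = v ∨ x = w) :
    ∃ n : ℕ, 3 ≤ n ∧ ∃ f : ZMod n ≃ K, ∀ i j, H.Adj (f i) (f j) ↔ j = i + 1 ∨ i = j + 1 := by
  obtain ⟨x, n, hn, hx, hper⟩ := exists_isNonBacktracking hconn h2
  have hxeq : ∀ i j : ℤ, x i = x j ↔ (i : ZMod n) = j := by
    intro i j
    rw [eq_comm (a := (i : ZMod n)), ZMod.intCast_eq_intCast_iff_dvd_sub, ← hper]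
    exact ⟨fun h => ⟨h, hx.next_eq h⟩, fun h => h.1⟩
  have : NeZero n := ⟨hn.ne'⟩
  let f : ZMod n → K := fun i => x (i.cast : ℤ)
  have hf : ∀ i : ℤ, x i = f (i : ZMod n) := fun i => by
    rw [hxeq, ZMod.intCast_zmod_cast]
  have hinj : Function.Injective f := fun i j hij => by
    have h3 := (hxeq _ _).1 hij
    rwa [ZMod.intCast_zmod_cast, ZMod.intCast_zmod_cast] at h3
  have hsurj : Function.Surjective f := by
    intro v
    obtain ⟨p⟩ := hconn.preconnected (x 0) v
    have key : ∀ {u v : K}, H.Walk u v → (∃ i : ℤ, x i = u) → ∃ i : ℤ, x i = v := by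
      intro u v p
      induction p with
      | nil => exact id
      | cons hadj _ ih =>
        rintro ⟨i, rfl⟩
        rcases hx.nbr i _ hadj with h3 | h3
        exacts [ih ⟨_, h3.symm⟩, ih ⟨_, h3.symm⟩]
    obtain ⟨i, rfl⟩ := key p ⟨0, rfl⟩
    exact ⟨_, (hf i).symm⟩
  refine ⟨n, ?_, Equiv.ofBijective f ⟨hinj, hsurj⟩, fun i j => ?_⟩
  -- If n divides 2, then x 1 = x (-1), a backtrack.
  · by_contra hlt
    have h3 := hx.ne 0
    have h4 : (n : ℤ) ∣ (0 + 1) - (0 - 1) := by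
      have : n = 1 ∨ n = 2 := by omega
      rcases this with rfl | rfl <;> norm_num
    exact h3 ((hper _ _).2 h4).1
  · have h5 : ∀ k : ℤ, H.Adj (x k) (f j) ↔ j = k + 1 ∨ (k : ZMod n) = j + 1 := by
      intro k
      have e1 : f j = x (k + 1) ↔ j = k + 1 := by
        rw [hf, hinj.eq_iff]; push_cast; rfl
      have e2 : f j = x (k - 1) ↔ (k : ZMod n) = j + 1 := by
        rw [hf, hinj.eq_iff]; push_cast; rw [eq_sub_iff_add_eq, eq_comm]
      rw [← e1, ← e2]
      exact ⟨hx.nbr k _, fun h3 => by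
        rcases h3 with h3 | h3 <;> rw [h3]
        exacts [hx.adj k, hx.adj' k]⟩
    have h6 := h5 (i.cast : ℤ)
    rw [hf, ZMod.intCast_zmod_cast] at h6
    exact h6

end Cycle

/-- Two vertices in the same layer: equal, or joined by a path of at most two heavy edges. -/
def Layer {V : Type*} (G : SimpleGraph V) (a b : V) : Prop :=
  a = b ∨ Heavy G a b ∨ ∃ x, Heavy G a x ∧ Heavy G x b

/-- A heavy four-cycle `a, x, z, y`, together with the second maximal clique on each of its
edges. -/
structure Hub {V : Type*} (G : SimpleGraph V) (a x z y p q m n g g' r s : V) : Prop where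
  fa : Frame G a x y z p q r s
  fx : Frame G x a z y p q m n
  fz : Frame G z x y a m n g g'
  fy : Frame G y a z x r s g g'
  quadF : Quad G p q g g'
  quadB : Quad G r s m n

/-! ### Layers and their neighbouring layers. -/

namespace Hub

variable {V : Type*} {G : SimpleGraph V} {a x z y p q m n g g' r s : V}

theorem rot (h : Hub G a x z y p q m n g g' r s) : Hub G x z y a m n g g' r s p q :=
  ⟨h.fx.swap, h.fz, h.fy.swap, h.fa, ⟨h.quadB.cd, h.quadB.ac.symm, h.quadB.bc.symm,
    h.quadB.ad.symm, h.quadB.bd.symm, h.quadB.ab⟩, h.quadF⟩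

theorem reflect (h : Hub G a x z y p q m n g g' r s) : Hub G a y z x r s g g' m n p q :=
  ⟨h.fa.swap, h.fy, h.fz.swap, h.fx, h.quadB, h.quadF⟩

theorem layer_iff (h : Hub G a x z y p q m n g g' r s) {v : V} :
    Layer G a v ↔ v = a ∨ v = x ∨ v = z ∨ v = y := by
  constructor
  · rintro (rfl | hv | ⟨u, hu, hv⟩)
    · exact Or.inl rfl
    · rw [h.fa.heavy_iff] at hv; tauto
    · rw [h.fa.heavy_iff] at hu
      rcases hu with rfl | rfl
      · rw [h.fx.heavy_iff] at hv; tauto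
      · rw [h.fy.heavy_iff] at hv; tauto
  · rintro (rfl | rfl | rfl | rfl)
    · exact Or.inl rfl
    · exact Or.inr (Or.inl h.fa.heavy_x)
    · exact Or.inr (Or.inr ⟨x, h.fa.heavy_x, h.fx.heavy_y⟩)
    · exact Or.inr (Or.inl h.fa.heavy_y)

theorem layer_congr (h : Hub G a x z y p q m n g g' r s) {b : V} (hb : Layer G a b) (v : V) :
    Layer G b v ↔ Layer G a v := by
  rw [h.layer_iff] at hb ⊢
  rcases hb with rfl | rfl | rfl | rfl
  · rw [h.layer_iff]
  · rw [h.rot.layer_iff]; tauto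
  · rw [h.rot.rot.layer_iff]; tauto
  · rw [h.rot.rot.rot.layer_iff]; tauto

theorem quad (h : Hub G a x z y p q m n g g' r s) : Quad G a x z y := h.fa.mid.swap₃₄

theorem adj_of_layer (h : Hub G a x z y p q m n g g' r s) {v : V} (hv : Layer G a v)
    (hne : a ≠ v) : G.Adj a v := by
  rw [h.layer_iff] at hv
  rcases hv with rfl | rfl | rfl | rfl
  exacts [(hne rfl).elim, h.quad.ab, h.quad.ac, h.quad.ad]

theorem card_layer [Fintype V] [DecidableEq V] [DecidablePred (Layer G a)]
    (h : Hub G a x z y p q m n g g' r s) : (Finset.univ.filter (Layer G a)).card = 4 := by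
  rw [← h.quad.isNClique.card_eq]
  congr 1
  ext v
  simp [h.layer_iff]

end Hub

namespace IsLocallyQ

variable {V : Type*} {G : SimpleGraph V} (h : IsLocallyQ G)
include h

theorem exists_hub (a : V) : ∃ x z y p q m n g g' r s, Hub G a x z y p q m n g g' r s := by
  obtain ⟨x, y, z, p, q, r, s, hA⟩ := h.exists_frame a
  obtain ⟨hzx, hzy⟩ := h.heavy_zx_and_zy hA
  obtain ⟨m, n, hX⟩ := h.frame_inner hA hzx.symm
  obtain ⟨g, g', hZ⟩ := h.frame_inner hX.swap hzy
  obtain ⟨g₂, g₂', hY⟩ := h.frame_inner hA.swap hzy.symm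
  have hY' : Frame G y a z x r s g g' := by
    have h1 := hY.swap.adj_x hZ.right.bc hZ.right.ac
    have h2 := hY.swap.adj_x hZ.right.bd hZ.right.ad
    have := hZ.ne_xr; have := hZ.ne_xs; have := hZ.ne_zr; have := hZ.ne_zs
    have := hZ.right.cd.ne
    have hg : (g = g₂ ∧ g' = g₂') ∨ (g = g₂' ∧ g' = g₂) := by grind
    rcases hg with ⟨rfl, rfl⟩ | ⟨rfl, rfl⟩
    exacts [hY, hY.swapRight]
  refine ⟨x, z, y, p, q, m, n, g, g', r, s, hA, hX, hZ, hY', ?_, ?_⟩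
  · have hq := hA.mid.swap₃₄
    exact ⟨hA.left.cd,
      h.adj_of_dominating_pair hq hA.left.ac hA.left.bc hZ.right.ac hZ.right.bc,
      h.adj_of_dominating_pair hq hA.left.ac hA.left.bc hZ.right.ad hZ.right.bd,
      h.adj_of_dominating_pair hq hA.left.ad hA.left.bd hZ.right.ac hZ.right.bc,
      h.adj_of_dominating_pair hq hA.left.ad hA.left.bd hZ.right.ad hZ.right.bd, hZ.right.cd⟩
  · have hq := hA.mid.swap₂₃
    exact ⟨hA.right.cd,
      h.adj_of_dominating_pair hq hA.right.ac hA.right.bc hX.right.ac hX.right.bc,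
      h.adj_of_dominating_pair hq hA.right.ac hA.right.bc hX.right.ad hX.right.bd,
      h.adj_of_dominating_pair hq hA.right.ad hA.right.bd hX.right.ac hX.right.bc,
      h.adj_of_dominating_pair hq hA.right.ad hA.right.bd hX.right.ad hX.right.bd, hX.right.cd⟩

theorem layer_equivalence : Equivalence (Layer G) := by
  refine ⟨fun _ => Or.inl rfl, fun {u v} huv => ?_, fun {u v w} huv hvw => ?_⟩ <;>
    obtain ⟨_, _, _, _, _, _, _, _, _, _, _, hH⟩ := h.exists_hub u
  · rw [hH.layer_congr huv]; exact Or.inl rfl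
  · rwa [hH.layer_congr huv] at hvw

variable {a x z y p q m n g g' r s : V} (hH : Hub G a x z y p q m n g g' r s)
include hH

/-- The edge pq is heavy, being in cliques with {a, x} and {g, g'}, whereas pa and px are not. The
second heavy neighbour of p shares a clique with p and q, so it is g or g', and the remaining vertex
is forced. -/
theorem layer_p_iff {v : V} : Layer G p v ↔ v = p ∨ v = q ∨ v = g ∨ v = g' := by
  have hap : ¬ Heavy G p a := fun h1 => hH.fa.not_heavy_p h1.symm
  have hxp : ¬ Heavy G p x := fun h1 => hH.fx.not_heavy_p h1.symm
  have h3 : Quad G p q a x := ⟨hH.fa.left.cd, hH.fa.left.ac.symm, hH.fa.left.bc.symm,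
    hH.fa.left.ad.symm, hH.fa.left.bd.symm, hH.fa.left.ab⟩
  have hga : g ≠ a := hH.fz.ne_zr.symm
  have hgx : g ≠ x := hH.fz.ne_xr.symm
  have hpq : Heavy G p q := ⟨g, g', a, x, hH.quadF, h3, hga, hgx⟩
  have key : ∀ {x' z' y' p' q' m' n' e e' r' s'}, Hub G p x' z' y' p' q' m' n' e e' r' s' →
      q = x' → (Layer G p v ↔ v = p ∨ v = q ∨ v = g ∨ v = g') := by
    rintro x' z' y' p' q' m' n' e e' r' s' hH' rfl
    have h4 := h.mem_of_three_quads h3 hH.quadF hH'.fa.mid hga hgx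
      (fun h5 => hap (h5 ▸ hH'.fa.heavy_y)) (fun h5 => hxp (h5 ▸ hH'.fa.heavy_y))
    rw [hH'.layer_iff]
    rcases h4 with rfl | rfl
    · obtain rfl := h.unique hH.quadF hH'.fa.mid.ad.symm hH'.fa.mid.bd.symm hH'.fa.mid.cd.symm
      tauto
    · obtain rfl := h.unique hH.quadF.swap₃₄ hH'.fa.mid.ad.symm hH'.fa.mid.bd.symm
        hH'.fa.mid.cd.symm
      tauto
  obtain ⟨_, _, _, _, _, _, _, _, _, _, _, hH'⟩ := h.exists_hub p
  rw [hH'.fa.heavy_iff] at hpq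
  rcases hpq with h1 | h1
  exacts [key hH' h1, key hH'.reflect h1]

/-- The layers split as {a, x}, {z, y} and {p, q}, {g, g'}, corresponding halves being completely
joined and the others not at all. This is the origin of the binary labels. -/
theorem adj_iff_of_layers {v c : V} (hv : Layer G a v) (hc : Layer G p c) :
    G.Adj v c ↔ (G.Adj v p ↔ (c = p ∨ c = q)) := by
  rw [hH.layer_iff] at hv
  rw [h.layer_p_iff hH] at hc
  have a1 := hH.fa.left
  have a2 := hH.fz.right
  have n1 := hH.fa.yp; have n2 := hH.fa.yq; have n3 := hH.fa.zp; have n4 := hH.fa.zq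
  have n5 := hH.fz.zr; have n6 := hH.fz.zs; have n7 := hH.fz.xr; have n8 := hH.fz.xs
  have e1 := hH.quadF.ac.ne; have e2 := hH.quadF.ad.ne
  have e3 := hH.quadF.bc.ne; have e4 := hH.quadF.bd.ne
  rcases hv with rfl | rfl | rfl | rfl <;> rcases hc with rfl | rfl | rfl | rfl <;>
    simp [a1.ac, a1.ad, a1.bc, a1.bd, a2.ac, a2.ad, a2.bc, a2.bd, n1, n2, n3, n4, n5, n6, n7, n8,
      e1.symm, e2.symm, e3.symm, e4.symm]

omit h in
theorem _root_.CISGraph.Hub.not_layer_p : ¬ Layer G a p := by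
  rw [hH.layer_iff]
  rintro (h1 | h1 | h1 | h1)
  exacts [hH.fa.left.ac.ne h1.symm, hH.fa.left.bc.ne h1.symm, hH.fa.ne_zp h1.symm,
    hH.fa.ne_yp h1.symm]

theorem not_layer_pr : ¬ Layer G p r := by
  rw [h.layer_p_iff hH]
  rintro (h1 | h1 | h1 | h1)
  exacts [hH.fa.ne_pr h1.symm, hH.fa.ne_qr h1.symm, hH.fy.ne_pr h1, hH.fy.ne_ps h1]

theorem layer_of_adj {b c : V} (hb : Layer G a b) (hbc : G.Adj b c) :
    Layer G a c ∨ Layer G p c ∨ Layer G r c := by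
  rw [hH.layer_iff, h.layer_p_iff hH, h.layer_p_iff hH.reflect]
  rw [hH.layer_iff] at hb
  rcases hb with rfl | rfl | rfl | rfl
  · have := hH.fa.all c hbc; tauto
  · have := hH.fx.all c hbc; tauto
  · have := hH.fz.all c hbc; tauto
  · have := hH.fy.all c hbc; tauto

end IsLocallyQ

/-! ### Coordinates and the isomorphism with Q_n. -/

theorem graphQ_adj {n : ℕ} {p q : ZMod n × ZMod 2 × ZMod 2} :
    (graphQ n).Adj p q ↔ p ≠ q ∧ (p.1 = q.1 ∨ (q.1 = p.1 + 1 ∧ q.2.1 = p.2.2) ∨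
      (p.1 = q.1 + 1 ∧ p.2.1 = q.2.2)) := by
  simp only [graphQ, graphPX, SimpleGraph.sup_adj, SimpleGraph.fromRel_adj]
  constructor
  · rintro (⟨h1, h2⟩ | ⟨h1, h2 | h2⟩)
    exacts [⟨h1, Or.inr h2⟩, ⟨h1, Or.inl h2⟩, ⟨h1, Or.inl h2.symm⟩]
  · rintro ⟨h1, h2 | h2⟩
    exacts [Or.inr ⟨h1, Or.inl h2⟩, Or.inl ⟨h1, h2⟩]

/-- A maximal clique of size three: the reason why n = 3 is excluded. -/
theorem graphQ_three_triangle (d : ZMod 3 × ZMod 2 × ZMod 2) :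
    ¬ ((graphQ 3).Adj (0, 0, 0) d ∧ (graphQ 3).Adj (1, 0, 0) d ∧ (graphQ 3).Adj (2, 0, 0) d) := by
  simp only [graphQ_adj]
  revert d
  decide

namespace IsLocallyQ

variable {V : Type*} {G : SimpleGraph V} (h : IsLocallyQ G)

/-- The quotient of the graph by its layers. -/
def layerGraph : SimpleGraph (Quotient (⟨Layer G, h.layer_equivalence⟩ : Setoid V)) where
  Adj k l := k ≠ l ∧ ∃ u v, Quotient.mk _ u = k ∧ Quotient.mk _ v = l ∧ G.Adj u v
  symm := ⟨fun _ _ h => ⟨h.1.symm, by obtain ⟨-, u, v, hu, hv, huv⟩ := h; exact ⟨v, u, hv, hu, huv.symm⟩⟩⟩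
  loopless := ⟨fun _ h => h.1 rfl⟩

include h

theorem layerGraph_adj_mk {a x z y p q m n g g' r s : V} (hH : Hub G a x z y p q m n g g' r s)
    (l : Quotient (⟨Layer G, h.layer_equivalence⟩ : Setoid V)) :
    h.layerGraph.Adj (Quotient.mk _ a) l ↔ l = Quotient.mk _ p ∨ l = Quotient.mk _ r := by
  constructor
  · rintro ⟨hne, u, v, hu, rfl, huv⟩
    have hau : Layer G a u := Quotient.exact hu.symm
    rcases h.layer_of_adj hH hau huv with h1 | h1 | h1
    · exact (hne (Quotient.sound h1)).elim
    · exact Or.inl (Quotient.sound h1).symm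
    · exact Or.inr (Quotient.sound h1).symm
  · rintro (rfl | rfl)
    · exact ⟨fun h1 => hH.not_layer_p (Quotient.exact h1), a, p, rfl, rfl, hH.fa.left.ac⟩
    · exact ⟨fun h1 => hH.reflect.not_layer_p (Quotient.exact h1), a, r, rfl, rfl,
        hH.fa.right.ac⟩

theorem layerGraph_nbrs (k : Quotient (⟨Layer G, h.layer_equivalence⟩ : Setoid V)) :
    ∃ v w, v ≠ w ∧ ∀ x, h.layerGraph.Adj k x ↔ x = v ∨ x = w := by
  obtain ⟨a, rfl⟩ := Quotient.exists_rep k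
  obtain ⟨_, _, _, p, _, _, _, _, _, r, _, hH⟩ := h.exists_hub a
  exact ⟨_, _, fun h1 => h.not_layer_pr hH (Quotient.exact h1), h.layerGraph_adj_mk hH⟩

theorem layerGraph_connected (hconn : G.Connected) : h.layerGraph.Connected := by
  have : Nonempty V := hconn.nonempty
  refine (SimpleGraph.connected_iff_exists_forall_reachable _).2 ?_
  obtain ⟨u⟩ := this
  refine ⟨Quotient.mk _ u, fun k => ?_⟩
  obtain ⟨v, rfl⟩ := Quotient.exists_rep k
  obtain ⟨w⟩ := hconn.preconnected u v
  induction w with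
  | nil => exact SimpleGraph.Reachable.refl _
  | @cons a b c hab _ ih =>
    refine SimpleGraph.Reachable.trans ?_ ih
    by_cases hne : (Quotient.mk _ a : Quotient (⟨Layer G, h.layer_equivalence⟩ : Setoid V)) =
        Quotient.mk _ b
    · rw [hne]
    · exact SimpleGraph.Adj.reachable ⟨hne, a, b, rfl, rfl, hab⟩

theorem exists_labels {k l : Quotient (⟨Layer G, h.layer_equivalence⟩ : Setoid V)}
    (hkl : h.layerGraph.Adj k l) : ∃ α β : V → ZMod 2, ∀ v c, Quotient.mk _ v = k →
      Quotient.mk _ c = l → (G.Adj v c ↔ β c = α v) := by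
  classical
  obtain ⟨a, rfl⟩ := Quotient.exists_rep k
  have key : ∀ {x z y p q m n g g' r s}, Hub G a x z y p q m n g g' r s → l = Quotient.mk _ p →
      ∃ α β : V → ZMod 2, ∀ v c, (Quotient.mk _ v :
        Quotient (⟨Layer G, h.layer_equivalence⟩ : Setoid V)) = Quotient.mk _ a →
      Quotient.mk _ c = l → (G.Adj v c ↔ β c = α v) := by
    rintro x z y p q m n g g' r s hH rfl
    refine ⟨fun v => if G.Adj v p then 0 else 1, fun c => if c = p ∨ c = q then 0 else 1,
      fun v c hv hc => ?_⟩
    rw [h.adj_iff_of_layers hH (Quotient.exact hv.symm) (Quotient.exact hc.symm)]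
    by_cases h1 : G.Adj v p <;> by_cases h2 : c = p ∨ c = q <;> simp [h1, h2]
  obtain ⟨_, _, _, p, _, _, _, _, _, r, _, hH⟩ := h.exists_hub a
  rcases (h.layerGraph_adj_mk hH l).1 hkl with hl | hl
  exacts [key hH hl, key hH.reflect hl]

theorem exists_coordinates [Finite V] (hconn : G.Connected) : ∃ n : ℕ, 3 ≤ n ∧
    ∃ ψ : V → ZMod n × ZMod 2 × ZMod 2,
      (∀ i, ∃ a, ∀ v, (ψ v).1 = i ↔ Layer G a v) ∧
      ∀ u v, G.Adj u v ↔ u ≠ v ∧ ((ψ u).1 = (ψ v).1 ∨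
        ((ψ v).1 = (ψ u).1 + 1 ∧ (ψ v).2.1 = (ψ u).2.2) ∨
        ((ψ u).1 = (ψ v).1 + 1 ∧ (ψ u).2.1 = (ψ v).2.2)) := by
  obtain ⟨n, hn, f, hf⟩ := exists_cycle_equiv (h.layerGraph_connected hconn) h.layerGraph_nbrs
  have hlab : ∀ i : ZMod n, ∃ α β : V → ZMod 2, ∀ v c, Quotient.mk _ v = f i →
      Quotient.mk _ c = f (i + 1) → (G.Adj v c ↔ β c = α v) := fun i =>
    h.exists_labels ((hf i (i + 1)).2 (Or.inl rfl))
  choose α β hαβ using hlab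
  let idx : V → ZMod n := fun v => f.symm (Quotient.mk _ v)
  have hidx : ∀ v, Quotient.mk _ v = f (idx v) := fun v => (f.apply_symm_apply _).symm
  have hsame : ∀ u v, idx u = idx v ↔ Layer G u v := fun u v => by
    rw [f.symm.injective.eq_iff]
    exact ⟨fun h1 => Quotient.exact h1, fun h1 => Quotient.sound h1⟩
  -- The two labels of a vertex record its half relative to the previous layer and relative to the
  -- next one.
  refine ⟨n, hn, fun v => (idx v, β (idx v - 1) v, α (idx v) v), fun i => ?_, fun u v => ?_⟩
  · obtain ⟨a, ha⟩ := Quotient.exists_rep (f i)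
    refine ⟨a, fun v => ?_⟩
    rw [← hsame]
    have : idx a = i := by simp only [idx]; rw [ha, f.symm_apply_apply]
    rw [this, eq_comm]
  · have hfwd : ∀ u v, idx v = idx u + 1 → (G.Adj u v ↔ β (idx v - 1) v = α (idx u) u) := by
      intro u v huv
      rw [show idx v - 1 = idx u by rw [huv]; ring]
      exact hαβ _ u v (hidx u) (by rw [← huv]; exact hidx v)
    simp only
    constructor
    · refine fun huv => ⟨huv.ne, ?_⟩
      by_cases hl : idx u = idx v
      · exact Or.inl hl
      · have h1 : h.layerGraph.Adj (f (idx u)) (f (idx v)) :=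
          ⟨fun h2 => hl (f.injective h2), u, v, hidx u, hidx v, huv⟩
        rcases (hf _ _).1 h1 with h2 | h2
        · exact Or.inr (Or.inl ⟨h2, (hfwd u v h2).1 huv⟩)
        · exact Or.inr (Or.inr ⟨h2, (hfwd v u h2).1 huv.symm⟩)
    · rintro ⟨hne, h1 | ⟨h1, h2⟩ | ⟨h1, h2⟩⟩
      · obtain ⟨_, _, _, _, _, _, _, _, _, _, _, hH⟩ := h.exists_hub u
        exact hH.adj_of_layer ((hsame u v).1 h1) hne
      · exact (hfwd u v h1).2 h2
      · exact ((hfwd v u h1).2 h2).symm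

theorem nonempty_iso_graphQ [Fintype V] (hconn : G.Connected) :
    ∃ n : ℕ, 4 ≤ n ∧ Nonempty (G ≃g graphQ n) := by
  classical
  obtain ⟨n, hn, ψ, hlayer, hadj⟩ := h.exists_coordinates hconn
  have : NeZero n := ⟨by omega⟩
  -- The coordinates determine the closed neighbourhood, so vertices with equal coordinates are
  -- closed twins.
  have hinj : Function.Injective ψ := by
    have key : ∀ u w, (w = u ∨ G.Adj u w) ↔ ((ψ u).1 = (ψ w).1 ∨
        ((ψ w).1 = (ψ u).1 + 1 ∧ (ψ w).2.1 = (ψ u).2.2) ∨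
        ((ψ u).1 = (ψ w).1 + 1 ∧ (ψ u).2.1 = (ψ w).2.2)) := by
      intro u w
      rw [hadj]
      by_cases hwu : w = u
      · subst hwu; simp
      · simp [hwu, Ne.symm hwu]
    intro u v huv
    refine h.twin fun w => ?_
    rw [key, key, huv]
  have hcard : Fintype.card V = n * 4 := by
    have h1 := card_eq_sum_card_fiberwise (s := univ) (t := univ) (f := fun v => (ψ v).1)
      (fun v _ => mem_coe.2 (mem_univ _))
    rw [sum_congr rfl fun i _ => show _ = 4 by
      obtain ⟨a, ha⟩ := hlayer i
      obtain ⟨_, _, _, _, _, _, _, _, _, _, _, hH⟩ := h.exists_hub a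
      rw [← hH.card_layer]
      congr 1
      ext v
      simp [ha]] at h1
    simpa [ZMod.card] using h1
  have hbij : Function.Bijective ψ := by
    rw [Fintype.bijective_iff_injective_and_card]
    refine ⟨hinj, ?_⟩
    rw [hcard, Fintype.card_prod, Fintype.card_prod, ZMod.card, ZMod.card]
  let e : G ≃g graphQ n := ⟨Equiv.ofBijective ψ hbij, fun {u v} => by
    rw [graphQ_adj, hadj]
    exact and_congr hinj.ne_iff Iff.rfl⟩
  refine ⟨n, ?_, ⟨e⟩⟩
  by_contra hlt
  obtain rfl : n = 3 := by omega
  have hsymm : ∀ {p q}, (graphQ 3).Adj p q → G.Adj (e.symm p) (e.symm q) := fun hpq =>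
    e.symm.map_adj_iff.2 hpq
  obtain ⟨d, hd⟩ := h.ext₃ (a := e.symm (0, 0, 0)) (b := e.symm (1, 0, 0)) (c := e.symm (2, 0, 0))
    (hsymm (by rw [graphQ_adj]; decide)) (hsymm (by rw [graphQ_adj]; decide))
    (hsymm (by rw [graphQ_adj]; decide))
  have he : ∀ {p}, G.Adj (e.symm p) d → (graphQ 3).Adj p (e d) := fun {p} hp => by
    have := e.map_adj_iff.2 hp
    rwa [e.apply_symm_apply] at this
  exact graphQ_three_triangle (e d) ⟨he hd.ad, he hd.bd, he hd.cd⟩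

end IsLocallyQ

/-! ### The sporadic graphs are CIS. -/

section Constructions

variable {V W : Type*}

theorem isCIS_completeGraph [Nonempty V] : IsCIS (SimpleGraph.completeGraph V) := by
  intro C S hC hS
  rw [maximal_isClique_iff] at hC
  rw [maximal_isIndepSet_iff] at hS
  have hC' : ∀ v, v ∈ C := fun v => hC.2 v fun c _ hvc => hvc
  by_contra hne
  obtain ⟨v⟩ := ‹Nonempty V›
  have hS' : ∀ s, s ∉ S := fun s hs => hne ⟨s, hC' s, hs⟩
  exact hS' v (hS.2 v fun c hc => (hS' c hc).elim)

theorem isCIS_compl_completeGraph [Nonempty V] : IsCIS (SimpleGraph.completeGraph V)ᶜ := by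
  intro C S hC hS
  rw [maximal_isClique_iff] at hC
  rw [maximal_isIndepSet_iff] at hS
  have hS' : ∀ v, v ∈ S := fun v => hS.2 v fun c _ hvc => by simp
  by_contra hne
  obtain ⟨v⟩ := ‹Nonempty V›
  have hC' : ∀ s, s ∉ C := fun s hs => hne ⟨s, hs, hS' s⟩
  exact hC' v (hC.2 v fun c hc => (hC' c hc).elim)

/-- The projections of C and S to the first factor are maximal there and share a vertex; the fibres
of C and S over it are maximal in the second factor. -/
theorem IsCIS.lexProduct [Nonempty W] {G : SimpleGraph V} {H : SimpleGraph W} (hG : IsCIS G)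
    (hH : IsCIS H) : IsCIS (lexProduct G H) := by
  intro C S hC hS
  rw [maximal_isClique_iff] at hC
  rw [maximal_isIndepSet_iff] at hS
  obtain ⟨w₀⟩ := ‹Nonempty W›
  obtain ⟨_, ⟨⟨g, c⟩, hc, rfl⟩, ⟨⟨g', s⟩, hs, hg⟩⟩ := hG (Prod.fst '' C) (Prod.fst '' S)
    (maximal_isClique_iff.2 ⟨by
      rintro _ ⟨p, hp, rfl⟩ _ ⟨q, hq, rfl⟩ hpq
      exact (hC.1 hp hq fun h => hpq (h ▸ rfl)).resolve_right fun h => hpq h.1, fun v hv => by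
      by_contra hvC
      refine hvC ⟨(v, w₀), hC.2 _ fun c hc _ => Or.inl (hv c.1 ⟨c, hc, rfl⟩ ?_), rfl⟩
      rintro rfl
      exact hvC ⟨c, hc, rfl⟩⟩)
    (maximal_isIndepSet_iff.2 ⟨by
      rintro _ ⟨p, hp, rfl⟩ _ ⟨q, hq, rfl⟩ hpq h
      exact hS.1 hp hq (fun h => hpq (h ▸ rfl)) (Or.inl h), fun v hv => by
      by_contra hvS
      have hne : ∀ c ∈ S, v ≠ c.1 := by
        rintro c hc rfl
        exact hvS ⟨c, hc, rfl⟩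
      refine hvS ⟨(v, w₀), hS.2 _ fun c hc _ h => ?_, rfl⟩
      rcases h with h | h
      exacts [hv c.1 ⟨c, hc, rfl⟩ (hne c hc) h, hne c hc h.1]⟩)
  obtain rfl : g' = g := hg
  obtain ⟨w, hw, hw'⟩ := hH {w | (g', w) ∈ C} {w | (g', w) ∈ S}
    (maximal_isClique_iff.2 ⟨by
      intro u hu v hv huv
      exact ((hC.1 hu hv fun h => huv (congrArg Prod.snd h)).resolve_left
        fun h => h.ne rfl).2, fun v hv => by
      refine hC.2 _ fun d hd hvd => ?_
      by_cases hd1 : d.1 = g'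
      · refine Or.inr ⟨hd1.symm, hv d.2 (by rw [← hd1]; exact hd) fun h => hvd ?_⟩
        exact Prod.ext hd1.symm h
      · rcases hC.1 hc hd (fun h => hd1 (congrArg Prod.fst h).symm) with h | h
        exacts [Or.inl h, (hd1 h.1.symm).elim]⟩)
    (maximal_isIndepSet_iff.2 ⟨by
      intro u hu v hv huv h
      exact hS.1 hu hv (fun h => huv (congrArg Prod.snd h)) (Or.inr ⟨rfl, h⟩), fun v hv => by
      refine hS.2 _ fun d hd hvd => ?_
      rintro (h | ⟨h, h'⟩)
      · exact hS.1 hs hd (fun h1 => h.ne (show g' = d.1 from congrArg Prod.fst h1)) (Or.inl h)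
      · change g' = d.1 at h
        exact hv d.2 (by rw [Set.mem_ofPred_eq, h]; exact hd) (fun h1 => hvd (Prod.ext h h1)) h'⟩)
  exact ⟨(g', w), hw, hw'⟩

theorem isCIS_completeBipartite {n : ℕ} (hn : 0 < n) :
    IsCIS (completeBipartiteGraph (Fin n) (Fin n)) := by
  have : Nonempty (Fin n) := ⟨⟨0, hn⟩⟩
  obtain ⟨e⟩ := nonempty_iso_lexProduct_empty (m := n) (G := completeBipartiteGraph (Fin n) (Fin n))
    (H := SimpleGraph.completeGraph Bool) Sum.isLeft
    (fun x => by
      cases x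
      · refine (congrArg card ?_).trans ((card_map Function.Embedding.inr).trans (card_fin n))
        ext u
        cases u <;> simp
      · refine (congrArg card ?_).trans ((card_map Function.Embedding.inl).trans (card_fin n))
        ext u
        cases u <;> simp)
    (fun u v => by cases u <;> cases v <;> simp)
  exact (isCIS_completeGraph.lexProduct isCIS_compl_completeGraph).of_iso e

theorem nonempty_cycleGraph_four_iso_completeBipartite :
    Nonempty (SimpleGraph.cycleGraph 4 ≃g completeBipartiteGraph (Fin 2) (Fin 2)) :=
  nonempty_iso_completeBipartite (m := 2) (G := SimpleGraph.cycleGraph 4)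
    (fun i => decide (i = 0 ∨ i = 2)) (by decide) (by decide)

theorem isCIS_cycleGraph_four : IsCIS (SimpleGraph.cycleGraph 4) := by
  obtain ⟨e⟩ := nonempty_cycleGraph_four_iso_completeBipartite
  exact (isCIS_completeBipartite two_pos).of_iso e

/-- The rook's graph. -/
def rookGraph (n : ℕ) : SimpleGraph (Fin n × Fin n) where
  Adj u v := u ≠ v ∧ (u.1 = v.1 ∨ u.2 = v.2)
  symm := ⟨fun _ _ h => ⟨h.1.symm, h.2.imp Eq.symm Eq.symm⟩⟩
  loopless := ⟨fun _ h => h.1 rfl⟩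

theorem nonempty_rookGraph_iso_lineGraph (n : ℕ) :
    Nonempty (rookGraph n ≃g (completeBipartiteGraph (Fin n) (Fin n)).lineGraph) :=
  nonempty_iso_lineGraph_completeBipartite (Equiv.refl _) fun _ _ => Iff.rfl

theorem isCIS_lineGraph_completeBipartite {n : ℕ} (hn : 0 < n) :
    IsCIS (completeBipartiteGraph (Fin n) (Fin n)).lineGraph := by
  obtain ⟨e⟩ := nonempty_rookGraph_iso_lineGraph n
  refine IsCIS.of_iso e.symm fun C S hC hS => ?_
  rw [maximal_isClique_iff] at hC
  rw [maximal_isIndepSet_iff] at hS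
  -- If row i is missed, each (i, j) is blocked by its column, so every column contains a vertex of
  -- S. These n vertices lie in distinct rows, hence in all rows.
  have hrow : ∀ i, ∃ s ∈ S, s.1 = i := by
    intro i
    by_contra! hcon
    have hdom : ∀ j, ∃ s ∈ S, s.2 = j := by
      intro j
      by_contra! hj
      exact hcon (i, j) (hS.2 (i, j) fun c hc _ h1 => by
        rcases h1.2 with h2 | h2
        exacts [hcon c hc h2.symm, hj c hc h2.symm]) rfl
    choose σ hσS hσ using hdom
    have hinj : Function.Injective fun j => (σ j).1 := by
      intro j k hjk
      by_contra hne
      have hne' : σ j ≠ σ k := fun h1 => hne (by rw [← hσ j, h1, hσ k])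
      exact hS.1 (hσS j) (hσS k) hne' ⟨hne', Or.inl hjk⟩
    obtain ⟨j, hj⟩ := (Finite.injective_iff_surjective.1 hinj) i
    exact hcon (σ j) (hσS j) hj
  have hcol : ∀ j, ∃ s ∈ S, s.2 = j := by
    intro j
    by_contra! hcon
    choose σ hσS hσ using hrow
    have hinj : Function.Injective fun i => (σ i).2 := by
      intro i k hik
      by_contra hne
      have hne' : σ i ≠ σ k := fun h1 => hne (by rw [← hσ i, h1, hσ k])
      exact hS.1 (hσS i) (hσS k) hne' ⟨hne', Or.inr hik⟩
    obtain ⟨i, hi⟩ := (Finite.injective_iff_surjective.1 hinj) j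
    exact hcon (σ i) (hσS i) hi
  by_cases hex : ∃ c ∈ C, ∃ d ∈ C, c.1 ≠ d.1
  · obtain ⟨c, hc, d, hd, hcd⟩ := hex
    have hcd2 : c.2 = d.2 := (hC.1 hc hd fun h1 => hcd (h1 ▸ rfl)).2.resolve_left hcd
    have hall : ∀ e ∈ C, e.2 = c.2 := by
      intro e he
      by_contra hne
      have h1 := (hC.1 he hc fun h1 => hne (h1 ▸ rfl)).2.resolve_right hne
      have h2 := (hC.1 he hd fun h1 => hne (h1 ▸ hcd2.symm)).2.resolve_right
        fun h2 => hne (h2.trans hcd2.symm)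
      exact hcd (h1.symm.trans h2)
    obtain ⟨s, hs, hsc⟩ := hcol c.2
    exact ⟨s, hC.2 s fun e he hse => ⟨hse, Or.inr (hsc.trans (hall e he).symm)⟩, hs⟩
  · push Not at hex
    obtain ⟨i, hi⟩ : ∃ i : Fin n, ∀ e ∈ C, e.1 = i := by
      by_cases hne : C.Nonempty
      · obtain ⟨c, hc⟩ := hne
        exact ⟨c.1, fun e he => hex e he c hc⟩
      · exact ⟨⟨0, hn⟩, fun e he => (hne ⟨e, he⟩).elim⟩
    obtain ⟨s, hs, hsi⟩ := hrow i
    exact ⟨s, hC.2 s fun e he hse => ⟨hse, Or.inl (hsi.trans (hi e he).symm)⟩, hs⟩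

end Constructions

/-! ### The graphs Q_n are connected, vertex-transitive, 7-valent and CIS. -/

section GraphQ

variable {n : ℕ}

theorem graphQ_adj_of_fst_eq {p q : ZMod n × ZMod 2 × ZMod 2} (h : p.1 = q.1) (hne : p ≠ q) :
    (graphQ n).Adj p q := graphQ_adj.2 ⟨hne, Or.inl h⟩

theorem zmod_add_one_ne (hn : 4 ≤ n) (i : ZMod n) : i + 1 ≠ i := by
  intro h
  have h1 : ((1 : ℕ) : ZMod n) = 0 := by push_cast; simpa using h
  rw [ZMod.natCast_eq_zero_iff] at h1
  exact absurd (Nat.le_of_dvd one_pos h1) (by omega)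

theorem zmod_add_two_ne (hn : 4 ≤ n) (i : ZMod n) : i + 1 + 1 ≠ i := by
  intro h
  have h1 : ((2 : ℕ) : ZMod n) = 0 := by
    push_cast; rw [add_assoc] at h; norm_num at h; exact h
  rw [ZMod.natCast_eq_zero_iff] at h1
  exact absurd (Nat.le_of_dvd two_pos h1) (by omega)

theorem zmod_add_three_ne (hn : 4 ≤ n) (i : ZMod n) : i + 1 + 1 + 1 ≠ i := by
  intro h
  have h1 : ((3 : ℕ) : ZMod n) = 0 := by
    push_cast; rw [add_assoc, add_assoc] at h; norm_num at h; exact h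
  rw [ZMod.natCast_eq_zero_iff] at h1
  exact absurd (Nat.le_of_dvd three_pos h1) (by omega)

theorem graphQ_connected (hn : 4 ≤ n) : (graphQ n).Connected := by
  have : NeZero n := ⟨by omega⟩
  rw [SimpleGraph.connected_iff_exists_forall_reachable]
  have hlayer : ∀ p q : ZMod n × ZMod 2 × ZMod 2, p.1 = q.1 → (graphQ n).Reachable p q := by
    intro p q hpq
    by_cases hne : p = q
    · rw [hne]
    · exact (graphQ_adj_of_fst_eq hpq hne).reachable
  have key : ∀ k : ℕ, ∀ x, (graphQ n).Reachable (0, 0, 0) ((k : ZMod n), x) := by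
    intro k
    induction k with
    | zero => exact fun x => hlayer _ _ (by simp)
    | succ k ih =>
      intro x
      have h1 : (graphQ n).Adj ((k : ZMod n), 0, 0) ((k : ZMod n) + 1, 0, 0) := by
        rw [graphQ_adj]
        exact ⟨fun h => zmod_add_one_ne hn k (congrArg Prod.fst h).symm, Or.inr (Or.inl ⟨rfl, rfl⟩)⟩
      exact ((ih (0, 0)).trans h1.reachable).trans (hlayer _ _ (by push_cast; rfl))
  refine ⟨(0, 0, 0), fun q => ?_⟩
  have := key q.1.val q.2
  rwa [ZMod.natCast_zmod_val] at this

theorem graphQ_isVertexTransitive (hn : 4 ≤ n) : IsVertexTransitive (graphQ n) := by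
  intro u v
  let c := v.1 - u.1
  -- A vertex (i, x, y) carries a bit on link i and a bit on link i + 1. Adding f to the link bits
  -- preserves matching of labels, and only the two links at u need adjusting after the shift by c.
  let f : ZMod n → ZMod 2 := fun i =>
    if i = u.1 then v.2.1 - u.2.1 else if i = u.1 + 1 then v.2.2 - u.2.2 else 0
  let e : ZMod n × ZMod 2 × ZMod 2 ≃ ZMod n × ZMod 2 × ZMod 2 :=
    { toFun := fun p => (p.1 + c, p.2.1 + f p.1, p.2.2 + f (p.1 + 1))
      invFun := fun p => (p.1 - c, p.2.1 - f (p.1 - c), p.2.2 - f (p.1 - c + 1))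
      left_inv := fun p => by simp
      right_inv := fun p => by simp }
  have he : ∀ p, e p = (p.1 + c, p.2.1 + f p.1, p.2.2 + f (p.1 + 1)) := fun p => rfl
  refine ⟨⟨e, fun {p q} => ?_⟩, ?_⟩
  · rw [graphQ_adj, graphQ_adj, e.injective.ne_iff, he, he]
    have h1 : ∀ i j : ZMod n, i + c = j + c + 1 ↔ i = j + 1 := fun i j => by
      rw [add_right_comm, add_left_inj]
    simp only [add_left_inj, h1]
    refine and_congr_right fun _ => or_congr_right (or_congr ?_ ?_) <;>
      refine and_congr_right fun h2 => ?_ <;> rw [h2, add_left_inj]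
  · change e u = v
    rw [he]
    simp [f, c, zmod_add_one_ne hn]

theorem graphQ_hasValency (hn : 4 ≤ n) : HasValency (graphQ n) 7 := by
  rintro ⟨i, x, y⟩
  have h1 := zmod_add_one_ne hn i
  have h2 := zmod_add_one_ne hn (i - 1)
  have h3 := zmod_add_two_ne hn (i - 1)
  rw [sub_add_cancel] at h2 h3
  have hz : ∀ a b : ZMod 2, a = b ∨ a = b + 1 := by decide
  have hz' : ∀ b : ZMod 2, b + 1 ≠ b := by decide
  have hz1 : (1 : ZMod 2) ≠ 0 := by decide
  have heq : (graphQ n).neighborSet (i, x, y) = (({(i, x + 1, y), (i, x, y + 1), (i, x + 1, y + 1),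
      (i + 1, y, 0), (i + 1, y, 1), (i - 1, 0, x), (i - 1, 1, x)} :
      Finset (ZMod n × ZMod 2 × ZMod 2)) : Set _) := by
    ext ⟨j, u, v⟩
    rw [SimpleGraph.mem_neighborSet, graphQ_adj]
    simp only [coe_insert, coe_singleton, Set.mem_insert_iff, Set.mem_singleton_iff, Prod.mk.injEq,
      ne_eq]
    have e1 : i = j + 1 ↔ j = i - 1 := by rw [eq_sub_iff_add_eq, eq_comm]
    rw [e1]
    have e2 := hz u 0
    have e3 := hz v 0
    have e4 := hz u x
    have e5 := hz v y
    have e6 := hz' x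
    have e7 := hz' y
    rw [zero_add] at e2 e3
    constructor
    · rintro ⟨h4, h5 | ⟨h5, h6⟩ | ⟨h5, h6⟩⟩
      · subst h5
        rcases e4 with rfl | rfl <;> rcases e5 with rfl | rfl <;> simp_all
      · subst h5 h6
        rcases e3 with rfl | rfl <;> simp
      · subst h5 h6
        rcases e2 with rfl | rfl <;> simp
    · rintro (⟨rfl, rfl, rfl⟩ | ⟨rfl, rfl, rfl⟩ | ⟨rfl, rfl, rfl⟩ | ⟨rfl, rfl, rfl⟩ |
        ⟨rfl, rfl, rfl⟩ | ⟨rfl, rfl, rfl⟩ | ⟨rfl, rfl, rfl⟩) <;> simp_all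
  rw [heq, Set.encard_coe_eq_coe_finsetCard]
  norm_cast
  rw [card_insert_of_notMem, card_insert_of_notMem, card_insert_of_notMem, card_insert_of_notMem,
    card_insert_of_notMem, card_pair] <;>
    simp [h2, h3, h1.symm, hz']

/-- A maximal stable set has exactly one vertex in each layer. A maximal clique is a layer, or
consists of the vertices on both sides of a link with a given bit. In the latter case the two chosen
vertices carry opposite bits on that link, so one of them is in the clique. -/
theorem graphQ_isCIS (hn : 4 ≤ n) : IsCIS (graphQ n) := by
  intro C S hC hS
  rw [maximal_isClique_iff] at hC
  rw [maximal_isIndepSet_iff] at hS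
  have hz : ∀ a b c : ZMod 2, a ≠ b → c = a ∨ c = b := by decide
  have hz' : ∀ b : ZMod 2, b ≠ b + 1 := by decide
  have huniq : ∀ s ∈ S, ∀ t ∈ S, s.1 = t.1 → s = t := by
    intro s hs t ht hst
    by_contra hne
    exact hS.1 hs ht hne (graphQ_adj_of_fst_eq hst hne)
  have hlayer : ∀ i, ∃ s ∈ S, s.1 = i := by
    intro i
    by_contra! hcon
    -- The previous layer contains at most one vertex of S, so one of the two bits avoids it; the
    -- value 0 serves when there is none. The same holds for y and the next layer.
    obtain ⟨x, hx⟩ : ∃ x, ∀ s ∈ S, i = s.1 + 1 → s.2.2 ≠ x := by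
      by_cases hs : ∃ s ∈ S, i = s.1 + 1
      · obtain ⟨s, hs, hsi⟩ := hs
        refine ⟨s.2.2 + 1, fun t ht hti => ?_⟩
        obtain rfl := huniq s hs t ht (add_right_cancel (hsi.symm.trans hti))
        exact hz' _
      · push Not at hs
        exact ⟨0, fun s hs1 hsi => (hs s hs1 hsi).elim⟩
    obtain ⟨y, hy⟩ : ∃ y, ∀ s ∈ S, s.1 = i + 1 → s.2.1 ≠ y := by
      by_cases hs : ∃ s ∈ S, s.1 = i + 1
      · obtain ⟨s, hs, hsi⟩ := hs
        refine ⟨s.2.1 + 1, fun t ht hti => ?_⟩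
        obtain rfl := huniq s hs t ht (hsi.trans hti.symm)
        exact hz' _
      · push Not at hs
        exact ⟨0, fun s hs1 hsi => (hs s hs1 hsi).elim⟩
    refine hcon (i, x, y) (hS.2 (i, x, y) fun s hs _ h1 => ?_) rfl
    rcases (graphQ_adj.1 h1).2 with h2 | ⟨h2, h3⟩ | ⟨h2, h3⟩
    exacts [hcon s hs h2.symm, hy s hs h2 h3, hx s hs h2 h3.symm]
  by_cases hex : ∃ c ∈ C, ∃ d ∈ C, d.1 = c.1 + 1
  · obtain ⟨c, hc, d, hd, hcd⟩ := hex
    have hne : c.1 ≠ d.1 := fun h => zmod_add_one_ne hn c.1 (hcd.symm.trans h.symm)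
    have hy : d.2.1 = c.2.2 := by
      have h1 := (graphQ_adj.1 (hC.1 hc hd fun h => hne (congrArg Prod.fst h))).2
      rcases h1 with h2 | ⟨-, h2⟩ | ⟨h2, -⟩
      · exact (hne h2).elim
      · exact h2
      · rw [hcd] at h2
        exact (zmod_add_two_ne hn _ h2.symm).elim
    have hnb : ∀ e ∈ C, ∀ f ∈ C, e.1 = f.1 ∨ (f.1 = e.1 + 1 ∧ f.2.1 = e.2.2) ∨
        (e.1 = f.1 + 1 ∧ e.2.1 = f.2.2) := by
      intro e he f hf
      by_cases hef : e = f
      · exact Or.inl (hef ▸ rfl)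
      · exact (graphQ_adj.1 (hC.1 he hf hef)).2
    have hall : ∀ e ∈ C, (e.1 = c.1 ∧ e.2.2 = c.2.2) ∨ (e.1 = d.1 ∧ e.2.1 = c.2.2) := by
      intro e he
      have h1 := hnb e he c hc
      have h2 := hnb e he d hd
      have t1 := zmod_add_one_ne hn
      have t2 := zmod_add_two_ne hn
      have t3 := zmod_add_three_ne hn
      rw [hcd] at h2
      rw [hcd]
      rcases h1 with h1 | ⟨h1, h1'⟩ | ⟨h1, h1'⟩
      · left
        refine ⟨h1, ?_⟩
        rw [h1] at h2
        rcases h2 with h2 | ⟨h2, h2'⟩ | ⟨h2, h2'⟩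
        · exact (t1 _ h2.symm).elim
        · rw [← h2', hy]
        · exact (t2 _ h2.symm).elim
      · rw [h1] at h2
        rcases h2 with h2 | ⟨h2, -⟩ | ⟨h2, -⟩
        · exact (t2 _ h2.symm).elim
        · exact (t1 _ (add_right_cancel h2)).elim
        · exact (t3 _ h2.symm).elim
      · exact Or.inr ⟨h1, h1'⟩
    have hmem : ∀ e : ZMod n × ZMod 2 × ZMod 2,
        (e.1 = c.1 ∧ e.2.2 = c.2.2) ∨ (e.1 = d.1 ∧ e.2.1 = c.2.2) → e ∈ C := by
      intro e he
      refine hC.2 e fun f hf hef => graphQ_adj.2 ⟨hef, ?_⟩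
      rcases he with ⟨h1, h2⟩ | ⟨h1, h2⟩ <;> rcases hall f hf with ⟨h3, h4⟩ | ⟨h3, h4⟩
      · exact Or.inl (h1.trans h3.symm)
      · exact Or.inr (Or.inl ⟨by rw [h1, h3, hcd], h4.trans h2.symm⟩)
      · exact Or.inr (Or.inr ⟨by rw [h1, h3, hcd], h2.trans h4.symm⟩)
      · exact Or.inl (h1.trans h3.symm)
    obtain ⟨s, hs, hsc⟩ := hlayer c.1
    obtain ⟨t, ht, htd⟩ := hlayer d.1
    have hst : t.2.1 ≠ s.2.2 := by
      intro h1
      have hne' : s ≠ t := fun h => hne (by rw [← hsc, ← htd, h])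
      exact hS.1 hs ht hne' (graphQ_adj.2 ⟨hne', Or.inr (Or.inl ⟨by rw [hsc, htd, hcd], h1⟩)⟩)
    rcases hz _ _ c.2.2 hst with h1 | h1
    · exact ⟨t, hmem t (Or.inr ⟨htd, h1.symm⟩), ht⟩
    · exact ⟨s, hmem s (Or.inl ⟨hsc, h1.symm⟩), hs⟩
  · push Not at hex
    obtain ⟨i, hi⟩ : ∃ i : ZMod n, ∀ e ∈ C, e.1 = i := by
      by_cases hne : C.Nonempty
      · obtain ⟨c, hc⟩ := hne
        refine ⟨c.1, fun e he => ?_⟩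
        by_contra hec
        rcases (graphQ_adj.1 (hC.1 he hc fun h => hec (h ▸ rfl))).2 with h1 | h1 | h1
        exacts [hec h1, hex e he c hc h1.1, hex c hc e he h1.1]
      · exact ⟨0, fun e he => (hne ⟨e, he⟩).elim⟩
    obtain ⟨s, hs, hsi⟩ := hlayer i
    exact ⟨s, hC.2 s fun e he hse => graphQ_adj_of_fst_eq (hsi.trans (hi e he).symm) hse, hs⟩

end GraphQ

/-- The connected vertex-transitive CIS graphs of valency at most seven, up to isomorphism, apart
from the graphs `Q_n`. -/
def IsSporadic {V : Type*} (G : SimpleGraph V) : Prop :=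
  (∃ n : ℕ, 1 ≤ n ∧ n ≤ 8 ∧ Nonempty (G ≃g SimpleGraph.completeGraph (Fin n))) ∨
  (∃ n : ℕ, 2 ≤ n ∧ n ≤ 7 ∧ Nonempty (G ≃g completeBipartiteGraph (Fin n) (Fin n))) ∨
  Nonempty (G ≃g (completeBipartiteGraph (Fin 3) (Fin 3)).lineGraph) ∨
  Nonempty (G ≃g (completeBipartiteGraph (Fin 4) (Fin 4)).lineGraph) ∨
  Nonempty (G ≃g lexProduct (SimpleGraph.cycleGraph 4) (SimpleGraph.completeGraph (Fin 2))) ∨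
  Nonempty (G ≃g lexProduct (SimpleGraph.completeGraph (Fin 3))
    (SimpleGraph.completeGraph (Fin 2))ᶜ) ∨
  Nonempty (G ≃g lexProduct (SimpleGraph.completeGraph (Fin 3))
    (SimpleGraph.completeGraph (Fin 3))ᶜ) ∨
  Nonempty (G ≃g lexProduct (SimpleGraph.completeGraph (Fin 4))
    (SimpleGraph.completeGraph (Fin 2))ᶜ) ∨
  Nonempty (G ≃g lexProduct (completeBipartiteGraph (Fin 3) (Fin 3))
    (SimpleGraph.completeGraph (Fin 2)))

/-! ### Assembling the classification. -/

section Classification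

variable {V : Type*} {G : SimpleGraph V} {k : ℕ}

theorem IsPureCIS.isSporadic_of_open_twins [Fintype V] [DecidableEq V] [DecidableRel G.Adj] {w : ℕ}
    (h : IsPureCIS G k w) (ho : ∀ v, ∃ u, u ≠ v ∧ ∀ x, G.Adj v x ↔ G.Adj u x) (hk : k ≤ 7) :
    IsSporadic G := by
  obtain ⟨m, hm, hwm, f, hf, hadj⟩ := h.completeMultipartite_of_open_twins ho hk
  -- From w m = k + m and m ≥ 2: w ≥ 5 would give k ≥ 4m ≥ 8.
  have hw : w ≤ 4 := by
    by_contra! hlt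
    have := Nat.mul_le_mul_right m hlt
    omega
  have hiso : Nonempty (G ≃g lexProduct (SimpleGraph.completeGraph (Fin w))
      (SimpleGraph.completeGraph (Fin m))ᶜ) :=
    nonempty_iso_lexProduct_empty f hf fun u v => by rw [hadj]; rfl
  obtain ⟨v⟩ := h.conn.nonempty
  interval_cases w
  · omega
  · obtain ⟨u, hu, -⟩ := ho v
    refine (hu ?_).elim
    exact h.eq_univ_of_closed (s := {v}) ⟨v, rfl⟩
      (fun a _ b hab => ((hadj a b).1 hab (Subsingleton.elim _ _)).elim) u
  · right; left
    refine ⟨m, hm, by omega, nonempty_iso_completeBipartite (fun v => decide (f v = 0)) ?_ ?_⟩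
    · rintro (_ | _)
      · rw [← hf 1]
        congr 1
        ext u
        simp
        omega
      · rw [← hf 0]
        simp
    · intro u v
      rw [hadj, ne_eq, ne_eq, decide_eq_decide]
      omega
  · obtain rfl | rfl : m = 2 ∨ m = 3 := by omega
    · exact Or.inr (Or.inr (Or.inr (Or.inr (Or.inr (Or.inl hiso)))))
    · exact Or.inr (Or.inr (Or.inr (Or.inr (Or.inr (Or.inr (Or.inl hiso))))))
  · obtain rfl : m = 2 := by omega
    exact Or.inr (Or.inr (Or.inr (Or.inr (Or.inr (Or.inr (Or.inr (Or.inl hiso)))))))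

theorem IsPureCIS.isSporadic_of_closed_twins [Fintype V] [DecidableEq V] [DecidableRel G.Adj]
    {w : ℕ} (h : IsPureCIS G k w) (hvt : IsVertexTransitive G)
    (ho : ∀ u v, (∀ x, G.Adj u x ↔ G.Adj v x) → u = v) (hc : ∃ u v, ClosedTwin G u v ∧ u ≠ v)
    (hk : k ≤ 7) (hG : G ≠ ⊤) : IsSporadic G := by
  classical
  obtain ⟨u, v, huv, hne⟩ := hc
  let cl : V → Finset V := fun v => univ.filter (ClosedTwin G v)
  have hcl : ∀ u v, v ∈ cl u ↔ ClosedTwin G u v := fun u v => by simp [cl]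
  have hm : ∀ v, (cl v).card = (cl u).card := by
    intro v
    obtain ⟨φ, rfl⟩ := hvt u v
    refine (card_bij (fun x _ => φ x) (fun x hx => ?_) (fun x _ y _ hxy => φ.injective hxy)
      fun y hy => ?_).symm
    · rw [hcl] at hx ⊢
      intro y
      obtain ⟨y, rfl⟩ := φ.surjective y
      simpa only [φ.injective.eq_iff, φ.map_adj_iff] using hx y
    · obtain ⟨y, rfl⟩ := φ.surjective y
      refine ⟨y, ?_, rfl⟩
      rw [hcl] at hy ⊢
      intro x
      simpa only [φ.injective.eq_iff, φ.map_adj_iff] using hy (φ x)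
  have hm2 : 2 ≤ (cl u).card :=
    one_lt_card.2 ⟨u, (hcl u u).2 (.refl u), v, (hcl u v).2 huv, hne⟩
  obtain ⟨j, rfl | rfl, ⟨e⟩⟩ := h.lexProduct_of_closed_twins ho hcl hm hm2 hk hG
  · obtain ⟨e₁⟩ := nonempty_cycleGraph_four_iso_completeBipartite
    obtain ⟨e₂⟩ := lexProduct_iso_left (SimpleGraph.completeGraph (Fin 2)) e₁
    exact Or.inr (Or.inr (Or.inr (Or.inr (Or.inl ⟨e.trans e₂.symm⟩))))
  · exact Or.inr (Or.inr (Or.inr (Or.inr (Or.inr (Or.inr (Or.inr (Or.inr ⟨e⟩)))))))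

theorem IsCIS.isSporadic_or_nonempty_iso_graphQ [Finite V] (hcis : IsCIS G) (hconn : G.Connected)
    (hvt : IsVertexTransitive G) (hval : HasValency G k) (hk : k ≤ 7) :
    IsSporadic G ∨ ∃ n : ℕ, 4 ≤ n ∧ Nonempty (G ≃g graphQ n) := by
  classical
  have := Fintype.ofFinite V
  obtain ⟨w, h⟩ := hcis.exists_isPureCIS hconn hvt hval
  by_cases hG : G = ⊤
  · obtain ⟨v⟩ := hconn.nonempty
    have hcard : Fintype.card V ≤ 8 := by
      have h1 : G.neighborFinset v = univ.erase v := by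
        ext x
        simp [hG, eq_comm]
      have h2 := h.deg v
      rw [h1, card_erase_of_mem (mem_univ v), card_univ] at h2
      omega
    subst hG
    exact Or.inl (Or.inl ⟨Fintype.card V, Fintype.card_pos_iff.2 ⟨v⟩, hcard,
      ⟨SimpleGraph.Iso.completeGraph (Fintype.equivFin V)⟩⟩)
  by_cases ho : ∀ u v, (∀ x, G.Adj u x ↔ G.Adj v x) → u = v
  · by_cases hc : ∀ u v, ClosedTwin G u v → u = v
    · rcases h.lineGraph_or_valency_seven ho hc hk hG with h1 | h1 | ⟨rfl, rfl⟩
      · exact Or.inl (Or.inr (Or.inr (Or.inl h1)))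
      · exact Or.inl (Or.inr (Or.inr (Or.inr (Or.inl h1))))
      · exact Or.inr ((h.isLocallyQ ho hc).nonempty_iso_graphQ hconn)
    · push Not at hc
      exact Or.inl (h.isSporadic_of_closed_twins hvt ho hc hk hG)
  · push Not at ho
    obtain ⟨u, v, huv, hne⟩ := ho
    refine Or.inl (h.isSporadic_of_open_twins (fun x => ?_) hk)
    obtain ⟨φ, rfl⟩ := hvt u x
    refine ⟨φ v, fun h1 => hne (φ.injective h1).symm, fun y => ?_⟩
    obtain ⟨y, rfl⟩ := φ.surjective y
    rw [φ.map_adj_iff, φ.map_adj_iff, huv]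

theorem IsSporadic.isCIS (h : IsSporadic G) : IsCIS G := by
  rcases h with ⟨n, hn, -, ⟨e⟩⟩ | ⟨n, hn, -, ⟨e⟩⟩ | ⟨⟨e⟩⟩ | ⟨⟨e⟩⟩ | ⟨⟨e⟩⟩ | ⟨⟨e⟩⟩ | ⟨⟨e⟩⟩ | ⟨⟨e⟩⟩ |
      ⟨⟨e⟩⟩ <;>
    refine IsCIS.of_iso e ?_
  · have : Nonempty (Fin n) := ⟨⟨0, hn⟩⟩
    exact isCIS_completeGraph
  · exact isCIS_completeBipartite (by omega)
  · exact isCIS_lineGraph_completeBipartite three_pos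
  · exact isCIS_lineGraph_completeBipartite four_pos
  · exact isCIS_cycleGraph_four.lexProduct isCIS_completeGraph
  · exact isCIS_completeGraph.lexProduct isCIS_compl_completeGraph
  · exact isCIS_completeGraph.lexProduct isCIS_compl_completeGraph
  · exact isCIS_completeGraph.lexProduct isCIS_compl_completeGraph
  · exact (isCIS_completeBipartite three_pos).lexProduct isCIS_completeGraph

theorem IsSporadic.card_le (h : IsSporadic G) : Nat.card V ≤ 16 := by
  rcases h with ⟨n, -, hn, ⟨e⟩⟩ | ⟨n, -, hn, ⟨e⟩⟩ | ⟨⟨e⟩⟩ | ⟨⟨e⟩⟩ | ⟨⟨e⟩⟩ | ⟨⟨e⟩⟩ | ⟨⟨e⟩⟩ | ⟨⟨e⟩⟩ |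
      ⟨⟨e⟩⟩
  · rw [Nat.card_congr e.toEquiv, Nat.card_fin]
    omega
  · rw [Nat.card_congr e.toEquiv, Nat.card_sum, Nat.card_fin]
    omega
  · obtain ⟨e'⟩ := nonempty_rookGraph_iso_lineGraph 3
    rw [Nat.card_congr (e.trans e'.symm).toEquiv]
    simp
  · obtain ⟨e'⟩ := nonempty_rookGraph_iso_lineGraph 4
    rw [Nat.card_congr (e.trans e'.symm).toEquiv]
    simp
  all_goals
    rw [Nat.card_congr e.toEquiv]
    simp

theorem HasValency.eq_of_iso {W : Type*} {H : SimpleGraph W} {l : ℕ} [Nonempty V]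
    (hG : HasValency G k) (hH : HasValency H l) (e : G ≃g H) : k = l := by
  obtain ⟨v⟩ := ‹Nonempty V›
  have h1 : (G.neighborSet v).encard = (H.neighborSet (e v)).encard :=
    Set.encard_congr (e.mapNeighborSet v)
  rw [hG, hH] at h1
  exact_mod_cast h1

end Classification

end CISGraph

theorem mainTheorem2 :
    -- the classification
    (∀ {V : Type*} [Finite V] (G : SimpleGraph V) (k : ℕ),
      G.Connected → CISGraph.IsVertexTransitive G → CISGraph.HasValency G k → k ≤ 7 →
      (CISGraph.IsCIS G ↔
        (∃ n : ℕ, 1 ≤ n ∧ n ≤ 8 ∧ Nonempty (G ≃g SimpleGraph.completeGraph (Fin n))) ∨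
        (∃ n : ℕ, 2 ≤ n ∧ n ≤ 7 ∧ Nonempty (G ≃g completeBipartiteGraph (Fin n) (Fin n))) ∨
        Nonempty (G ≃g (completeBipartiteGraph (Fin 3) (Fin 3)).lineGraph) ∨
        Nonempty (G ≃g (completeBipartiteGraph (Fin 4) (Fin 4)).lineGraph) ∨
        Nonempty (G ≃g
          CISGraph.lexProduct (SimpleGraph.cycleGraph 4) (SimpleGraph.completeGraph (Fin 2))) ∨
        Nonempty (G ≃g
          CISGraph.lexProduct (SimpleGraph.completeGraph (Fin 3)) (SimpleGraph.completeGraph (Fin 2))ᶜ) ∨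
        Nonempty (G ≃g
          CISGraph.lexProduct (SimpleGraph.completeGraph (Fin 3)) (SimpleGraph.completeGraph (Fin 3))ᶜ) ∨
        Nonempty (G ≃g
          CISGraph.lexProduct (SimpleGraph.completeGraph (Fin 4)) (SimpleGraph.completeGraph (Fin 2))ᶜ) ∨
        Nonempty (G ≃g
          CISGraph.lexProduct (completeBipartiteGraph (Fin 3) (Fin 3)) (SimpleGraph.completeGraph (Fin 2))) ∨
        (∃ n : ℕ, 4 ≤ n ∧ Nonempty (G ≃g CISGraph.graphQ n)))) ∧
    -- up to isomorphism there are only finitely many examples of valency at most 6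
    (∃ L : Finset (Σ n : ℕ, SimpleGraph (Fin n)),
      ∀ {V : Type*} [Finite V] (G : SimpleGraph V) (k : ℕ),
        G.Connected → CISGraph.IsVertexTransitive G → CISGraph.HasValency G k → k ≤ 6 →
        CISGraph.IsCIS G → ∃ H ∈ L, Nonempty (G ≃g H.2)) ∧
    -- the graphs `Q_n`, `n ≥ 4`, form an infinite family of examples of valency 7
    (∀ n : ℕ, 4 ≤ n →
      (CISGraph.graphQ n).Connected ∧ CISGraph.IsVertexTransitive (CISGraph.graphQ n) ∧
      CISGraph.HasValency (CISGraph.graphQ n) 7 ∧ CISGraph.IsCIS (CISGraph.graphQ n)) ∧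
    (∀ m n : ℕ, 4 ≤ m → 4 ≤ n →
      Nonempty (CISGraph.graphQ m ≃g CISGraph.graphQ n) → m = n) := by
  classical
  refine ⟨fun {V} _ G k hconn hvt hval hk => ?_,
    -- All graphs on at most 16 vertices: this bounds the sporadic graphs, and Q_n is ruled out by
    -- its valency 7.
    ⟨(Finset.range 17).sigma fun _ => Finset.univ, fun {V} _ G k hconn hvt hval hk hcis => ?_⟩,
    fun n hn => ⟨CISGraph.graphQ_connected hn, CISGraph.graphQ_isVertexTransitive hn,
      CISGraph.graphQ_hasValency hn, CISGraph.graphQ_isCIS hn⟩, fun m n hm hn h => ?_⟩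
  · have h1 : CISGraph.IsCIS G ↔
        CISGraph.IsSporadic G ∨ ∃ n : ℕ, 4 ≤ n ∧ Nonempty (G ≃g CISGraph.graphQ n) := by
      refine ⟨fun hcis => hcis.isSporadic_or_nonempty_iso_graphQ hconn hvt hval hk, ?_⟩
      rintro (h | ⟨n, hn, ⟨e⟩⟩)
      exacts [h.isCIS, (CISGraph.graphQ_isCIS hn).of_iso e]
    rw [h1, CISGraph.IsSporadic]
    simp only [or_assoc]
  · have := Fintype.ofFinite V
    have := hconn.nonempty
    rcases hcis.isSporadic_or_nonempty_iso_graphQ hconn hvt hval (by omega) with h | ⟨n, hn, ⟨e⟩⟩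
    · have hcard := h.card_le
      rw [Nat.card_eq_fintype_card] at hcard
      exact ⟨⟨Fintype.card V, G.overFin rfl⟩, by simp; omega, ⟨G.overFinIso rfl⟩⟩
    · have := hval.eq_of_iso (CISGraph.graphQ_hasValency hn) e
      omega
  · obtain ⟨e⟩ := h
    -- The order 4n of Q_n determines n.
    have h1 := Nat.card_congr e.toEquiv
    simp only [Nat.card_prod, Nat.card_zmod] at h1
    omega
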